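/- Let $d\ge 1$ be an integer and $T>0$. There exist $k_1,k_2\in\mathbb R^d$ and $\alpha_1,\alpha_2\in C_0^\infty(\mathbb R^d;\mathbb C)$ with disjoint supports such that the following holds. For every $\varepsilon\in(0,1]$, the Cauchy problems $$i\varepsilon\partial_t u^\varepsilon+\tfrac{\varepsilon^2}{2}\Delta u^\varepsilon=\varepsilon|u^\varepsilon|^2u^\varepsilon,\qquad u^\varepsilon(0,x)=\alpha_1(x)e^{ik_1\cdot x/\varepsilon}+\alpha_2(x)e^{ik_2\cdot x/\varepsilon},$$ and, for $j=1,2$, $$i\varepsilon\partial_t u_j^\varepsilon+\tfrac{\varepsilon^2}{2}\Delta u_j^\varepsilon=\varepsilon|u_j^\varepsilon|^2u_j^\varepsilon,\qquad u_j^\varepsilon(0,x)=\alpha_j(x)e^{ik_j\cdot x/\varepsilon},$$ each have a unique solution in $C([0,T];H^\infty(\mathbb R^d))$, where $H^\infty(\mathbb R^d)=\bigcap_{s>0}H^s(\mathbb R^d)$, and these solutions satisfy $$\liminf_{\varepsilon\to0^+}\ \sup_{t\in[0,T]}\bigl\|u^\varepsilon(t)-u_1^\varepsilon(t)-u_2^\varepsilon(t)\bigr\|_{L^p(\mathbb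 R^d)}>0\qquad\text{for all } p\in[2,\infty].$$ -/

import Mathlib

open Filter Topology MeasureTheory
open scoped ENNReal ContDiff

noncomputable section

namespace WeakNLS

/-- The Sobolev space `H^∞(ℝᵈ) = ⋂ₛ Hˢ(ℝᵈ)`, its elements being represented by their smooth
representatives: `f` is smooth and all its derivatives are square integrable. -/
def MemHInfty {d : ℕ} (f : EuclideanSpace ℝ (Fin d) → ℂ) : Prop :=
  ContDiff ℝ ∞ f ∧ ∀ n : ℕ, MemLp (iteratedFDeriv ℝ n f) 2 volume

/-- `u ∈ C([0,T]; H^∞(ℝᵈ))`: every `u(t)` is in `H^∞`, and `t ↦ u(t)` is continuous on `[0,T]`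
for each of the seminorms `f ↦ ‖Dⁿ f‖_{L²}`, `n ≥ 0`, which generate the topology of `H^∞`. -/
def MemCHInfty {d : ℕ} (T : ℝ) (u : ℝ → EuclideanSpace ℝ (Fin d) → ℂ) : Prop :=
  (∀ t ∈ Set.Icc 0 T, MemHInfty (u t)) ∧
  ∀ n : ℕ, ∀ t ∈ Set.Icc 0 T,
    Tendsto (fun s => eLpNorm (iteratedFDeriv ℝ n (u s - u t)) 2 volume)
      (𝓝[Set.Icc 0 T] t) (𝓝 0)

/-- `u ∈ C([0,T]; H^∞(ℝᵈ))` solves the Cauchy problem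
`i ε ∂ₜu + (ε²/2) Δu = ε |u|² u` on `[0,T] × ℝᵈ`, `u(0) = u₀`
(the time derivative is one-sided at `t = 0` and `t = T`). -/
structure IsSolution {d : ℕ} (T ε : ℝ) (u₀ : EuclideanSpace ℝ (Fin d) → ℂ)
    (u : ℝ → EuclideanSpace ℝ (Fin d) → ℂ) : Prop where
  mem : MemCHInfty T u
  init : ∀ x, u 0 x = u₀ x
  eqn : ∀ t ∈ Set.Icc 0 T, ∀ x, ∃ v : ℂ,
    HasDerivWithinAt (fun s => u s x) v (Set.Icc 0 T) t ∧
    Complex.I * (ε : ℂ) * v + (ε : ℂ) ^ 2 / 2 * Laplacian.laplacian (u t) x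
      = (ε : ℂ) * ((‖u t x‖ : ℂ) ^ 2 * u t x)

/-- The Cauchy problem has one and only one solution in `C([0,T]; H^∞(ℝᵈ))`. Functions of time
are total here, so two solutions are only compared on `[0,T]`. -/
def HasUniqueSolution {d : ℕ} (T ε : ℝ) (u₀ : EuclideanSpace ℝ (Fin d) → ℂ) : Prop :=
  (∃ u, IsSolution T ε u₀ u) ∧
  ∀ u v, IsSolution T ε u₀ u → IsSolution T ε u₀ v → ∀ t ∈ Set.Icc 0 T, u t = v t

/-- The WKB state `α(x) e^{i k·x/ε}`. -/
def wkb {d : ℕ} (ε : ℝ) (α : EuclideanSpace ℝ (Fin d) → ℂ) (k : EuclideanSpace ℝ (Fin d)) :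
    EuclideanSpace ℝ (Fin d) → ℂ :=
  fun x => α x * Complex.exp (Complex.I * ((inner ℝ k x / ε : ℝ) : ℂ))

end WeakNLS

end

set_option linter.unusedSectionVars false

noncomputable section

namespace WeakNLS

/-! ### Convolutions, Young's inequality and submultiplicatively weighted Lebesgue norms. -/

section

variable {V : Type*} [NormedAddCommGroup V] [InnerProductSpace ℝ V] [FiniteDimensional ℝ V]
  [MeasurableSpace V] [BorelSpace V]

section LConvolution

/-! Disjoint supports at time zero do not prevent interaction: a wave `α e^{ik·x/ε}` travels at
velocity `k`, independently of `ε`. Take `k₁ = 0` and let the second packet start at distance 3 from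
the first, with `k₂` such that it arrives exactly at time `T`. After division by `ε` the equation
reads `i∂ₜu + (ε/2)Δu = |u|²u`, so the nonlinearity acts at order one over `[0, T]`. Of the cross
terms in `|u₁ + u₂|²(u₁ + u₂)`, the term `2|u₂|²u₁` carries no relative phase and survives as `ε →
0`; the others oscillate at frequencies of size `1/ε` and vanish weakly by Riemann–Lebesgue
(`cubic_add_sub_sub`, `tendsto_integral_cross`).

To turn this into a lower bound, test the difference at time `T` against a fixed bump `β` at the
origin. With profiles of amplitude `δ`, the first Duhamel iterate contributes in the limit a number
of modulus `2δ³J`, where `J > 0` is an overlap integral (`tendsto_integral_interaction`,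
`integral_overlap_pos`). The remainder of the Born approximation is `O(δ⁵)` uniformly in `ε`
(`norm_sub_born_le`), so a small `δ` leaves a positive amount (`exists_small_amplitude`). By Hölder
this bounds every `Lᵖ` norm from below (`eLpNorm_pos_of_le`).

Uniformity in `ε` comes from working with Fourier transforms in `L¹`. This is a convolution algebra
on which the free flow is a multiplication by phases and the plane wave `e^{ik·x/ε}` a translation,
both isometric; the existence time and the constants therefore do not see `ε`. Regularity is
recovered from weighted `L¹` and `L²` norms that the Picard iteration propagates
(`exists_mild_solution`, `exists_isSolution`). Galilean invariance (`fourierEval_propagator_shift`)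
makes the transport by `k` exact. Uniqueness in the class `C([0,T]; H^∞)` is a separate localized
`L²` estimate (`IsSolution.eq`), which identifies arbitrary given solutions with the constructed
ones. -/

theorem aemeasurable_mul_sub {a b : V → ℝ≥0∞} (ha : AEMeasurable a) (hb : AEMeasurable b) :
    AEMeasurable (fun p : V × V => a p.2 * b (p.1 - p.2)) (volume.prod volume) :=
  (ha.comp_quasiMeasurePreserving Measure.quasiMeasurePreserving_snd).mul
    (hb.comp_quasiMeasurePreserving (quasiMeasurePreserving_sub_of_right_invariant _ _))

theorem lintegral_lintegral_mul_sub {a b : V → ℝ≥0∞} (ha : AEMeasurable a) (hb : AEMeasurable b) :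
    ∫⁻ x, ∫⁻ y, a y * b (x - y) = (∫⁻ y, a y) * ∫⁻ x, b x := by
  rw [lintegral_lintegral_swap (aemeasurable_mul_sub ha hb)]
  calc ∫⁻ y, ∫⁻ x, a y * b (x - y) = ∫⁻ y, a y * ∫⁻ x, b x := by
        refine lintegral_congr fun y => ?_
        have hb' : AEMeasurable (fun x => b (x - y)) :=
          hb.comp_quasiMeasurePreserving (measurePreserving_sub_right volume y).quasiMeasurePreserving
        rw [lintegral_const_mul'' _ hb', lintegral_sub_right_eq_self b y]
    _ = _ := lintegral_mul_const'' _ ha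

/-- Cauchy–Schwarz for the measure `a dy`, obtained by splitting `a = a^{1/2} a^{1/2}`. -/
theorem lintegral_mul_sq_le {a b : V → ℝ≥0∞} (ha : AEMeasurable a) (hb : AEMeasurable b) :
    (∫⁻ y, a y * b y) ^ 2 ≤ (∫⁻ y, a y) * ∫⁻ y, a y * b y ^ 2 := by
  have h := ENNReal.lintegral_mul_le_Lp_mul_Lq volume (p := 2) (q := 2)
    (Real.HolderConjugate.two_two) (f := fun y => a y ^ (1 / 2 : ℝ))
    (g := fun y => a y ^ (1 / 2 : ℝ) * b y) (ha.pow_const _) ((ha.pow_const _).mul hb)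
  have key : ∀ z : ℝ≥0∞, z ^ (1 / 2 : ℝ) * z ^ (1 / 2 : ℝ) = z := fun z => by
    rw [← ENNReal.rpow_add_of_nonneg _ _ (by norm_num) (by norm_num)]; norm_num
  have e1 : ∀ y, ((fun y => a y ^ (1 / 2 : ℝ)) * fun y => a y ^ (1 / 2 : ℝ) * b y) y
      = a y * b y := fun y => by
    simp only [Pi.mul_apply]; rw [← mul_assoc, key]
  have e2 : ∀ y, (a y ^ (1 / 2 : ℝ)) ^ (2 : ℝ) = a y := fun y => by
    rw [← ENNReal.rpow_mul]; norm_num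
  have e3 : ∀ y, (a y ^ (1 / 2 : ℝ) * b y) ^ (2 : ℝ) = a y * b y ^ 2 := fun y => by
    rw [ENNReal.mul_rpow_of_nonneg _ _ (by norm_num), e2]; norm_cast
  simp only [e1, e2, e3] at h
  calc (∫⁻ y, a y * b y) ^ 2
      ≤ ((∫⁻ y, a y) ^ (1 / 2 : ℝ) * (∫⁻ y, a y * b y ^ 2) ^ (1 / 2 : ℝ)) ^ 2 := by gcongr
    _ = _ := by rw [mul_pow, sq, key, sq, key]

/-- Cauchy–Schwarz with respect to `a dy` inside, then Tonelli and translation invariance: Young's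
inequality `L¹ * L² ⊂ L²`. -/
theorem lintegral_sq_lintegral_mul_sub_le {a b : V → ℝ≥0∞} (ha : AEMeasurable a)
    (hb : AEMeasurable b) :
    ∫⁻ x, (∫⁻ y, a y * b (x - y)) ^ 2 ≤ (∫⁻ y, a y) ^ 2 * ∫⁻ x, b x ^ 2 := by
  calc ∫⁻ x, (∫⁻ y, a y * b (x - y)) ^ 2
      ≤ ∫⁻ x, (∫⁻ y, a y) * ∫⁻ y, a y * b (x - y) ^ 2 := by
        refine lintegral_mono fun x => lintegral_mul_sq_le (b := fun y => b (x - y)) ha ?_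
        exact hb.comp_quasiMeasurePreserving
          (quasiMeasurePreserving_sub_left_of_right_invariant volume x)
    _ = (∫⁻ y, a y) * ∫⁻ x, ∫⁻ y, a y * b (x - y) ^ 2 := by
        refine lintegral_const_mul'' _ ?_
        exact (aemeasurable_mul_sub ha (hb.pow_const 2)).lintegral_prod_right'
    _ = _ := by
        rw [lintegral_lintegral_mul_sub (b := fun x => b x ^ 2) ha (hb.pow_const 2)]; ring

end LConvolution

/-- A continuous even submultiplicative weight, bounded below by `1`. -/
structure IsSubmulWeight (w : V → ℝ) : Prop where
  continuous : Continuous w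
  one_le : ∀ x, 1 ≤ w x
  add_le : ∀ x y, w (x + y) ≤ w x * w y
  neg : ∀ x, w (-x) = w x

theorem IsSubmulWeight.nonneg {w : V → ℝ} (h : IsSubmulWeight w) (x : V) : 0 ≤ w x :=
  zero_le_one.trans (h.one_le x)

/-- The weight `(1 + λ‖ξ‖)ⁿ`. -/
def polyWeight (l : ℝ) (n : ℕ) (x : V) : ℝ := (1 + l * ‖x‖) ^ n

theorem isSubmulWeight_polyWeight {l : ℝ} (hl : 0 ≤ l) (n : ℕ) :
    IsSubmulWeight (polyWeight l n : V → ℝ) where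
  continuous := by unfold polyWeight; fun_prop
  one_le x := one_le_pow₀ (by have := mul_nonneg hl (norm_nonneg x); linarith)
  add_le x y := by
    unfold polyWeight
    rw [← mul_pow]
    have h1 := mul_le_mul_of_nonneg_left (norm_add_le x y) hl
    have h2 : 0 ≤ (l * ‖x‖) * (l * ‖y‖) := by positivity
    gcongr
    nlinarith
  neg x := by simp [polyWeight]

/-- The weighted Lebesgue norm `‖w f‖_{Lᵖ}`. -/
def wnorm (w : V → ℝ) (p : ℝ≥0∞) (f : V → ℂ) : ℝ≥0∞ :=
  eLpNorm (fun x => w x • f x) p volume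

theorem wnorm_congr_ae {w : V → ℝ} {p : ℝ≥0∞} {f g : V → ℂ} (h : f =ᵐ[volume] g) :
    wnorm w p f = wnorm w p g :=
  eLpNorm_congr_ae (by filter_upwards [h] with x hx; rw [hx])

theorem wnorm_congr_norm_ae {w : V → ℝ} {p : ℝ≥0∞} {f g : V → ℂ}
    (h : ∀ᵐ x, ‖f x‖ = ‖g x‖) : wnorm w p f = wnorm w p g :=
  eLpNorm_congr_norm_ae (by filter_upwards [h] with x hx; rw [norm_smul, norm_smul, hx])

theorem wnorm_add_le {w : V → ℝ} (hw : Continuous w) {p : ℝ≥0∞} (hp : 1 ≤ p) {f g : V → ℂ}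
    (hf : AEStronglyMeasurable f) (hg : AEStronglyMeasurable g) :
    wnorm w p (f + g) ≤ wnorm w p f + wnorm w p g := by
  unfold wnorm
  simp only [Pi.add_apply, smul_add]
  exact eLpNorm_add_le (hw.aestronglyMeasurable.smul hf) (hw.aestronglyMeasurable.smul hg) hp

theorem wnorm_const_smul (w : V → ℝ) (p : ℝ≥0∞) {𝕜 : Type*} [NormedField 𝕜] [NormedSpace 𝕜 ℂ]
    [SMulCommClass ℝ 𝕜 ℂ] (c : 𝕜) (f : V → ℂ) :
    wnorm w p (c • f) = ‖c‖ₑ * wnorm w p f := by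
  unfold wnorm
  simp only [Pi.smul_apply, smul_comm _ c]
  exact eLpNorm_const_smul c _ p volume

theorem wnorm_one (p : ℝ≥0∞) (f : V → ℂ) : wnorm (fun _ => 1) p f = eLpNorm f p volume := by
  simp [wnorm]

theorem wnorm_mono_weight {w w' : V → ℝ} (h0 : ∀ x, 0 ≤ w x) (h : ∀ x, w x ≤ w' x) (p : ℝ≥0∞)
    (f : V → ℂ) : wnorm w p f ≤ wnorm w' p f := by
  refine eLpNorm_mono fun x => ?_
  rw [norm_smul, norm_smul, Real.norm_of_nonneg (h0 x), Real.norm_of_nonneg ((h0 x).trans (h x))]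
  gcongr
  exact h x

/-- Fatou along an almost everywhere convergent subsequence. Closedness in the `L¹` topology alone
lets weighted bounds pass to Bochner integrals and to limits of Picard iterates, where nothing
converges in the weighted norm a priori. -/
theorem isClosed_wnorm_le {w : V → ℝ} (hw : Continuous w) (p : ℝ≥0∞) (R : ℝ≥0∞) :
    IsClosed {f : Lp ℂ 1 (volume : Measure V) | wnorm w p f ≤ R} := by
  refine isClosed_of_closure_subset fun f hf => ?_
  obtain ⟨u, hu, hlim⟩ := mem_closure_iff_seq_limit.1 hf
  obtain ⟨ns, -, hns⟩ := (tendstoInMeasure_of_tendsto_Lp hlim).exists_seq_tendsto_ae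
  refine (Lp.eLpNorm_lim_le_liminf_eLpNorm (f := fun n x => w x • u (ns n) x)
    (fun n => hw.aestronglyMeasurable.smul (Lp.aestronglyMeasurable _)) _ ?_).trans ?_
  · filter_upwards [hns] with x hx using hx.const_smul _
  · exact liminf_le_of_le (by isBoundedDefault) fun b hb => by
      obtain ⟨n, hn⟩ := hb.exists
      exact hn.trans (hu _)

theorem convex_wnorm_le {w : V → ℝ} (hw : Continuous w) {p : ℝ≥0∞} (hp : 1 ≤ p) (R : ℝ≥0∞) :
    Convex ℝ {f : Lp ℂ 1 (volume : Measure V) | wnorm w p f ≤ R} := by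
  intro f hf g hg a b ha hb hab
  simp only [Set.mem_ofPred_eq] at *
  have e : (↑(a • f + b • g) : V → ℂ) =ᵐ[volume] a • (f : V → ℂ) + b • (g : V → ℂ) := by
    filter_upwards [Lp.coeFn_add (a • f) (b • g), Lp.coeFn_smul a f, Lp.coeFn_smul b g]
      with x h1 h2 h3
    rw [h1, Pi.add_apply, Pi.add_apply, h2, h3]
  rw [wnorm_congr_ae e]
  calc _ ≤ wnorm w p (a • (f : V → ℂ)) + wnorm w p (b • (g : V → ℂ)) :=
        wnorm_add_le hw hp ((Lp.aestronglyMeasurable _).const_smul _)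
          ((Lp.aestronglyMeasurable _).const_smul _)
    _ ≤ ‖a‖ₑ * R + ‖b‖ₑ * R := by
        rw [wnorm_const_smul, wnorm_const_smul]; gcongr
    _ = R := by
        rw [← add_mul, ← ofReal_norm, ← ofReal_norm,
          ← ENNReal.ofReal_add (norm_nonneg _) (norm_nonneg _), Real.norm_of_nonneg ha,
          Real.norm_of_nonneg hb, hab]
        simp

/-- A Bochner integral over `[a, b]` of functions of weighted norm at most `R` has weighted norm at
most `(b - a) R`. -/
theorem wnorm_intervalIntegral_le {w : V → ℝ} (hw : Continuous w) {p : ℝ≥0∞} (hp : 1 ≤ p)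
    {R : ℝ≥0∞} {a b : ℝ} (hab : a ≤ b) {F : ℝ → Lp ℂ 1 (volume : Measure V)} (hF : Continuous F)
    (hR : ∀ s ∈ Set.Icc a b, wnorm w p (F s) ≤ R) :
    wnorm w p ((∫ s in a..b, F s : Lp ℂ 1 (volume : Measure V)) : V → ℂ)
      ≤ ENNReal.ofReal (b - a) * R := by
  rcases hab.eq_or_lt with rfl | hlt
  · have : wnorm w p ((0 : Lp ℂ 1 (volume : Measure V)) : V → ℂ) = 0 := by
      rw [wnorm_congr_ae (Lp.coeFn_zero ℂ 1 volume)]; simp [wnorm]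
    rw [intervalIntegral.integral_same, this]
    exact zero_le
  · have hm := (convex_wnorm_le hw hp R).set_average_mem (isClosed_wnorm_le hw p R)
      (μ := (volume : Measure ℝ)) (t := Set.Ioc a b) (f := F) (by simp [hlt]) (by simp)
      (by
        filter_upwards [ae_restrict_mem measurableSet_Ioc] with s hs
        exact hR s (Set.Ioc_subset_Icc_self hs))
      (hF.integrableOn_Ioc)
    have e : (∫ s in a..b, F s) = (b - a) • ⨍ s in Set.Ioc a b, F s := by
      rw [setAverage_eq, intervalIntegral.integral_of_le hab, smul_smul]
      simp [Measure.real, hlt.le, mul_inv_cancel₀ (sub_pos.2 hlt).ne']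
    rw [e, wnorm_congr_ae (Lp.coeFn_smul _ _), wnorm_const_smul, ← ofReal_norm,
      Real.norm_of_nonneg (sub_nonneg.2 hab)]
    gcongr
    exact hm

/-- Convolution of scalar functions. -/
def conv (f g : V → ℂ) : V → ℂ := convolution f g (ContinuousLinearMap.mul ℂ ℂ) volume

theorem integrable_conv {f g : V → ℂ} (hf : Integrable f) (hg : Integrable g) :
    Integrable (conv f g) := hf.integrable_convolution _ hg

/-- Since `w x ≤ w y * w (x - y)`, the weight can be distributed over the two factors. Weighted
convolution estimates thus reduce to unweighted ones with the same constants. -/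
theorem enorm_weight_conv_le {w : V → ℝ} (hw : IsSubmulWeight w) (f g : V → ℂ) (x : V) :
    ‖w x • conv f g x‖ₑ ≤ ∫⁻ y, ‖w y • f y‖ₑ * ‖w (x - y) • g (x - y)‖ₑ := by
  have : w x • conv f g x = ∫ y, w x • (f y * g (x - y)) := by
    rw [integral_smul]; rfl
  rw [this]
  refine (enorm_integral_le_lintegral_enorm _).trans (lintegral_mono fun y => ?_)
  rw [← enorm_mul, ← ofReal_norm, ← ofReal_norm]
  refine ENNReal.ofReal_le_ofReal ?_
  rw [smul_mul_smul_comm, norm_smul, norm_smul, Real.norm_of_nonneg (hw.nonneg x),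
    Real.norm_of_nonneg (mul_nonneg (hw.nonneg _) (hw.nonneg _))]
  gcongr
  simpa using hw.add_le y (x - y)

theorem wnorm_one_conv_le {w : V → ℝ} (hw : IsSubmulWeight w) {f g : V → ℂ}
    (hf : AEStronglyMeasurable f) (hg : AEStronglyMeasurable g) :
    wnorm w 1 (conv f g) ≤ wnorm w 1 f * wnorm w 1 g := by
  simp only [wnorm, eLpNorm_one_eq_lintegral_enorm]
  have h1 : AEMeasurable fun x => ‖w x • f x‖ₑ :=
    (hw.continuous.aestronglyMeasurable.smul hf).enorm
  have h2 : AEMeasurable fun x => ‖w x • g x‖ₑ :=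
    (hw.continuous.aestronglyMeasurable.smul hg).enorm
  rw [← lintegral_lintegral_mul_sub (b := fun x => ‖w x • g x‖ₑ) h1 h2]
  exact lintegral_mono fun x => enorm_weight_conv_le hw f g x

theorem eLpNorm_two_sq {E : Type*} [NormedAddCommGroup E] (f : V → E) :
    eLpNorm f 2 volume ^ 2 = ∫⁻ x, ‖f x‖ₑ ^ 2 := by
  rw [eLpNorm_eq_lintegral_rpow_enorm_toReal (by norm_num) (by norm_num)]
  simp only [ENNReal.toReal_ofNat, ENNReal.rpow_ofNat]
  rw [← ENNReal.rpow_natCast, ← ENNReal.rpow_mul]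
  norm_num

theorem wnorm_two_conv_le {w : V → ℝ} (hw : IsSubmulWeight w) {f g : V → ℂ}
    (hf : AEStronglyMeasurable f) (hg : AEStronglyMeasurable g) :
    wnorm w 2 (conv f g) ≤ wnorm w 1 f * wnorm w 2 g := by
  have h1 : AEMeasurable fun x => ‖w x • f x‖ₑ :=
    (hw.continuous.aestronglyMeasurable.smul hf).enorm
  have h2 : AEMeasurable fun x => ‖w x • g x‖ₑ :=
    (hw.continuous.aestronglyMeasurable.smul hg).enorm
  rw [← ENNReal.pow_le_pow_left_iff (two_ne_zero)]
  rw [mul_pow]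
  simp only [wnorm, eLpNorm_two_sq, eLpNorm_one_eq_lintegral_enorm]
  refine le_trans (lintegral_mono fun x => ?_) (lintegral_sq_lintegral_mul_sub_le h1 h2)
  gcongr
  exact enorm_weight_conv_le hw f g x

/-- Young's inequality in the two cases that are needed. -/
theorem wnorm_conv_le {w : V → ℝ} (hw : IsSubmulWeight w) {p : ℝ≥0∞} (hp : p = 1 ∨ p = 2)
    {f g : V → ℂ} (hf : AEStronglyMeasurable f) (hg : AEStronglyMeasurable g) :
    wnorm w p (conv f g) ≤ wnorm w 1 f * wnorm w p g := by
  rcases hp with rfl | rfl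
  exacts [wnorm_one_conv_le hw hf hg, wnorm_two_conv_le hw hf hg]

end

/-! ### The convolution algebra `L¹`, the free propagator and the cubic vector field. -/

section

variable {V : Type*} [NormedAddCommGroup V] [InnerProductSpace ℝ V] [FiniteDimensional ℝ V]
  [MeasurableSpace V] [BorelSpace V]

variable (V) in
/-- The space `L¹(V)`, in which the Fourier transforms of the solutions live. -/
abbrev LOne : Type _ := Lp ℂ 1 (volume : Measure V)

theorem LOne.integrable (f : LOne V) : Integrable (f : V → ℂ) := L1.integrable_coeFn f

theorem LOne.enorm_eq (f : LOne V) : ‖f‖ₑ = wnorm (fun _ => 1) 1 f := by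
  rw [wnorm_one, Lp.enorm_def]

theorem isSubmulWeight_one : IsSubmulWeight (fun _ : V => (1 : ℝ)) :=
  ⟨continuous_const, by simp, by simp, by simp⟩

theorem conv_congr_ae {f f' g g' : V → ℂ} (hf : f =ᵐ[volume] f') (hg : g =ᵐ[volume] g') :
    conv f g = conv f' g' := by
  ext x
  refine integral_congr_ae ?_
  have := (quasiMeasurePreserving_sub_left_of_right_invariant volume x).ae_eq hg
  filter_upwards [hf, this] with y h1 h2
  simp only [Function.comp_apply] at h2
  simp only [h1, h2]

theorem conv_add_left_ae {f f' g : V → ℂ} (hf : Integrable f) (hf' : Integrable f')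
    (hg : Integrable g) : conv (f + f') g =ᵐ[volume] conv f g + conv f' g := by
  filter_upwards [hf.ae_convolution_exists (ContinuousLinearMap.mul ℂ ℂ) hg,
    hf'.ae_convolution_exists (ContinuousLinearMap.mul ℂ ℂ) hg] with x h1 h2
  exact h1.add_distrib h2

theorem conv_add_right_ae {f g g' : V → ℂ} (hf : Integrable f) (hg : Integrable g)
    (hg' : Integrable g') : conv f (g + g') =ᵐ[volume] conv f g + conv f g' := by
  filter_upwards [hf.ae_convolution_exists (ContinuousLinearMap.mul ℂ ℂ) hg,
    hf.ae_convolution_exists (ContinuousLinearMap.mul ℂ ℂ) hg'] with x h1 h2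
  exact h1.distrib_add h2

theorem conv_smul_left (c : ℂ) (f g : V → ℂ) : conv (c • f) g = c • conv f g :=
  smul_convolution

theorem conv_smul_right (c : ℂ) (f g : V → ℂ) : conv f (c • g) = c • conv f g :=
  convolution_smul

/-- Convolution on `L¹`. -/
def convL : LOne V →L[ℂ] LOne V →L[ℂ] LOne V :=
  LinearMap.mkContinuous₂
    (LinearMap.mk₂ ℂ (fun f g => (integrable_conv f.integrable g.integrable).toL1 _)
      (fun f f' g => by
        rw [← Integrable.toL1_add, Integrable.toL1_eq_toL1_iff]
        rw [conv_congr_ae (Lp.coeFn_add f f') (ae_eq_refl (g : V → ℂ))]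
        exact conv_add_left_ae f.integrable f'.integrable g.integrable)
      (fun c f g => by
        rw [← Integrable.toL1_smul, Integrable.toL1_eq_toL1_iff]
        rw [conv_congr_ae (Lp.coeFn_smul c f) (ae_eq_refl (g : V → ℂ)), conv_smul_left]
        rfl)
      (fun f g g' => by
        rw [← Integrable.toL1_add, Integrable.toL1_eq_toL1_iff]
        rw [conv_congr_ae (ae_eq_refl (f : V → ℂ)) (Lp.coeFn_add g g')]
        exact conv_add_right_ae f.integrable g.integrable g'.integrable)
      (fun c f g => by
        rw [← Integrable.toL1_smul, Integrable.toL1_eq_toL1_iff]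
        rw [conv_congr_ae (ae_eq_refl (f : V → ℂ)) (Lp.coeFn_smul c g), conv_smul_right]
        rfl)) 1
    (fun f g => by
      rw [one_mul, LinearMap.mk₂_apply, ← toReal_enorm, ← toReal_enorm, ← toReal_enorm,
        ← ENNReal.toReal_mul]
      refine ENNReal.toReal_mono (ENNReal.mul_ne_top enorm_ne_top enorm_ne_top) ?_
      rw [LOne.enorm_eq, LOne.enorm_eq, LOne.enorm_eq, wnorm_congr_ae (Integrable.coeFn_toL1 _)]
      exact wnorm_one_conv_le isSubmulWeight_one f.integrable.1 g.integrable.1)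

theorem coeFn_convL (f g : LOne V) : (convL f g : V → ℂ) =ᵐ[volume] conv f g :=
  Integrable.coeFn_toL1 (integrable_conv f.integrable g.integrable)

theorem norm_convL_le (f g : LOne V) : ‖convL f g‖ ≤ ‖f‖ * ‖g‖ := by
  refine ((convL.le_opNorm₂ f g).trans ?_)
  gcongr
  calc ‖(convL : LOne V →L[ℂ] LOne V →L[ℂ] LOne V)‖ * ‖f‖ ≤ 1 * ‖f‖ := by
        gcongr; exact LinearMap.mkContinuous₂_norm_le _ zero_le_one _
    _ = ‖f‖ := one_mul _

/-- The Fourier side of complex conjugation: `f♯(ξ) = conj (f (-ξ))`. -/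
def sharp (f : V → ℂ) : V → ℂ := fun x => (starRingEnd ℂ) (f (-x))

theorem sharp_congr_ae {f g : V → ℂ} (h : f =ᵐ[volume] g) : sharp f =ᵐ[volume] sharp g := by
  have := (Measure.measurePreserving_neg (volume : Measure V)).quasiMeasurePreserving.ae_eq h
  filter_upwards [this] with x hx
  simp only [Function.comp_apply] at hx
  simp [sharp, hx]

theorem integrable_sharp {f : V → ℂ} (hf : Integrable f) : Integrable (sharp f) := by
  refine (integrable_norm_iff ?_).1 ?_
  · exact Complex.continuous_conj.comp_aestronglyMeasurable hf.comp_neg.1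
  · simpa [sharp] using hf.comp_neg.norm

theorem wnorm_sharp {w : V → ℝ} (hw : IsSubmulWeight w) {p : ℝ≥0∞} {f : V → ℂ}
    (hf : AEStronglyMeasurable f) : wnorm w p (sharp f) = wnorm w p f := by
  have h := eLpNorm_comp_measurePreserving (p := p) (f := Neg.neg) (g := fun x => w x • f x)
    (hw.continuous.aestronglyMeasurable.smul hf)
    (Measure.measurePreserving_neg (volume : Measure V))
  unfold wnorm
  rw [← h]
  refine eLpNorm_congr_norm_ae (.of_forall fun x => ?_)
  simp [sharp, hw.neg]

/-- `f ↦ f♯` on `L¹`. -/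
def sharpL : LOne V →+ LOne V where
  toFun f := (integrable_sharp f.integrable).toL1 _
  map_zero' := by
    rw [← Integrable.toL1_zero, Integrable.toL1_eq_toL1_iff]
    · refine (sharp_congr_ae (Lp.coeFn_zero ℂ 1 volume)).trans (.of_eq ?_)
      ext; simp [sharp]
    · exact integrable_zero _ _ _
  map_add' f g := by
    rw [← Integrable.toL1_add, Integrable.toL1_eq_toL1_iff]
    refine (sharp_congr_ae (Lp.coeFn_add f g)).trans (.of_eq ?_)
    ext; simp [sharp]

theorem coeFn_sharpL (f : LOne V) : (sharpL f : V → ℂ) =ᵐ[volume] sharp f :=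
  Integrable.coeFn_toL1 (integrable_sharp f.integrable)

theorem norm_sharpL (f : LOne V) : ‖sharpL f‖ = ‖f‖ := by
  rw [← toReal_enorm, ← toReal_enorm, LOne.enorm_eq, LOne.enorm_eq,
    wnorm_congr_ae (coeFn_sharpL f), wnorm_sharp isSubmulWeight_one f.integrable.1]

theorem continuous_sharpL : Continuous (sharpL : LOne V → LOne V) :=
  (AddMonoidHomClass.isometry_of_norm _ norm_sharpL).continuous

/-- The phase `exp (-i c |ξ|²)` of the Schrödinger propagator. -/
def phase (c : ℝ) (x : V) : ℂ := Complex.exp (-(Complex.I * (c * ‖x‖ ^ 2 : ℝ)))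

@[fun_prop]
theorem continuous_phase (c : ℝ) : Continuous (phase c : V → ℂ) := by
  unfold phase; fun_prop

@[simp]
theorem norm_phase (c : ℝ) (x : V) : ‖phase c x‖ = 1 := by
  rw [phase, Complex.norm_exp]; simp [-Complex.ofReal_mul, -Complex.ofReal_pow]

theorem phase_add (c c' : ℝ) (x : V) : phase (c + c') x = phase c x * phase c' x := by
  rw [phase, phase, phase, ← Complex.exp_add]; push_cast; ring_nf

@[simp]
theorem phase_zero (x : V) : phase 0 x = 1 := by simp [phase]

theorem integrable_phase_mul (c : ℝ) {f : V → ℂ} (hf : Integrable f) :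
    Integrable (fun x => phase c x * f x) :=
  hf.bdd_mul (continuous_phase c).aestronglyMeasurable (.of_forall fun x => (norm_phase c x).le)

/-- Multiplication by the phase on `L¹`. -/
def propagator (c : ℝ) : LOne V →ₗᵢ[ℂ] LOne V where
  toFun f := (integrable_phase_mul c f.integrable).toL1 _
  map_add' f g := by
    rw [← Integrable.toL1_add, Integrable.toL1_eq_toL1_iff]
    filter_upwards [Lp.coeFn_add f g] with x hx
    simp only [hx, Pi.add_apply, mul_add]
  map_smul' a f := by
    rw [RingHom.id_apply, ← Integrable.toL1_smul, Integrable.toL1_eq_toL1_iff]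
    filter_upwards [Lp.coeFn_smul a f] with x hx
    simp only [hx, Pi.smul_apply, smul_eq_mul]
    ring
  norm_map' f := by
    change ‖(integrable_phase_mul c f.integrable).toL1 _‖ = _
    rw [← toReal_enorm, ← toReal_enorm, LOne.enorm_eq, LOne.enorm_eq,
      wnorm_congr_ae (Integrable.coeFn_toL1 _)]
    congr 1
    exact wnorm_congr_norm_ae (.of_forall fun x => by simp)

theorem coeFn_propagator (c : ℝ) (f : LOne V) :
    (propagator c f : V → ℂ) =ᵐ[volume] fun x => phase c x * f x :=
  Integrable.coeFn_toL1 (integrable_phase_mul c f.integrable)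

theorem wnorm_propagator (w : V → ℝ) (p : ℝ≥0∞) (c : ℝ) (f : LOne V) :
    wnorm w p (propagator c f) = wnorm w p f := by
  rw [wnorm_congr_ae (coeFn_propagator c f)]
  exact wnorm_congr_norm_ae (.of_forall fun x => by simp)

theorem propagator_add (c c' : ℝ) (f : LOne V) :
    propagator (c + c') f = propagator c (propagator c' f) := by
  apply Lp.ext
  filter_upwards [coeFn_propagator (c + c') f, coeFn_propagator c (propagator c' f),
    coeFn_propagator c' f] with x h1 h2 h3
  rw [h1, h2, h3, phase_add, mul_assoc]

@[simp]
theorem propagator_zero (f : LOne V) : propagator 0 f = f := by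
  apply Lp.ext
  filter_upwards [coeFn_propagator 0 f] with x h1
  rw [h1, phase_zero, one_mul]

theorem norm_sub_propagator (f : LOne V) (c c' : ℝ) :
    ‖propagator c f - propagator c' f‖ = ∫ x, ‖(phase c x - phase c' x) * f x‖ := by
  rw [L1.norm_eq_integral_norm]
  refine integral_congr_ae ?_
  filter_upwards [Lp.coeFn_sub (propagator c f) (propagator c' f), coeFn_propagator c f,
    coeFn_propagator c' f] with x h1 h2 h3
  rw [h1, Pi.sub_apply, h2, h3, sub_mul]

/-- Dominated convergence. Only strong continuity is available: the phases do not depend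
continuously on `c` uniformly in `ξ`. -/
theorem continuous_propagator_left (f : LOne V) : Continuous fun c => propagator c f := by
  refine continuous_iff_continuousAt.2 fun c₀ => ?_
  rw [ContinuousAt, tendsto_iff_norm_sub_tendsto_zero]
  simp only [norm_sub_propagator]
  have : Continuous fun c => ∫ x, ‖(phase c x - phase c₀ x) * f x‖ := by
    refine continuous_of_dominated (bound := fun x => 2 * ‖f x‖) (fun c => ?_) (fun c => ?_) ?_ ?_
    · exact (AEStronglyMeasurable.mul (by fun_prop) f.integrable.1).norm
    · refine .of_forall fun x => ?_
      rw [norm_norm, norm_mul]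
      gcongr
      exact (norm_sub_le _ _).trans (by simp; norm_num)
    · exact f.integrable.norm.const_mul 2
    · refine .of_forall fun x => ?_
      unfold phase; fun_prop
  simpa using this.tendsto c₀

theorem continuous_propagator {X : Type*} [TopologicalSpace X] {c : X → ℝ} {f : X → LOne V}
    (hc : Continuous c) (hf : Continuous f) : Continuous fun s => propagator (c s) (f s) := by
  refine continuous_iff_continuousAt.2 fun s₀ => ?_
  rw [ContinuousAt, tendsto_iff_norm_sub_tendsto_zero]
  have h1 : Tendsto (fun s => ‖f s - f s₀‖ + ‖propagator (c s) (f s₀) - propagator (c s₀) (f s₀)‖)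
      (𝓝 s₀) (𝓝 0) := by
    have a := tendsto_iff_norm_sub_tendsto_zero.1 (hf.tendsto s₀)
    have b := tendsto_iff_norm_sub_tendsto_zero.1
      (((continuous_propagator_left (f s₀)).comp hc).tendsto s₀)
    simpa using a.add b
  refine squeeze_zero (fun _ => norm_nonneg _) (fun s => ?_) h1
  calc _ ≤ ‖propagator (c s) (f s) - propagator (c s) (f s₀)‖
        + ‖propagator (c s) (f s₀) - propagator (c s₀) (f s₀)‖ := norm_sub_le_norm_sub_add_norm_sub ..
    _ = _ := by rw [← map_sub, LinearIsometry.norm_map]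

/-- The Fourier side of `u ↦ |u|² u`. -/
def cubic (f : LOne V) : LOne V := convL (convL f (sharpL f)) f

theorem continuous_cubic : Continuous (cubic : LOne V → LOne V) := by
  have h := continuous_sharpL (V := V)
  unfold cubic
  fun_prop

/-- Two of the three factors are measured in weighted `L¹` and only one in `Lᵖ`, so the bound is
linear in the `p`-norm: smallness in weighted `L¹` will control the `L²` norms too, whatever their
size. -/
theorem wnorm_cubic_le {w : V → ℝ} (hw : IsSubmulWeight w) {p : ℝ≥0∞} (hp : p = 1 ∨ p = 2)
    (f : LOne V) : wnorm w p (cubic f) ≤ wnorm w 1 f ^ 2 * wnorm w p f := by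
  unfold cubic
  rw [wnorm_congr_ae (coeFn_convL _ _)]
  refine (wnorm_conv_le hw hp (Lp.aestronglyMeasurable _) (Lp.aestronglyMeasurable _)).trans ?_
  gcongr
  rw [wnorm_congr_ae (coeFn_convL _ _)]
  refine (wnorm_conv_le hw (.inl rfl) (Lp.aestronglyMeasurable _)
    (Lp.aestronglyMeasurable _)).trans ?_
  rw [wnorm_congr_ae (coeFn_sharpL f), wnorm_sharp hw (Lp.aestronglyMeasurable _), sq]

theorem norm_cubic_sub_le {R : ℝ} {f g : LOne V} (hf : ‖f‖ ≤ R) (hg : ‖g‖ ≤ R) :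
    ‖cubic f - cubic g‖ ≤ 3 * R ^ 2 * ‖f - g‖ := by
  have hR : 0 ≤ R := (norm_nonneg f).trans hf
  -- Telescoping of a trilinear expression, one argument changed at a time; hence the factor 3.
  have e : cubic f - cubic g = convL (convL (f - g) (sharpL f)) f
      + convL (convL g (sharpL (f - g))) f + convL (convL g (sharpL g)) (f - g) := by
    simp only [cubic, map_sub, sub_apply]
    abel
  have key : ∀ a b c : LOne V, ‖convL (convL a (sharpL b)) c‖ ≤ ‖a‖ * ‖b‖ * ‖c‖ := fun a b c => by
    refine (norm_convL_le _ _).trans ?_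
    gcongr
    exact (norm_convL_le _ _).trans (by rw [norm_sharpL])
  rw [e]
  refine (norm_add₃_le).trans ?_
  have h1 := key (f - g) f f
  have h2 := key g (f - g) f
  have h3 := key g g (f - g)
  have h1' : ‖f - g‖ * ‖f‖ * ‖f‖ ≤ ‖f - g‖ * R * R := by gcongr
  have h2' : ‖g‖ * ‖f - g‖ * ‖f‖ ≤ R * ‖f - g‖ * R := by gcongr
  have h3' : ‖g‖ * ‖g‖ * ‖f - g‖ ≤ R * R * ‖f - g‖ := by gcongr
  linarith

/-- The vector field of the equation on the Fourier side, in the interaction picture. -/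
def field (κ s : ℝ) (f : LOne V) : LOne V :=
  (-Complex.I) • propagator (-(κ * s)) (cubic (propagator (κ * s) f))

theorem continuous_field {κ : ℝ} {f : ℝ → LOne V} (hf : Continuous f) :
    Continuous fun s => field κ s (f s) := by
  unfold field
  have h1 : Continuous fun s => propagator (κ * s) (f s) :=
    continuous_propagator (c := fun s => κ * s) (by fun_prop) hf
  have h2 : Continuous fun s => propagator (-(κ * s)) (cubic (propagator (κ * s) (f s))) :=
    continuous_propagator (c := fun s => -(κ * s)) (by fun_prop) (continuous_cubic.comp h1)
  exact h2.const_smul (-Complex.I)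

theorem wnorm_field_le {w : V → ℝ} (hw : IsSubmulWeight w) {p : ℝ≥0∞} (hp : p = 1 ∨ p = 2)
    (κ s : ℝ) (f : LOne V) : wnorm w p (field κ s f) ≤ wnorm w 1 f ^ 2 * wnorm w p f := by
  unfold field
  rw [wnorm_congr_ae (Lp.coeFn_smul _ _), wnorm_const_smul, wnorm_propagator]
  have := wnorm_cubic_le hw hp (propagator (κ * s) f)
  rw [wnorm_propagator, wnorm_propagator] at this
  have hI : ‖-Complex.I‖ₑ = 1 := by rw [← ofReal_norm]; simp
  rwa [hI, one_mul]

theorem norm_field_sub_le (κ s : ℝ) {R : ℝ} {f g : LOne V} (hf : ‖f‖ ≤ R) (hg : ‖g‖ ≤ R) :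
    ‖field κ s f - field κ s g‖ ≤ 3 * R ^ 2 * ‖f - g‖ := by
  unfold field
  rw [← smul_sub, ← map_sub, norm_smul, norm_neg, Complex.norm_I, one_mul,
    LinearIsometry.norm_map]
  refine (norm_cubic_sub_le (R := R) (by simpa using hf) (by simpa using hg)).trans ?_
  rw [← map_sub, LinearIsometry.norm_map]

end

/-! ### The fixed point of the Duhamel map and the propagation of weighted norms. -/

section

variable {V : Type*} [NormedAddCommGroup V] [InnerProductSpace ℝ V] [FiniteDimensional ℝ V]
  [MeasurableSpace V] [BorelSpace V]

theorem norm_field_le (κ s : ℝ) {R : ℝ} {f : LOne V} (hf : ‖f‖ ≤ R) :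
    ‖field κ s f‖ ≤ R ^ 3 := by
  have h := wnorm_field_le isSubmulWeight_one (.inl rfl) κ s f
  rw [← LOne.enorm_eq, ← LOne.enorm_eq, ← pow_succ] at h
  have h' : ‖field κ s f‖ ≤ ‖f‖ ^ 3 := by
    have := ENNReal.toReal_mono (by simp) h
    simpa using this
  exact h'.trans (by gcongr)

/-- The Duhamel map on `C([0,T]; L¹)`. -/
def duhamel {T : ℝ} (hT : 0 ≤ T) (κ : ℝ) (h₀ : LOne V) (γ : C(Set.Icc 0 T, LOne V)) :
    C(Set.Icc 0 T, LOne V) where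
  toFun t := h₀ + ∫ s in (0 : ℝ)..t, field κ s (Set.IccExtend hT γ s)
  continuous_toFun := by
    have hc : Continuous fun s => field κ s (Set.IccExtend hT γ s) :=
      continuous_field γ.continuous.Icc_extend'
    have h := intervalIntegral.continuous_primitive (μ := volume)
      (fun a b => hc.intervalIntegrable a b) 0
    exact continuous_const.add (h.comp continuous_subtype_val)

theorem wnorm_duhamel_le {T : ℝ} (hT : 0 ≤ T) (κ : ℝ) {h₀ : LOne V}
    {w : V → ℝ} (hw : IsSubmulWeight w) {p : ℝ≥0∞} (hp : p = 1 ∨ p = 2)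
    {γ : C(Set.Icc 0 T, LOne V)} {A R : ℝ≥0∞} (hA : ∀ t, wnorm w 1 (γ t) ≤ A)
    (hR : ∀ t, wnorm w p (γ t) ≤ R) (t : Set.Icc 0 T) :
    wnorm w p (duhamel hT κ h₀ γ t) ≤ wnorm w p h₀ + ENNReal.ofReal T * (A ^ 2 * R) := by
  have hp1 : 1 ≤ p := by rcases hp with rfl | rfl <;> norm_num
  have e : (duhamel hT κ h₀ γ t : V → ℂ) =ᵐ[volume] _ := Lp.coeFn_add _ _
  rw [wnorm_congr_ae e]
  refine (wnorm_add_le hw.continuous hp1 (Lp.aestronglyMeasurable _)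
    (Lp.aestronglyMeasurable _)).trans ?_
  gcongr
  refine (wnorm_intervalIntegral_le hw.continuous hp1 (R := A ^ 2 * R) t.2.1
    (continuous_field γ.continuous.Icc_extend') fun s _ => ?_).trans ?_
  · refine (wnorm_field_le hw hp _ _ _).trans ?_
    gcongr
    exacts [hA _, hR _]
  · gcongr
    linarith [t.2.2]

theorem dist_duhamel_le {T : ℝ} (hT : 0 ≤ T) (κ : ℝ) {h₀ : LOne V}
    {γ γ' : C(Set.Icc 0 T, LOne V)} {R : ℝ} (h : ∀ t, ‖γ t‖ ≤ R)
    (h' : ∀ t, ‖γ' t‖ ≤ R) :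
    dist (duhamel hT κ h₀ γ) (duhamel hT κ h₀ γ') ≤ T * (3 * R ^ 2) * dist γ γ' := by
  refine (ContinuousMap.dist_le (by positivity)).2 fun t => ?_
  have hi : ∀ γ : C(Set.Icc 0 T, LOne V), IntervalIntegrable
      (fun s => field κ s (Set.IccExtend hT γ s)) volume 0 t := fun γ =>
    (continuous_field (κ := κ) γ.continuous.Icc_extend').intervalIntegrable _ _
  have e : duhamel hT κ h₀ γ t - duhamel hT κ h₀ γ' t = ∫ s in (0 : ℝ)..t,
      (field κ s (Set.IccExtend hT γ s) - field κ s (Set.IccExtend hT γ' s)) := by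
    rw [intervalIntegral.integral_sub (hi γ) (hi γ')]
    simp only [duhamel, ContinuousMap.coe_mk]
    abel
  rw [dist_eq_norm, e]
  refine (intervalIntegral.norm_integral_le_of_norm_le_const (C := 3 * R ^ 2 * dist γ γ')
    fun s _ => ?_).trans ?_
  · refine (norm_field_sub_le κ s (h _) (h' _)).trans ?_
    gcongr
    rw [← dist_eq_norm]
    exact ContinuousMap.dist_apply_le_dist _
  · rw [sub_zero, abs_of_nonneg t.2.1]
    have : (t : ℝ) ≤ T := t.2.2
    calc 3 * R ^ 2 * dist γ γ' * t ≤ 3 * R ^ 2 * dist γ γ' * T := by gcongr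
      _ = _ := by ring

/-- Existence of the solution on the Fourier side, on a time interval that depends on the data only
through its `L¹` norm, with propagation of all the weighted norms. -/
theorem exists_mild_solution {T : ℝ} (hT : 0 ≤ T) (κ : ℝ) {h₀ : LOne V} {M : ℝ}
    (hM : 24 * M ^ 2 * T ≤ 1) (hh₀ : ‖h₀‖ ≤ M) :
    ∃ h : ℝ → LOne V, Continuous h ∧ (∀ t, ‖h t‖ ≤ 2 * M) ∧
      (∀ t ∈ Set.Icc 0 T, h t = h₀ + ∫ s in (0 : ℝ)..t, field κ s (h s)) ∧
      ∀ w : V → ℝ, IsSubmulWeight w → wnorm w 1 h₀ ≤ ENNReal.ofReal M →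
        ∀ p : ℝ≥0∞, p = 1 ∨ p = 2 → ∀ t, wnorm w p (h t) ≤ 2 * wnorm w p h₀ := by
  have hM0 : 0 ≤ M := (norm_nonneg _).trans hh₀
  set Φ := duhamel hT κ h₀
  -- A bound by twice the initial norm is reproduced by the Duhamel map: the integral adds at most
  -- `T (2M)² · 2 = 8M²T ≤ 1` times the initial norm.
  have inv : ∀ w : V → ℝ, IsSubmulWeight w → wnorm w 1 h₀ ≤ ENNReal.ofReal M →
      ∀ p : ℝ≥0∞, p = 1 ∨ p = 2 → ∀ γ : C(Set.Icc 0 T, LOne V),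
      (∀ t, wnorm w 1 (γ t) ≤ 2 * wnorm w 1 h₀) → (∀ t, wnorm w p (γ t) ≤ 2 * wnorm w p h₀) →
      ∀ t, wnorm w p (Φ γ t) ≤ 2 * wnorm w p h₀ := fun w hw hwM p hp γ h1 h2 t => by
    refine (wnorm_duhamel_le hT κ hw hp h1 h2 t).trans ?_
    have : ENNReal.ofReal T * ((2 * wnorm w 1 h₀) ^ 2 * (2 * wnorm w p h₀)) ≤ 1 * wnorm w p h₀ := by
      calc _ ≤ ENNReal.ofReal T * ((2 * ENNReal.ofReal M) ^ 2 * (2 * wnorm w p h₀)) := by gcongr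
        _ = ENNReal.ofReal (8 * M ^ 2 * T) * wnorm w p h₀ := by
            rw [ENNReal.ofReal_mul (by positivity), ENNReal.ofReal_mul (by positivity),
              ENNReal.ofReal_pow hM0]
            simp only [ENNReal.ofReal_ofNat]
            ring
        _ ≤ _ := by
            gcongr
            rw [← ENNReal.ofReal_one]
            refine ENNReal.ofReal_le_ofReal ?_
            have : 0 ≤ M ^ 2 * T := by positivity
            linarith
    calc _ ≤ wnorm w p h₀ + 1 * wnorm w p h₀ := by gcongr
      _ = _ := by ring
  have norm_iff : ∀ f : LOne V, ‖f‖ ≤ 2 * M ↔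
      wnorm (fun _ => 1) 1 f ≤ ENNReal.ofReal (2 * M) := fun f => by
    rw [← LOne.enorm_eq, ← ofReal_norm, ENNReal.ofReal_le_ofReal_iff (by positivity)]
  set S : Set C(Set.Icc 0 T, LOne V) := {γ | ∀ t, ‖γ t‖ ≤ 2 * M} with hS
  have hSc : IsClosed S := by
    rw [hS]
    simp only [Set.ofPred_forall]
    exact isClosed_iInter fun t =>
      isClosed_le (continuous_norm.comp (continuous_eval_const t)) continuous_const
  have hmaps : Set.MapsTo Φ S S := fun γ hγ t => by
    rw [norm_iff]
    refine (wnorm_duhamel_le hT κ isSubmulWeight_one (.inl rfl)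
      (fun t => (norm_iff _).1 (hγ t)) (fun t => (norm_iff _).1 (hγ t)) t).trans ?_
    rw [← LOne.enorm_eq, ← ofReal_norm, ← pow_succ, ← ENNReal.ofReal_pow (by positivity),
      ← ENNReal.ofReal_mul hT, ← ENNReal.ofReal_add (norm_nonneg _) (by positivity)]
    refine ENNReal.ofReal_le_ofReal ?_
    have h1 : 0 ≤ M * (M ^ 2 * T) := by positivity
    have h2 := mul_le_mul_of_nonneg_left hM hM0
    have e : T * (2 * M) ^ (2 + 1) = 8 * (M * (M ^ 2 * T)) := by ring
    rw [e]
    linarith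
  -- The Lipschitz constant is `3 (2M)² T = 12M²T`; the hypothesis `24M²T ≤ 1` is what makes it at
  -- most `1/2`.
  have hcontr : ContractingWith (1 / 2) (hmaps.restrict Φ S S) := by
    refine ⟨by norm_num, LipschitzWith.of_dist_le_mul fun γ γ' => ?_⟩
    refine (dist_duhamel_le hT κ γ.2 γ'.2).trans ?_
    rw [Subtype.dist_eq]
    gcongr
    push_cast
    nlinarith
  set γ₀ : C(Set.Icc 0 T, LOne V) := ContinuousMap.const _ h₀
  have hγ₀ : γ₀ ∈ S := fun t => hh₀.trans (by linarith)
  obtain ⟨y, hyS, hfix, hlim, -⟩ := ContractingWith.exists_fixedPoint' hSc.isComplete hmaps hcontr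
    hγ₀ (edist_ne_top _ _)
  -- The contraction takes place in the unweighted norm only. Weighted bounds are proved for each
  -- Picard iterate and then inherited by the `L¹` limit through `isClosed_wnorm_le`.
  have hiter : ∀ w : V → ℝ, IsSubmulWeight w → wnorm w 1 h₀ ≤ ENNReal.ofReal M →
      ∀ p : ℝ≥0∞, p = 1 ∨ p = 2 → ∀ n t, wnorm w p (Φ^[n] γ₀ t) ≤ 2 * wnorm w p h₀ := by
    intro w hw hwM
    have h2 : ∀ a : ℝ≥0∞, a ≤ 2 * a := fun a => by rw [two_mul]; exact le_self_add
    have base : ∀ p t, wnorm w p (γ₀ t) ≤ 2 * wnorm w p h₀ := fun p t => h2 _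
    intro p hp n
    -- The induction must treat both exponents together: the step for `p` uses the bound of the
    -- previous iterate for `p = 1`.
    suffices H : ∀ p, p = 1 ∨ p = 2 → ∀ t, wnorm w p (Φ^[n] γ₀ t) ≤ 2 * wnorm w p h₀ from H p hp
    induction n with
    | zero => exact fun p _ t => base p t
    | succ n ih =>
      intro p hp t
      rw [Function.iterate_succ_apply']
      exact inv w hw hwM p hp _ (ih 1 (.inl rfl)) (ih p hp) t
  refine ⟨Set.IccExtend hT y, y.continuous.Icc_extend', fun t => hyS _, fun t ht => ?_, ?_⟩
  · have := congrArg (fun γ : C(Set.Icc 0 T, LOne V) => γ ⟨t, ht⟩) hfix.symm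
    rw [Set.IccExtend_of_mem _ _ ht]
    exact this
  · intro w hw hwM p hp t
    refine (isClosed_wnorm_le hw.continuous p (2 * wnorm w p h₀)).mem_of_tendsto
      (((continuous_eval_const (Set.projIcc 0 T hT t)).tendsto y).comp hlim) ?_
    exact .of_forall fun n => hiter w hw hwM p hp n _

/-- Data with a finite norm for the weight `(1 + ‖ξ‖)ⁿ` has norm at most `M` for an equivalent
weight. -/
theorem exists_polyWeight_wnorm_le {h₀ : LOne V} {M : ℝ} (hM : ‖h₀‖ < M) (n : ℕ)
    (hn : wnorm (polyWeight 1 n) 1 h₀ ≠ ⊤) :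
    ∃ l : ℝ, 0 < l ∧ l ≤ 1 ∧ wnorm (polyWeight l n) 1 h₀ ≤ ENNReal.ofReal M := by
  set A := (wnorm (polyWeight 1 n) 1 h₀).toReal
  have hA : 0 ≤ A := ENNReal.toReal_nonneg
  -- The excess caused by the weight is at most `l A`, and this `l` makes `l (A + 1) ≤ M - ‖h₀‖`.
  -- The strict inequality `‖h₀‖ < M` is what leaves room for a positive `l`. Every degree `n` can
  -- thus be handled with the same `M`, hence on the same time interval.
  set l := min 1 ((M - ‖h₀‖) / (A + 1))
  have hl : 0 < l := lt_min one_pos (div_pos (sub_pos.2 hM) (by linarith))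
  have hl1 : l ≤ 1 := min_le_left _ _
  refine ⟨l, hl, hl1, ?_⟩
  -- Convexity of `t ↦ tⁿ` at `1 + l‖x‖ = (1 - l) · 1 + l (1 + ‖x‖)`.
  have hb : ∀ x : V, polyWeight l n x ≤ (1 - l) * 1 + l * polyWeight 1 n x := fun x => by
    have := (convexOn_pow n).2 (x := 1) (y := 1 + ‖x‖) (by simp) (by simp; positivity)
      (sub_nonneg.2 hl1) hl.le (by ring)
    simp only [smul_eq_mul, one_pow] at this
    have e : (1 - l) * 1 + l * (1 + ‖x‖) = 1 + l * ‖x‖ := by ring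
    rw [e] at this
    simpa only [polyWeight, one_mul] using this
  have h1 : wnorm (polyWeight l n) 1 h₀ ≤ ENNReal.ofReal (1 - l) * ‖h₀‖ₑ
      + ENNReal.ofReal l * wnorm (polyWeight 1 n) 1 h₀ := by
    have hp1 := (isSubmulWeight_polyWeight zero_le_one n : IsSubmulWeight (polyWeight 1 n : V → ℝ))
    rw [LOne.enorm_eq]
    simp only [wnorm, eLpNorm_one_eq_lintegral_enorm]
    rw [← lintegral_const_mul' _ _ (by simp), ← lintegral_const_mul' _ _ (by simp),
      ← lintegral_add_left' (by
        simpa using h₀.integrable.1.enorm.const_mul (ENNReal.ofReal (1 - l)))]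
    refine lintegral_mono fun x => ?_
    rw [← ofReal_norm, ← ofReal_norm, ← ofReal_norm, ← ENNReal.ofReal_mul (sub_nonneg.2 hl1),
      ← ENNReal.ofReal_mul hl.le, ← ENNReal.ofReal_add
        (mul_nonneg (sub_nonneg.2 hl1) (norm_nonneg _)) (mul_nonneg hl.le (norm_nonneg _))]
    refine ENNReal.ofReal_le_ofReal ?_
    rw [norm_smul, norm_smul, norm_smul, Real.norm_of_nonneg (hp1.nonneg x),
      Real.norm_of_nonneg ((isSubmulWeight_polyWeight hl.le n).nonneg x), norm_one]
    have := mul_le_mul_of_nonneg_right (hb x) (norm_nonneg (h₀ x))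
    linarith
  refine h1.trans ?_
  have hA' : wnorm (polyWeight 1 n) 1 h₀ = ENNReal.ofReal A := (ENNReal.ofReal_toReal hn).symm
  rw [← ofReal_norm, hA', ← ENNReal.ofReal_mul (sub_nonneg.2 hl1),
    ← ENNReal.ofReal_mul hl.le, ← ENNReal.ofReal_add
      (mul_nonneg (sub_nonneg.2 hl1) (norm_nonneg _)) (by positivity)]
  refine ENNReal.ofReal_le_ofReal ?_
  have h2 : l * (A + 1) ≤ M - ‖h₀‖ := by
    rw [← le_div_iff₀ (by linarith)]; exact min_le_right _ _
  change (1 - l) * ‖h₀‖ + l * A ≤ M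
  have := norm_nonneg h₀
  nlinarith

theorem wnorm_polyWeight_le {l : ℝ} (hl : 0 < l) (hl1 : l ≤ 1) (n : ℕ) (p : ℝ≥0∞) (f : V → ℂ) :
    wnorm (polyWeight 1 n) p f ≤ ENNReal.ofReal (l⁻¹ ^ n) * wnorm (polyWeight l n) p f := by
  have e : ENNReal.ofReal (l⁻¹ ^ n) * wnorm (polyWeight l n) p f
      = eLpNorm ((l⁻¹ ^ n) • fun x => polyWeight l n x • f x) p volume := by
    rw [eLpNorm_const_smul, ← ofReal_norm, Real.norm_of_nonneg (by positivity)]; rfl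
  rw [e]
  refine eLpNorm_mono fun x => ?_
  have h0 : 0 ≤ polyWeight l n x := (isSubmulWeight_polyWeight hl.le n).nonneg x
  rw [Pi.smul_apply, norm_smul, norm_smul, norm_smul, ← mul_assoc]
  gcongr
  rw [Real.norm_of_nonneg (by unfold polyWeight; positivity), Real.norm_of_nonneg (by positivity),
    Real.norm_of_nonneg h0]
  unfold polyWeight
  rw [← mul_pow]
  gcongr
  rw [mul_add, ← mul_assoc, inv_mul_cancel₀ hl.ne', mul_one]
  gcongr
  exact (one_le_inv₀ hl).2 hl1

end

/-! ### From the Fourier side to physical space: Plancherel, smoothness, Laplacian, cubic term. -/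

section

open scoped FourierTransform

variable {V : Type*} [NormedAddCommGroup V] [InnerProductSpace ℝ V] [FiniteDimensional ℝ V]
  [MeasurableSpace V] [BorelSpace V]

section Plancherel

theorem continuous_fourier {E : Type*} [NormedAddCommGroup E] [NormedSpace ℂ E] {f : V → E}
    (hf : Integrable f) : Continuous (𝓕 f) :=
  VectorFourier.fourierIntegral_continuous Real.continuous_fourierChar
    (by exact continuous_inner) hf

/-- The Fourier integral of `f ∈ L¹ ∩ L²` is its `L²` Fourier transform. -/
theorem fourier_toLp_two_ae_eq {E : Type*} [NormedAddCommGroup E] [InnerProductSpace ℂ E]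
    [CompleteSpace E] {f : V → E} (hf : Integrable f) (hf2 : MemLp f 2) :
    (𝓕 (hf2.toLp f) : Lp E 2 (volume : Measure V)) =ᵐ[volume] 𝓕 f := by
  refine ae_eq_of_integral_contDiff_smul_eq
    ((Lp.memLp _).locallyIntegrable (by norm_num)) (continuous_fourier hf).locallyIntegrable ?_
  -- Both sides are compared as distributions: the `L²` transform is defined by duality, and the
  -- Fourier integral satisfies the same duality formula by Fubini.
  intro φ hφ hφc
  have hc : HasCompactSupport (fun x => (φ x : ℂ)) := hφc.comp_left Complex.ofReal_zero
  set Φ : SchwartzMap V ℂ := hc.toSchwartzMap (Complex.ofRealCLM.contDiff.comp hφ)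
  have hΦ : ∀ x, Φ x = φ x := fun x => rfl
  have h1 := congrArg (fun u => u Φ) (Lp.fourier_toTemperedDistribution_eq (hf2.toLp f))
  simp only [TemperedDistribution.fourier_apply, Lp.toTemperedDistribution_apply] at h1
  have h2 : ∫ x, (𝓕 Φ) x • (hf2.toLp f) x = ∫ x, (𝓕 Φ) x • f x :=
    integral_congr_ae (by filter_upwards [hf2.coeFn_toLp] with x hx; rw [hx])
  have h3 : ∫ x, (𝓕 Φ) x • f x = ∫ x, Φ x • 𝓕 f x := by
    have := VectorFourier.integral_fourierIntegral_smul_eq_flip (e := Real.fourierChar)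
      (L := innerₗ V) (μ := volume) (ν := volume) (f := Φ) (g := f) Real.continuous_fourierChar
      (by exact continuous_inner) Φ.integrable hf
    rw [flip_innerₗ] at this
    exact this
  rw [h2, h3] at h1
  simpa [hΦ] using h1.symm

theorem eLpNorm_fourier_eq {E : Type*} [NormedAddCommGroup E] [InnerProductSpace ℂ E]
    [CompleteSpace E] {f : V → E} (hf : Integrable f) (hf2 : MemLp f 2) :
    eLpNorm (𝓕 f) 2 volume = eLpNorm f 2 volume := by
  rw [← eLpNorm_congr_ae (fourier_toLp_two_ae_eq hf hf2), ← Lp.enorm_def]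
  have h := Lp.norm_fourier_eq (hf2.toLp f)
  rw [← ofReal_norm, h, ofReal_norm, Lp.enorm_def, eLpNorm_congr_ae hf2.coeFn_toLp]

theorem fourier_clm_comp {E F : Type*} [NormedAddCommGroup E] [NormedSpace ℂ E] [CompleteSpace E]
    [NormedAddCommGroup F] [NormedSpace ℂ F] [CompleteSpace F] (L : E →L[ℂ] F) {f : V → E}
    (hf : Integrable f) (x : V) : 𝓕 (fun y => L (f y)) x = L (𝓕 f x) := by
  rw [Real.fourier_eq, Real.fourier_eq, ← L.integral_comp_comm]
  · simp [Circle.smul_def]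
  · exact (Real.fourierIntegral_convergent_iff x).2 hf

/-- Plancherel needs a Hilbert space as target, whereas derivatives take values in multilinear maps
with the operator norm. A linear isomorphism with a Euclidean space costs only a constant, which is
harmless here. -/
theorem eLpNorm_fourier_le_of_finiteDimensional (F : Type*) [NormedAddCommGroup F]
    [NormedSpace ℂ F] [FiniteDimensional ℂ F] :
    ∃ C : ℝ≥0∞, C ≠ ⊤ ∧ ∀ f : V → F, Integrable f → MemLp f 2 →
      eLpNorm (𝓕 f) 2 volume ≤ C * eLpNorm f 2 volume := by
  have : CompleteSpace F := FiniteDimensional.complete ℂ F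
  let L : F ≃L[ℂ] EuclideanSpace ℂ (Fin (Module.finrank ℂ F)) :=
    ContinuousLinearEquiv.ofFinrankEq (by simp)
  let A : F →L[ℂ] EuclideanSpace ℂ (Fin (Module.finrank ℂ F)) := L
  let B : EuclideanSpace ℂ (Fin (Module.finrank ℂ F)) →L[ℂ] F := L.symm
  refine ⟨ENNReal.ofReal ‖B‖ * ENNReal.ofReal ‖A‖,
    ENNReal.mul_ne_top ENNReal.ofReal_ne_top ENNReal.ofReal_ne_top, fun f hf hf2 => ?_⟩
  have hA := eLpNorm_fourier_eq (A.integrable_comp hf) (A.comp_memLp' hf2)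
  have h1 : eLpNorm (𝓕 f) 2 volume ≤ ENNReal.ofReal ‖B‖ * eLpNorm (𝓕 (fun y => A (f y))) 2 volume := by
    refine eLpNorm_le_mul_eLpNorm_of_ae_le_mul (.of_forall fun x => ?_) 2
    rw [fourier_clm_comp A hf]
    have : 𝓕 f x = B (A (𝓕 f x)) := (L.symm_apply_apply _).symm
    conv_lhs => rw [this]
    exact B.le_opNorm _
  have h2 : eLpNorm (fun y => A (f y)) 2 volume ≤ ENNReal.ofReal ‖A‖ * eLpNorm f 2 volume :=
    eLpNorm_le_mul_eLpNorm_of_ae_le_mul (.of_forall fun x => A.le_opNorm _) 2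
  calc _ ≤ _ := h1
    _ ≤ ENNReal.ofReal ‖B‖ * (ENNReal.ofReal ‖A‖ * eLpNorm f 2 volume) := by
        gcongr
        exact hA.le.trans h2
    _ = _ := by ring

variable (V) in
theorem finiteDimensional_continuousMultilinearMap (F : Type*) [NormedAddCommGroup F]
    [NormedSpace ℂ F] [FiniteDimensional ℂ F] (n : ℕ) :
    FiniteDimensional ℂ (ContinuousMultilinearMap ℝ (fun _ : Fin n => V) F) := by
  have : Module.Finite ℝ F := Module.Finite.trans ℂ F
  have : Module.Finite ℝ (ContinuousMultilinearMap ℝ (fun _ : Fin n => V) F) :=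
    Module.Finite.of_injective (ContinuousMultilinearMap.toMultilinearMapLinear (R' := ℝ))
      ContinuousMultilinearMap.toMultilinearMap_injective
  exact Module.Finite.of_restrictScalars_finite ℝ ℂ _

end Plancherel

section Regularity

/-- Rapid decay of `g` in the sense of all the polynomially weighted `L¹` and `L²` norms. -/
def RapidDecay (g : V → ℂ) : Prop :=
  AEStronglyMeasurable g ∧ ∀ n : ℕ, ∀ p : ℝ≥0∞, p = 1 ∨ p = 2 → wnorm (polyWeight 1 n) p g < ⊤

theorem pow_norm_mul_le_polyWeight {n m : ℕ} (hnm : n ≤ m) (x : V) :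
    ‖x‖ ^ n ≤ polyWeight 1 m x := by
  have h := norm_nonneg x
  unfold polyWeight
  calc ‖x‖ ^ n ≤ (1 + 1 * ‖x‖) ^ n := by gcongr; linarith
    _ ≤ _ := pow_le_pow_right₀ (by linarith) hnm

theorem RapidDecay.memLp_weight {g : V → ℂ} (hg : RapidDecay g) (n : ℕ) {p : ℝ≥0∞}
    (hp : p = 1 ∨ p = 2) : MemLp (fun x => polyWeight 1 n x • g x) p :=
  ⟨(isSubmulWeight_polyWeight zero_le_one n).continuous.aestronglyMeasurable.smul hg.1,
    hg.2 n p hp⟩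

theorem RapidDecay.memLp_pow {g : V → ℂ} (hg : RapidDecay g) (n : ℕ) {p : ℝ≥0∞}
    (hp : p = 1 ∨ p = 2) : MemLp (fun x => ‖x‖ ^ n • g x) p := by
  refine (hg.memLp_weight n hp).mono ?_ (.of_forall fun x => ?_)
  · exact (by fun_prop : Continuous fun x : V => ‖x‖ ^ n).aestronglyMeasurable.smul hg.1
  · have := pow_norm_mul_le_polyWeight le_rfl (n := n) x
    rw [norm_smul, norm_smul, Real.norm_of_nonneg (by positivity),
      Real.norm_of_nonneg ((by positivity : (0 : ℝ) ≤ ‖x‖ ^ n).trans this)]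
    gcongr

theorem RapidDecay.integrable_pow {g : V → ℂ} (hg : RapidDecay g) (n : ℕ) :
    Integrable (fun x => ‖x‖ ^ n * ‖g x‖) := by
  have := (memLp_one_iff_integrable.1 (hg.memLp_pow n (.inl rfl))).norm
  refine this.congr (.of_forall fun x => ?_)
  simp

theorem RapidDecay.integrable {g : V → ℂ} (hg : RapidDecay g) : Integrable g := by
  simpa using memLp_one_iff_integrable.1 (hg.memLp_pow 0 (.inl rfl))

theorem norm_fourierPowSMulRight_innerSL_le (g : V → ℂ) (x : V) (n : ℕ) :
    ‖VectorFourier.fourierPowSMulRight (innerSL ℝ) g x n‖ ≤ (2 * Real.pi) ^ n * ‖‖x‖ ^ n • g x‖ := by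
  refine (VectorFourier.norm_fourierPowSMulRight_le _ g x n).trans ?_
  have h : ‖(innerSL ℝ : V →L[ℝ] V →L[ℝ] ℝ)‖ ≤ 1 := norm_innerSL_le ℝ
  rw [norm_smul, norm_pow, norm_norm, ← mul_assoc]
  refine mul_le_mul_of_nonneg_right (mul_le_mul_of_nonneg_right ?_ (by positivity)) (norm_nonneg _)
  refine pow_le_pow_left₀ (by positivity) ?_ n
  exact mul_le_of_le_one_right Real.two_pi_pos.le h

theorem RapidDecay.memLp_fourierPowSMulRight {g : V → ℂ} (hg : RapidDecay g) (n : ℕ) {p : ℝ≥0∞}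
    (hp : p = 1 ∨ p = 2) :
    MemLp (fun x => VectorFourier.fourierPowSMulRight (innerSL ℝ) g x n) p := by
  refine ((hg.memLp_pow n hp).const_smul ((2 * Real.pi) ^ n : ℝ)).mono
    (hg.1.fourierPowSMulRight _ n) (.of_forall fun x => ?_)
  refine (norm_fourierPowSMulRight_innerSL_le g x n).trans (le_of_eq ?_)
  rw [Pi.smul_apply, norm_smul ((2 * Real.pi) ^ n : ℝ), Real.norm_of_nonneg (by positivity)]

theorem RapidDecay.contDiff_fourier {g : V → ℂ} (hg : RapidDecay g) : ContDiff ℝ ∞ (𝓕 g) :=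
  Real.contDiff_fourier (N := ⊤) fun n _ => hg.integrable_pow n

theorem RapidDecay.iteratedFDeriv_fourier {g : V → ℂ} (hg : RapidDecay g) (n : ℕ) :
    iteratedFDeriv ℝ n (𝓕 g) =
      𝓕 (fun x => VectorFourier.fourierPowSMulRight (innerSL ℝ) g x n) :=
  Real.iteratedFDeriv_fourier (N := ⊤) (fun n _ => hg.integrable_pow n) hg.1 le_top

/-- Differentiating `n` times multiplies `g` by a tensor of size `(2π‖ξ‖)ⁿ` before the transform. A
bound linear in `g`, with `C` independent of it, is what later yields continuity in time for the
seminorms of `H^∞`. -/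
theorem eLpNorm_iteratedFDeriv_fourier_le (n : ℕ) :
    ∃ C : ℝ≥0∞, C ≠ ⊤ ∧ ∀ g : V → ℂ, RapidDecay g →
      eLpNorm (iteratedFDeriv ℝ n (𝓕 g)) 2 volume ≤ C * wnorm (polyWeight 1 n) 2 g := by
  have := finiteDimensional_continuousMultilinearMap V ℂ n
  obtain ⟨C, hC, h⟩ := eLpNorm_fourier_le_of_finiteDimensional (V := V)
    (ContinuousMultilinearMap ℝ (fun _ : Fin n => V) ℂ)
  refine ⟨C * ENNReal.ofReal ((2 * Real.pi) ^ n), ENNReal.mul_ne_top hC ENNReal.ofReal_ne_top,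
    fun g hg => ?_⟩
  rw [hg.iteratedFDeriv_fourier]
  refine (h _ (memLp_one_iff_integrable.1 (hg.memLp_fourierPowSMulRight n (.inl rfl)))
    (hg.memLp_fourierPowSMulRight n (.inr rfl))).trans ?_
  rw [mul_assoc]
  gcongr
  refine eLpNorm_le_mul_eLpNorm_of_ae_le_mul (.of_forall fun x => ?_) 2
  refine (norm_fourierPowSMulRight_innerSL_le g x n).trans ?_
  have := pow_norm_mul_le_polyWeight le_rfl (n := n) x
  gcongr
  rw [norm_smul, norm_smul, Real.norm_of_nonneg (by positivity),
    Real.norm_of_nonneg ((by positivity : (0 : ℝ) ≤ ‖x‖ ^ n).trans this)]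
  gcongr

theorem RapidDecay.memLp_iteratedFDeriv_fourier {g : V → ℂ} (hg : RapidDecay g) (n : ℕ) :
    MemLp (iteratedFDeriv ℝ n (𝓕 g)) 2 := by
  obtain ⟨C, hC, h⟩ := eLpNorm_iteratedFDeriv_fourier_le (V := V) n
  refine ⟨(hg.contDiff_fourier.continuous_iteratedFDeriv (by exact_mod_cast le_top)).aestronglyMeasurable,
    (h g hg).trans_lt (ENNReal.mul_lt_top hC.lt_top (hg.2 n 2 (.inr rfl)))⟩

theorem RapidDecay.laplacian_fourier {g : V → ℂ} (hg : RapidDecay g) (x : V) :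
    Laplacian.laplacian (𝓕 g : V → ℂ) x
      = 𝓕 (fun y => (-(4 * Real.pi ^ 2 * ‖y‖ ^ 2) : ℝ) • g y) x := by
  have hi := memLp_one_iff_integrable.1 (hg.memLp_fourierPowSMulRight 2 (.inl rfl))
  have e := InnerProductSpace.laplacian_eq_iteratedFDeriv_orthonormalBasis (𝓕 g)
    (stdOrthonormalBasis ℝ V)
  rw [e, hg.iteratedFDeriv_fourier]
  simp only [Real.fourier_continuousMultilinearMap_apply hi]
  simp only [Real.fourier_eq]
  rw [← integral_finsetSum]
  · refine integral_congr_ae (.of_forall fun y => ?_)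
    simp only
    rw [← Finset.smul_sum]
    congr 1
    have hs := (stdOrthonormalBasis ℝ V).sum_sq_norm_inner_left y
    simp only [VectorFourier.fourierPowSMulRight_apply, Fin.prod_univ_two,
      Matrix.cons_val_zero, Matrix.cons_val_one]
    rw [← Finset.smul_sum, ← Finset.sum_smul]
    -- Parseval in an orthonormal basis: the trace of the second order multiplier is `‖y‖²`.
    have hs' : ∑ i, innerSL ℝ y (stdOrthonormalBasis ℝ V i) *
        innerSL ℝ y (stdOrthonormalBasis ℝ V i) = ‖y‖ ^ 2 := by
      rw [← hs]; refine Finset.sum_congr rfl fun i _ => ?_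
      rw [Real.norm_eq_abs, sq_abs, sq]; rfl
    rw [hs']
    have hI : (-(2 * (Real.pi : ℂ) * Complex.I)) ^ 2 = ((-(4 * Real.pi ^ 2) : ℝ) : ℂ) := by
      push_cast
      rw [neg_sq, mul_pow, Complex.I_sq]; ring
    rw [hI, Complex.real_smul, Complex.real_smul, smul_eq_mul]
    push_cast
    ring
  · intro i _
    exact (Real.fourierIntegral_convergent_iff x).2
      ((ContinuousMultilinearMap.apply ℝ (fun _ : Fin 2 => V) ℂ
        ![stdOrthonormalBasis ℝ V i, stdOrthonormalBasis ℝ V i]).integrable_comp hi)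

end Regularity

section Operations

theorem fourier_sharp (f : V → ℂ) (x : V) : 𝓕 (sharp f) x = (starRingEnd ℂ) (𝓕 f x) := by
  rw [Real.fourier_eq', Real.fourier_eq', ← integral_conj,
    ← integral_neg_eq_self (fun v => Complex.exp _ • sharp f v)]
  refine integral_congr_ae (.of_forall fun y => ?_)
  simp only [sharp, neg_neg, smul_eq_mul, map_mul, inner_neg_left, ← Complex.exp_conj,
    Complex.conj_I, Complex.conj_ofReal]
  congr 2
  push_cast
  ring

/-- Evaluation at `x` of the Fourier transform, as a continuous linear form on `L¹`. -/
def fourierEval (x : V) : LOne V →L[ℂ] ℂ :=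
  LinearMap.mkContinuous
    { toFun := fun f => Real.Lp.fourierTransformCLM V ℂ f x
      map_add' := fun f g => by rw [map_add]; rfl
      map_smul' := fun c f => by rw [map_smul]; rfl } 1
    (fun f => by
      rw [one_mul]
      change ‖𝓕 (f : V → ℂ) x‖ ≤ ‖f‖
      rw [Real.fourier_eq]
      apply (norm_integral_le_integral_norm _).trans
      simp_rw [Circle.norm_smul]
      exact (L1.norm_eq_integral_norm f).symm.le)

theorem fourierEval_apply (x : V) (f : LOne V) : fourierEval x f = 𝓕 (f : V → ℂ) x := rfl

theorem norm_fourierEval_le (x : V) (f : LOne V) : ‖fourierEval x f‖ ≤ ‖f‖ := by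
  rw [← one_mul ‖f‖]
  refine ((fourierEval x).le_opNorm f).trans ?_
  gcongr
  exact LinearMap.mkContinuous_norm_le _ zero_le_one _

theorem fourierEval_convL (x : V) (f g : LOne V) :
    fourierEval x (convL f g) = fourierEval x f * fourierEval x g := by
  rw [fourierEval_apply, Real.fourier_congr_ae (coeFn_convL f g)]
  exact Real.fourier_mul_convolution_eq f.integrable g.integrable x

theorem fourierEval_cubic (x : V) (f : LOne V) :
    fourierEval x (cubic f) = (‖fourierEval x f‖ : ℂ) ^ 2 * fourierEval x f := by
  rw [cubic, fourierEval_convL, fourierEval_convL]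
  have : fourierEval x (sharpL f) = (starRingEnd ℂ) (fourierEval x f) := by
    rw [fourierEval_apply, Real.fourier_congr_ae (coeFn_sharpL f), fourier_sharp,
      fourierEval_apply]
  rw [this, Complex.mul_conj']

end Operations

end

/-! ### Time derivatives, time continuity and existence of solutions. -/

section

open scoped FourierTransform

variable {V : Type*} [NormedAddCommGroup V] [InnerProductSpace ℝ V] [FiniteDimensional ℝ V]
  [MeasurableSpace V] [BorelSpace V]

theorem RapidDecay.congr_ae {f g : V → ℂ} (hf : RapidDecay f) (h : f =ᵐ[volume] g) :
    RapidDecay g :=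
  ⟨hf.1.congr h, fun n p hp => by rw [← wnorm_congr_ae h]; exact hf.2 n p hp⟩

theorem RapidDecay.propagator {f : LOne V} (hf : RapidDecay (f : V → ℂ)) (c : ℝ) :
    RapidDecay (propagator c f : V → ℂ) :=
  ⟨Lp.aestronglyMeasurable _, fun n p hp => by rw [wnorm_propagator]; exact hf.2 n p hp⟩

theorem RapidDecay.add {f g : V → ℂ} (hf : RapidDecay f) (hg : RapidDecay g) :
    RapidDecay (f + g) :=
  ⟨hf.1.add hg.1, fun n p hp => (wnorm_add_le
    (isSubmulWeight_polyWeight zero_le_one n).continuous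
    (by rcases hp with rfl | rfl <;> norm_num) hf.1 hg.1).trans_lt
      (ENNReal.add_lt_top.2 ⟨hf.2 n p hp, hg.2 n p hp⟩)⟩

theorem RapidDecay.const_smul {f : V → ℂ} (hf : RapidDecay f) (c : ℂ) : RapidDecay (c • f) :=
  ⟨hf.1.const_smul c, fun n p hp => by
    rw [wnorm_const_smul]; exact ENNReal.mul_lt_top enorm_lt_top (hf.2 n p hp)⟩

theorem RapidDecay.sub {f g : V → ℂ} (hf : RapidDecay f) (hg : RapidDecay g) :
    RapidDecay (f - g) := by
  have := hf.add (hg.const_smul (-1))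
  rwa [neg_one_smul, ← sub_eq_add_neg] at this

section TimeDerivative

theorem hasDerivAt_phase (κ s : ℝ) (x : V) :
    HasDerivAt (fun s => phase (κ * s) x)
      (-(Complex.I * (κ * ‖x‖ ^ 2 : ℝ)) * phase (κ * s) x) s := by
  have h : HasDerivAt (fun s : ℝ => -(Complex.I * ((κ * s * ‖x‖ ^ 2 : ℝ) : ℂ)))
      (-(Complex.I * (κ * ‖x‖ ^ 2 : ℝ))) s := by
    have h1 : HasDerivAt (fun s : ℝ => κ * s * ‖x‖ ^ 2) (κ * ‖x‖ ^ 2) s := by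
      simpa using ((hasDerivAt_id s).const_mul κ).mul_const (‖x‖ ^ 2)
    exact (h1.ofReal_comp.const_mul Complex.I).neg
  have := h.cexp
  unfold phase
  rwa [mul_comm] at this

theorem fourierEval_propagator (x : V) (c : ℝ) (f : LOne V) :
    fourierEval x (propagator c f) = ∫ y, Real.fourierChar (-inner ℝ y x) • (phase c y * f y) := by
  rw [fourierEval_apply, Real.fourier_congr_ae (coeFn_propagator c f), Real.fourier_eq]

/-- Differentiation under the integral; the phase brings down `κ‖ξ‖²`, so the second moment of `f`
serves as dominating function. -/
theorem hasDerivAt_fourierEval_propagator {f : LOne V} (hf : RapidDecay (f : V → ℂ)) (κ t : ℝ)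
    (x : V) : HasDerivAt (fun s => fourierEval x (propagator (κ * s) f))
      (𝓕 (fun y => -(Complex.I * (κ * ‖y‖ ^ 2 : ℝ)) * propagator (κ * t) f y) x) t := by
  simp only [fourierEval_propagator]
  have e : 𝓕 (fun y => -(Complex.I * (κ * ‖y‖ ^ 2 : ℝ)) * propagator (κ * t) f y) x
      = ∫ y, Real.fourierChar (-inner ℝ y x) •
        ((-(Complex.I * (κ * ‖y‖ ^ 2 : ℝ)) * phase (κ * t) y) * f y) := by
    rw [Real.fourier_eq]
    refine integral_congr_ae ?_
    filter_upwards [coeFn_propagator (κ * t) f] with y hy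
    rw [hy, mul_assoc]
  rw [e]
  have hchar : Continuous fun y : V => Real.fourierChar (-inner ℝ y x) :=
    Real.continuous_fourierChar.comp (by fun_prop)
  have hm : ∀ φ : V → ℂ, Continuous φ → AEStronglyMeasurable
      (fun y => Real.fourierChar (-inner ℝ y x) • (φ y * f y)) volume := fun φ hφ => by
    exact hchar.aestronglyMeasurable.smul (hφ.aestronglyMeasurable.mul hf.1)
  refine (hasDerivAt_integral_of_dominated_loc_of_deriv_le (s := Set.univ)
    (F' := fun s y => Real.fourierChar (-inner ℝ y x) •
      ((-(Complex.I * (κ * ‖y‖ ^ 2 : ℝ)) * phase (κ * s) y) * f y))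
    (bound := fun y => |κ| * (‖y‖ ^ 2 * ‖f y‖)) univ_mem
    (.of_forall fun s => hm _ (continuous_phase _)) ?_
    (hm (fun y => -(Complex.I * (κ * ‖y‖ ^ 2 : ℝ)) * phase (κ * t) y) (by fun_prop)) ?_
    ((hf.integrable_pow 2).const_mul _) ?_).2
  · exact (Real.fourierIntegral_convergent_iff x).2 (integrable_phase_mul _ hf.integrable)
  · refine .of_forall fun y s _ => le_of_eq ?_
    rw [Circle.norm_smul, norm_mul, norm_mul, norm_neg, norm_mul, Complex.norm_I, norm_phase,
      Complex.norm_real, norm_mul, norm_pow, norm_norm, Real.norm_eq_abs]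
    ring
  · refine .of_forall fun y s _ => ?_
    have := ((hasDerivAt_phase κ s y).mul_const (f y)).const_smul (Real.fourierChar (-inner ℝ y x))
    exact this

theorem hasDerivWithinAt_fourierEval_propagator {h : ℝ → LOne V} {h' : LOne V} {S : Set ℝ} {t : ℝ}
    (hh : HasDerivWithinAt h h' S t) (hf : RapidDecay (h t : V → ℂ)) (κ : ℝ) (x : V) :
    HasDerivWithinAt (fun s => fourierEval x (propagator (κ * s) (h s)))
      (fourierEval x (propagator (κ * t) h') +
        𝓕 (fun y => -(Complex.I * (κ * ‖y‖ ^ 2 : ℝ)) * propagator (κ * t) (h t) y) x) S t := by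
  -- Product rule without differentiability of the propagator on all of `L¹`: `h s` is split into `h
  -- s - h t` and the fixed, rapidly decaying `h t`. For the first piece, isometry and strong
  -- continuity suffice to pass to the limit in the slopes.
  have hA : HasDerivWithinAt (fun s => fourierEval x (propagator (κ * s) (h s - h t)))
      (fourierEval x (propagator (κ * t) h')) S t := by
    rw [hasDerivWithinAt_iff_tendsto_slope] at hh ⊢
    have e : slope (fun s => fourierEval x (propagator (κ * s) (h s - h t))) t
        = fun s => fourierEval x (propagator (κ * s) (slope h t s)) := by
      ext s
      simp only [slope, vsub_eq_sub, sub_self, map_zero, sub_zero]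
      rw [LinearMapClass.map_smul_of_tower, LinearMapClass.map_smul_of_tower]
    rw [e]
    refine ((fourierEval x).continuous.tendsto _).comp ?_
    rw [tendsto_iff_norm_sub_tendsto_zero] at hh ⊢
    have hc : Tendsto (fun s => ‖propagator (κ * s) h' - propagator (κ * t) h'‖)
        (𝓝[S \ {t}] t) (𝓝 0) := by
      have := (continuous_propagator_left h').comp
        (continuous_const.mul continuous_id : Continuous fun s => κ * s)
      exact tendsto_iff_norm_sub_tendsto_zero.1 ((this.tendsto t).mono_left nhdsWithin_le_nhds)
    refine squeeze_zero (fun _ => norm_nonneg _) (fun s => ?_) (by simpa using hh.add hc)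
    calc _ ≤ ‖propagator (κ * s) (slope h t s) - propagator (κ * s) h'‖
          + ‖propagator (κ * s) h' - propagator (κ * t) h'‖ := norm_sub_le_norm_sub_add_norm_sub ..
      _ = _ := by rw [← map_sub, LinearIsometry.norm_map]
  have e : (fun s => fourierEval x (propagator (κ * s) (h s)))
      = (fun s => fourierEval x (propagator (κ * s) (h s - h t)))
        + fun s => fourierEval x (propagator (κ * s) (h t)) := by
    ext s
    simp only [Pi.add_apply, ← map_add, sub_add_cancel]
  rw [e]
  exact hA.add (hasDerivAt_fourierEval_propagator hf κ t x).hasDerivWithinAt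

end TimeDerivative

section TimeContinuity

theorem norm_phase_sub_le (c c' : ℝ) (x : V) : ‖phase c x - phase c' x‖ ≤ |c - c'| * ‖x‖ ^ 2 := by
  have h : ∀ a : ℝ, ‖Complex.exp (Complex.I * a) - 1‖ ≤ |a| := fun a => by
    simpa using Real.norm_exp_I_mul_ofReal_sub_one_le (x := a)
  have e : phase c x - phase c' x
      = phase c' x * (Complex.exp (Complex.I * (-((c - c') * ‖x‖ ^ 2) : ℝ)) - 1) := by
    rw [mul_sub, mul_one, phase, phase, ← Complex.exp_add]
    congr 2
    push_cast
    ring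
  rw [e, norm_mul, norm_phase, one_mul]
  refine (h _).trans (le_of_eq ?_)
  rw [abs_neg, abs_mul, abs_of_nonneg (by positivity : 0 ≤ ‖x‖ ^ 2)]

theorem wnorm_phase_sub_mul_le (n : ℕ) (p : ℝ≥0∞) (c c' : ℝ) (f : V → ℂ) :
    wnorm (polyWeight 1 n) p (fun x => (phase c x - phase c' x) * f x)
      ≤ ENNReal.ofReal |c - c'| * wnorm (polyWeight 1 (n + 2)) p f := by
  refine eLpNorm_le_mul_eLpNorm_of_ae_le_mul (.of_forall fun x => ?_) p
  have h0 := (isSubmulWeight_polyWeight zero_le_one n).nonneg x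
  have h1 := pow_norm_mul_le_polyWeight (le_refl 2) x
  have h2 : polyWeight 1 (n + 2) x = polyWeight 1 n x * polyWeight 1 2 x := pow_add _ _ _
  rw [norm_smul, norm_smul, norm_mul, h2, norm_mul, Real.norm_of_nonneg h0,
    Real.norm_of_nonneg ((by positivity : (0 : ℝ) ≤ ‖x‖ ^ 2).trans h1)]
  calc _ ≤ polyWeight 1 n x * ((|c - c'| * polyWeight 1 2 x) * ‖f x‖) := by
        gcongr
        exact (norm_phase_sub_le c c' x).trans (by gcongr)
    _ = _ := by ring

/-- Lipschitz dependence on the time parameter costs two powers of the weight, since the phases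
differ by at most `|c - c'|‖ξ‖²`. All powers being available, the loss does not matter. -/
theorem wnorm_propagator_sub_le (n : ℕ) {p : ℝ≥0∞} (hp : 1 ≤ p) (c c' : ℝ) (f g : LOne V) :
    wnorm (polyWeight 1 n) p (propagator c f - propagator c' g : LOne V)
      ≤ wnorm (polyWeight 1 n) p (f - g : LOne V)
        + ENNReal.ofReal |c - c'| * wnorm (polyWeight 1 (n + 2)) p g := by
  have hc := (isSubmulWeight_polyWeight zero_le_one n :
    IsSubmulWeight (polyWeight 1 n : V → ℝ)).continuous
  have e : (propagator c f - propagator c' g : LOne V)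
      = propagator c (f - g) + (propagator c g - propagator c' g) := by rw [map_sub]; abel
  rw [e, wnorm_congr_ae (Lp.coeFn_add _ _)]
  refine (wnorm_add_le hc hp (Lp.aestronglyMeasurable _) (Lp.aestronglyMeasurable _)).trans ?_
  gcongr
  · rw [wnorm_propagator]
  · have e' : ((propagator c g - propagator c' g : LOne V) : V → ℂ) =ᵐ[volume]
        fun x => (phase c x - phase c' x) * g x := by
      filter_upwards [Lp.coeFn_sub (propagator c g) (propagator c' g), coeFn_propagator c g,
        coeFn_propagator c' g] with x h1 h2 h3
      rw [h1, Pi.sub_apply, h2, h3, sub_mul]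
    rw [wnorm_congr_ae e']
    exact wnorm_phase_sub_mul_le n p c c' _

end TimeContinuity

/-- The frequency scale of the free Schrödinger equation `i ε ∂ₜu + (ε²/2) Δu = 0` under the Fourier
transform with kernel `exp (-2πi x·ξ)`. -/
def kappa (ε : ℝ) : ℝ := 2 * Real.pi ^ 2 * ε

/-- Existence: data with small `L¹` norm on the Fourier side give a solution on
`[0, T]`, whatever `ε`. -/
theorem exists_isSolution {d : ℕ} {T : ℝ} (hT : 0 ≤ T) {M : ℝ} (hM : 24 * M ^ 2 * T ≤ 1) (ε : ℝ)
    {h₀ : LOne (EuclideanSpace ℝ (Fin d))} (hh₀ : ‖h₀‖ < M)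
    (hrd : RapidDecay (h₀ : EuclideanSpace ℝ (Fin d) → ℂ)) :
    ∃ h : ℝ → LOne (EuclideanSpace ℝ (Fin d)), Continuous h ∧ (∀ t, ‖h t‖ ≤ 2 * M) ∧
      (∀ t ∈ Set.Icc 0 T, h t = h₀ + ∫ s in (0 : ℝ)..t, field (kappa ε) s (h s)) ∧
      IsSolution T ε (fun x => fourierEval x h₀)
        (fun t x => fourierEval x (propagator (kappa ε * t) (h t))) := by
  obtain ⟨h, hcont, hbd, heq, hw⟩ := exists_mild_solution hT (kappa ε) hM hh₀.le
  set κ := kappa ε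
  -- For each degree, go to the equivalent weight with small `l`, propagate the norm there, and come
  -- back; the constant depends on `n` but the time interval does not.
  have hbound : ∀ n : ℕ, ∀ p : ℝ≥0∞, p = 1 ∨ p = 2 → ∃ R : ℝ≥0∞, R ≠ ⊤ ∧
      ∀ t, wnorm (polyWeight 1 n) p (h t) ≤ R := fun n p hp => by
    obtain ⟨l, hl, hl1, hlM⟩ := exists_polyWeight_wnorm_le hh₀ n (hrd.2 n 1 (.inl rfl)).ne
    have hwl := isSubmulWeight_polyWeight hl.le n (V := EuclideanSpace ℝ (Fin d))
    refine ⟨ENNReal.ofReal (l⁻¹ ^ n) * (2 * wnorm (polyWeight 1 n) p h₀),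
      ENNReal.mul_ne_top ENNReal.ofReal_ne_top (ENNReal.mul_ne_top (by norm_num)
        (hrd.2 n p hp).ne), fun t => ?_⟩
    refine (wnorm_polyWeight_le hl hl1 n p _).trans ?_
    gcongr
    refine (hw _ hwl hlM p hp t).trans ?_
    gcongr
    refine wnorm_mono_weight hwl.nonneg (fun x => ?_) _ _
    unfold polyWeight
    have := norm_nonneg x
    gcongr
  have hrdt : ∀ t, RapidDecay (h t : EuclideanSpace ℝ (Fin d) → ℂ) := fun t =>
    ⟨Lp.aestronglyMeasurable _, fun n p hp => by
      obtain ⟨R, hR, hle⟩ := hbound n p hp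
      exact (hle t).trans_lt hR.lt_top⟩
  -- In the interaction picture the solution is Lipschitz in time with values in every weighted `L²`
  -- space, because the free flow, which loses weights, has been factored out.
  have hincr : ∀ n : ℕ, ∃ R : ℝ≥0∞, R ≠ ⊤ ∧ ∀ t ∈ Set.Icc 0 T, ∀ s ∈ Set.Icc 0 T,
      wnorm (polyWeight 1 n) 2 (h s - h t : LOne _) ≤ ENNReal.ofReal |s - t| * R := fun n => by
    obtain ⟨R₁, hR₁, h₁⟩ := hbound n 1 (.inl rfl)
    obtain ⟨R₂, hR₂, h₂⟩ := hbound n 2 (.inr rfl)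
    have hwn := isSubmulWeight_polyWeight zero_le_one n (V := EuclideanSpace ℝ (Fin d))
    have hF := continuous_field (κ := κ) hcont
    have main : ∀ t ∈ Set.Icc 0 T, ∀ s ∈ Set.Icc 0 T, t ≤ s →
        wnorm (polyWeight 1 n) 2 (h s - h t : LOne _)
          ≤ ENNReal.ofReal (s - t) * (R₁ ^ 2 * R₂) := fun t ht s hs hts => by
      have e : h s - h t = ∫ r in t..s, field κ r (h r) := by
        rw [heq s hs, heq t ht, add_sub_add_left_eq_sub, intervalIntegral.integral_interval_sub_left
          (hF.intervalIntegrable _ _) (hF.intervalIntegrable _ _)]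
      rw [e]
      refine wnorm_intervalIntegral_le hwn.continuous (by norm_num) hts hF fun r _ => ?_
      refine (wnorm_field_le hwn (.inr rfl) _ _ _).trans ?_
      gcongr
      exacts [h₁ r, h₂ r]
    refine ⟨R₁ ^ 2 * R₂, ENNReal.mul_ne_top (ENNReal.pow_ne_top hR₁) hR₂, fun t ht s hs => ?_⟩
    rcases le_total t s with hts | hts
    · rw [abs_of_nonneg (sub_nonneg.2 hts)]
      exact main t ht s hs hts
    · rw [abs_of_nonpos (sub_nonpos.2 hts), neg_sub]
      refine le_trans (le_of_eq ?_) (main s hs t ht hts)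
      refine wnorm_congr_norm_ae ?_
      filter_upwards [Lp.coeFn_sub (h s) (h t), Lp.coeFn_sub (h t) (h s)] with x e1 e2
      rw [e1, e2, Pi.sub_apply, Pi.sub_apply, norm_sub_rev]
  have hu : ∀ t, (fun x => fourierEval x (propagator (κ * t) (h t)))
      = 𝓕 (propagator (κ * t) (h t) : EuclideanSpace ℝ (Fin d) → ℂ) := fun t => rfl
  refine ⟨h, hcont, hbd, heq, ⟨⟨fun t _ => ?_, fun n t ht => ?_⟩, fun x => ?_, fun t ht x => ?_⟩⟩
  · exact ⟨((hrdt t).propagator _).contDiff_fourier,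
      ((hrdt t).propagator _).memLp_iteratedFDeriv_fourier⟩
  · obtain ⟨C, hC, hCle⟩ := eLpNorm_iteratedFDeriv_fourier_le (V := EuclideanSpace ℝ (Fin d)) n
    obtain ⟨R, hR, hRle⟩ := hincr n
    have hsub : ∀ s, ((fun x => fourierEval x (propagator (κ * s) (h s)))
        - fun x => fourierEval x (propagator (κ * t) (h t)))
        = 𝓕 ((propagator (κ * s) (h s) - propagator (κ * t) (h t) : LOne _) :
          EuclideanSpace ℝ (Fin d) → ℂ) := fun s => by
      ext x
      rw [Pi.sub_apply, ← map_sub, fourierEval_apply]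
    simp only [hsub]
    set R' := wnorm (polyWeight 1 (n + 2)) 2 (h t) with hR'
    have hR'top : R' ≠ ⊤ := ((hrdt t).2 _ 2 (.inr rfl)).ne
    have hb : ∀ s ∈ Set.Icc 0 T, eLpNorm (iteratedFDeriv ℝ n
        (𝓕 ((propagator (κ * s) (h s) - propagator (κ * t) (h t) : LOne _) :
          EuclideanSpace ℝ (Fin d) → ℂ))) 2 volume ≤
        C * (ENNReal.ofReal |s - t| * R + ENNReal.ofReal |κ * s - κ * t| * R') := fun s hs => by
      refine (hCle _ ?_).trans ?_
      · exact (((hrdt s).propagator _).sub ((hrdt t).propagator _)).congr_ae (Lp.coeFn_sub _ _).symm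
      · gcongr
        refine (wnorm_propagator_sub_le n (by norm_num) _ _ _ _).trans ?_
        gcongr
        exact hRle t ht s hs
    have hlim : Tendsto (fun s => C * (ENNReal.ofReal |s - t| * R
        + ENNReal.ofReal |κ * s - κ * t| * R')) (𝓝[Set.Icc 0 T] t) (𝓝 0) := by
      have t1 : Tendsto (fun s => ENNReal.ofReal |s - t|) (𝓝[Set.Icc 0 T] t) (𝓝 0) := by
        have : Continuous fun s : ℝ => ENNReal.ofReal |s - t| :=
          ENNReal.continuous_ofReal.comp (by fun_prop)
        simpa using (this.tendsto t).mono_left nhdsWithin_le_nhds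
      have t2 : Tendsto (fun s => ENNReal.ofReal |κ * s - κ * t|) (𝓝[Set.Icc 0 T] t) (𝓝 0) := by
        have : Continuous fun s : ℝ => ENNReal.ofReal |κ * s - κ * t| :=
          ENNReal.continuous_ofReal.comp (by fun_prop)
        simpa using (this.tendsto t).mono_left nhdsWithin_le_nhds
      have t3 := (ENNReal.Tendsto.mul_const t1 (.inr hR)).add
        (ENNReal.Tendsto.mul_const t2 (.inr hR'top))
      simpa using ENNReal.Tendsto.const_mul t3 (.inr hC)
    refine tendsto_of_tendsto_of_tendsto_of_le_of_le' tendsto_const_nhds hlim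
      (.of_forall fun _ => zero_le) ?_
    filter_upwards [self_mem_nhdsWithin] with s hs using hb s hs
  · have : h 0 = h₀ := by simpa using heq 0 ⟨le_rfl, hT⟩
    simp [this]
  · have hd : HasDerivWithinAt h (field κ t (h t)) (Set.Icc 0 T) t := by
      have hF := continuous_field (κ := κ) hcont
      have h1 := (hF.integral_hasStrictDerivAt 0 t).hasDerivAt.const_add h₀
      exact h1.hasDerivWithinAt.congr heq (heq t ht)
    refine ⟨_, hasDerivWithinAt_fourierEval_propagator hd (hrdt t) κ x, ?_⟩
    have e1 : fourierEval x (propagator (κ * t) (field κ t (h t)))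
        = -Complex.I * ((‖fourierEval x (propagator (κ * t) (h t))‖ : ℂ) ^ 2
          * fourierEval x (propagator (κ * t) (h t))) := by
      rw [field, map_smul, ← propagator_add, add_neg_cancel, propagator_zero, map_smul,
        fourierEval_cubic, smul_eq_mul]
    -- The value of `kappa` is fixed by `-iκ‖ξ‖² = (iε/2) (-4π²‖ξ‖²)`.
    have e2 : 𝓕 (fun y => -(Complex.I * (κ * ‖y‖ ^ 2 : ℝ)) * propagator (κ * t) (h t) y) x
        = Complex.I * ε / 2 * Laplacian.laplacian
          (fun x => fourierEval x (propagator (κ * t) (h t))) x := by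
      rw [hu, ((hrdt t).propagator _).laplacian_fourier, Real.fourier_eq, Real.fourier_eq,
        ← integral_const_mul]
      refine integral_congr_ae (.of_forall fun y => ?_)
      simp only [Circle.smul_def, smul_eq_mul, Complex.real_smul, κ, kappa]
      push_cast
      ring
    rw [e1, e2]
    ring_nf
    simp only [Complex.I_sq]
    ring

end

/-! ### Sobolev embedding into bounded functions. -/

section

open scoped FourierTransform

variable {V : Type*} [NormedAddCommGroup V] [InnerProductSpace ℝ V] [FiniteDimensional ℝ V]
  [MeasurableSpace V] [BorelSpace V]

section SobolevEmbedding

variable {F : Type*} [NormedAddCommGroup F] [NormedSpace ℂ F] [FiniteDimensional ℂ F]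

theorem memLp_inv_one_add_norm_pow {n : ℕ} (hn : Module.finrank ℝ V < n) :
    MemLp (fun x : V => ((1 + ‖x‖) ^ n)⁻¹) 2 := by
  have hc : Continuous fun x : V => ((1 + ‖x‖) ^ n)⁻¹ :=
    Continuous.inv₀ (by fun_prop) fun x => by positivity
  rw [memLp_two_iff_integrable_sq_norm hc.aestronglyMeasurable]
  refine (integrable_one_add_norm (μ := (volume : Measure V)) (r := n) (by exact_mod_cast hn)).mono'
    (hc.norm.pow 2).aestronglyMeasurable (.of_forall fun x => ?_)
  have h1 : 1 ≤ (1 + ‖x‖) ^ n := one_le_pow₀ (by linarith [norm_nonneg x])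
  have h2 : ((1 + ‖x‖) ^ n)⁻¹ ≤ 1 := inv_le_one_of_one_le₀ h1
  have h3 : 0 ≤ ((1 + ‖x‖) ^ n)⁻¹ := by positivity
  rw [Real.rpow_neg (by positivity), Real.rpow_natCast, norm_pow, norm_norm,
    Real.norm_of_nonneg h3, sq]
  exact mul_le_of_le_one_left h3 h2

theorem norm_pow_smul_le_norm_fourierPowSMulRight (g : V → F) (n : ℕ) (x : V) :
    ‖‖x‖ ^ n • g x‖ ≤ ‖VectorFourier.fourierPowSMulRight (-innerSL ℝ) g x n‖ := by
  set A := VectorFourier.fourierPowSMulRight (-innerSL ℝ) g x n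
  -- Evaluation on the diagonal `(x, …, x)` shows that the tensor has operator norm at least
  -- `(2π)ⁿ‖x‖ⁿ‖g x‖` when `x ≠ 0`.
  have h := A.le_opNorm (fun _ => x)
  have e : ‖A fun _ => x‖ = (2 * Real.pi) ^ n * ‖x‖ ^ n * (‖x‖ ^ n * ‖g x‖) := by
    simp only [A, VectorFourier.fourierPowSMulRight_apply, Finset.prod_const, Finset.card_univ,
      Fintype.card_fin]
    have : ‖(-innerSL ℝ : V →L[ℝ] V →L[ℝ] ℝ) x x‖ = ‖x‖ ^ 2 := by
      rw [neg_apply, neg_apply, norm_neg]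
      change ‖inner ℝ x x‖ = _
      rw [real_inner_self_eq_norm_sq, norm_pow, norm_norm]
    rw [norm_smul, norm_smul, norm_pow, norm_pow, this]
    simp only [norm_neg, norm_mul, Complex.norm_I, Complex.norm_real, Complex.norm_ofNat,
      Real.norm_of_nonneg Real.pi_pos.le]
    ring
  rw [e, Finset.prod_const, Finset.card_univ, Fintype.card_fin] at h
  rw [norm_smul, norm_pow, norm_norm]
  rcases eq_or_ne x 0 with rfl | hx
  · rcases n.eq_zero_or_pos with rfl | hn
    · simpa using h
    · simp [hn.ne']
  · have hx' : 0 < ‖x‖ ^ n := by positivity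
    have h' : (2 * Real.pi) ^ n * (‖x‖ ^ n * ‖g x‖) ≤ ‖A‖ := by
      refine le_of_mul_le_mul_right ?_ hx'
      linarith
    refine le_trans (le_mul_of_one_le_left (by positivity) ?_) h'
    exact one_le_pow₀ (by linarith [Real.pi_gt_three])

variable (V F) in
-- Fourier inversion bounds `f` by the `L¹` norm of its transform, and Cauchy–Schwarz against `(1 +
-- ‖ξ‖)⁻ⁿ`, square integrable for `n > dim V`, bounds that by `L²` norms. Compact support supplies
-- all the integrability needed on the way.
theorem enorm_le_of_hasCompactSupport {n : ℕ} (hn : Module.finrank ℝ V < n) :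
    ∃ C : ℝ≥0∞, C ≠ ⊤ ∧ ∀ f : V → F, ContDiff ℝ ∞ f → HasCompactSupport f → ∀ x,
      ‖f x‖ₑ ≤ C * (eLpNorm f 2 volume + eLpNorm (iteratedFDeriv ℝ n f) 2 volume) := by
  have := FiniteDimensional.complete ℂ F
  have := finiteDimensional_continuousMultilinearMap V F n
  obtain ⟨C₀, hC₀, h₀⟩ := eLpNorm_fourier_le_of_finiteDimensional (V := V) F
  obtain ⟨C₁, hC₁, h₁⟩ := eLpNorm_fourier_le_of_finiteDimensional (V := V)
    (ContinuousMultilinearMap ℝ (fun _ : Fin n => V) F)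
  have hA := memLp_inv_one_add_norm_pow hn
  set A := eLpNorm (fun x : V => ((1 + ‖x‖) ^ n)⁻¹) 2 volume
  refine ⟨A * (2 ^ (n - 1) * (C₀ + C₁)), ENNReal.mul_ne_top hA.2.ne (ENNReal.mul_ne_top
    (ENNReal.pow_ne_top (by norm_num)) (ENNReal.add_ne_top.2 ⟨hC₀, hC₁⟩)), fun f hf hfc x => ?_⟩
  have hint : ∀ m : ℕ, Integrable (iteratedFDeriv ℝ m f) := fun m =>
    (hf.continuous_iteratedFDeriv (by exact_mod_cast le_top)).integrable_of_hasCompactSupport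
      (hfc.iteratedFDeriv m)
  have hfi : Integrable f := hf.continuous.integrable_of_hasCompactSupport hfc
  have hf2 : MemLp f 2 := hf.continuous.memLp_of_hasCompactSupport hfc
  have hn2 : MemLp (iteratedFDeriv ℝ n f) 2 :=
    (hf.continuous_iteratedFDeriv (by exact_mod_cast le_top)).memLp_of_hasCompactSupport
      (hfc.iteratedFDeriv n)
  have hFc := continuous_fourier hfi
  have hpow : eLpNorm (fun y => ‖y‖ ^ n • 𝓕 f y) 2 volume
      ≤ C₁ * eLpNorm (iteratedFDeriv ℝ n f) 2 volume := by
    refine le_trans ?_ (h₁ _ (hint n) hn2)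
    rw [Real.fourier_iteratedFDeriv (N := ⊤) hf (fun m _ => hint m) le_top]
    exact eLpNorm_mono fun y => norm_pow_smul_le_norm_fourierPowSMulRight _ n y
  have hweight : eLpNorm (fun y => (1 + ‖y‖) ^ n • 𝓕 f y) 2 volume
      ≤ 2 ^ (n - 1) * (C₀ + C₁) * (eLpNorm f 2 volume + eLpNorm (iteratedFDeriv ℝ n f) 2 volume) := by
    have hm : ∀ φ : V → ℝ, Continuous φ → AEStronglyMeasurable (fun y => φ y • 𝓕 f y) volume :=
      fun φ hφ => (hφ.smul hFc).aestronglyMeasurable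
    calc _ ≤ ENNReal.ofReal (2 ^ (n - 1)) *
          eLpNorm (fun y => ‖𝓕 f y‖ + ‖‖y‖ ^ n • 𝓕 f y‖) 2 volume := by
          refine eLpNorm_le_mul_eLpNorm_of_ae_le_mul (.of_forall fun y => ?_) 2
          have h := add_pow_le zero_le_one (norm_nonneg y) n
          rw [one_pow] at h
          rw [norm_smul, Real.norm_of_nonneg (by positivity), Real.norm_of_nonneg (by positivity),
            norm_smul, norm_pow, norm_norm]
          calc _ ≤ 2 ^ (n - 1) * (1 + ‖y‖ ^ n) * ‖𝓕 f y‖ := by gcongr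
            _ = _ := by ring
      _ ≤ 2 ^ (n - 1) * (C₀ * eLpNorm f 2 volume + C₁ * eLpNorm (iteratedFDeriv ℝ n f) 2 volume) := by
          rw [ENNReal.ofReal_pow (by norm_num), ENNReal.ofReal_ofNat]
          gcongr
          refine (eLpNorm_add_le hFc.norm.aestronglyMeasurable (hm _ (by fun_prop)).norm
            (by norm_num)).trans ?_
          rw [eLpNorm_norm, eLpNorm_norm]
          gcongr
          exact h₀ f hfi hf2
      _ ≤ 2 ^ (n - 1) * ((C₀ + C₁) * eLpNorm f 2 volume
            + (C₀ + C₁) * eLpNorm (iteratedFDeriv ℝ n f) 2 volume) := by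
          gcongr
          exacts [le_self_add, le_add_self]
      _ = _ := by ring
  have hL1 : eLpNorm (𝓕 f) 1 volume ≤ A * (2 ^ (n - 1) * (C₀ + C₁) *
      (eLpNorm f 2 volume + eLpNorm (iteratedFDeriv ℝ n f) 2 volume)) := by
    have e : 𝓕 f = (fun y : V => ((1 + ‖y‖) ^ n)⁻¹) • fun y => (1 + ‖y‖) ^ n • 𝓕 f y := by
      ext y
      have : (1 + ‖y‖) ^ n ≠ 0 := by positivity
      rw [Pi.smul_apply', smul_smul, inv_mul_cancel₀ this, one_smul]
    rw [e]
    refine (eLpNorm_smul_le_mul_eLpNorm (p := 2) (q := 2) (r := 1) ?_ hA.1).trans ?_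
    · exact ((by fun_prop : Continuous fun y : V => (1 + ‖y‖) ^ n).smul hFc).aestronglyMeasurable
    · gcongr
  have hFi : Integrable (𝓕 f) := by
    refine memLp_one_iff_integrable.1 ⟨hFc.aestronglyMeasurable, hL1.trans_lt ?_⟩
    exact ENNReal.mul_lt_top hA.2 (ENNReal.mul_lt_top (ENNReal.mul_lt_top
      (ENNReal.pow_lt_top (by norm_num)) (ENNReal.add_lt_top.2 ⟨hC₀.lt_top, hC₁.lt_top⟩))
      (ENNReal.add_lt_top.2 ⟨hf2.2, hn2.2⟩))
  have hinv := congrFun (hf.continuous.fourierInv_fourier_eq hfi hFi) x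
  rw [← hinv, Real.fourierInv_eq]
  refine (enorm_integral_le_lintegral_enorm _).trans ?_
  refine le_trans (le_of_eq ?_) (hL1.trans (le_of_eq (by ring)))
  rw [eLpNorm_one_eq_lintegral_enorm]
  refine lintegral_congr fun y => ?_
  rw [← ofReal_norm, ← ofReal_norm, Circle.norm_smul]

variable (V F) in
/-- The Sobolev embedding `H^n ⊂ L^∞`, `n > dim V`, for smooth functions. -/
theorem enorm_le_sum_eLpNorm_iteratedFDeriv {n : ℕ} (hn : Module.finrank ℝ V < n) :
    ∃ C : ℝ≥0∞, C ≠ ⊤ ∧ ∀ f : V → F, ContDiff ℝ ∞ f → ∀ x,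
      ‖f x‖ₑ ≤ C * ∑ i ∈ Finset.range (n + 1), eLpNorm (iteratedFDeriv ℝ i f) 2 volume := by
  obtain ⟨C, hC, h⟩ := enorm_le_of_hasCompactSupport V F hn
  let b : ContDiffBump (0 : V) := ⟨1, 2, one_pos, one_lt_two⟩
  set χ : V → ℝ := fun x => b x
  have hχ : ContDiff ℝ ∞ χ := b.contDiff
  have hχc : HasCompactSupport χ := b.hasCompactSupport
  have hχ0 : χ 0 = 1 := b.one_of_mem_closedBall (Metric.mem_closedBall_self b.rIn_pos.le)
  have hB : ∀ i : ℕ, ∃ B : ℝ, ∀ x, ‖iteratedFDeriv ℝ i χ x‖ ≤ B := fun i =>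
    (hχc.iteratedFDeriv i).exists_bound_of_continuous
      (hχ.continuous_iteratedFDeriv (by exact_mod_cast le_top))
  choose B hB using hB
  have hB0 : ∀ i, 0 ≤ B i := fun i => (norm_nonneg _).trans (hB i 0)
  -- Leibniz for a cutoff centred at `a`. The constant does not depend on `a`, so the compactly
  -- supported case can be applied with the cutoff centred at the very point of evaluation.
  have key : ∀ m : ℕ, m ≤ n → ∃ K : ℝ≥0∞, K ≠ ⊤ ∧ ∀ f : V → F, ContDiff ℝ ∞ f → ∀ a : V,
      eLpNorm (iteratedFDeriv ℝ m (fun y => χ (y - a) • f y)) 2 volume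
        ≤ K * ∑ i ∈ Finset.range (n + 1), eLpNorm (iteratedFDeriv ℝ i f) 2 volume := by
    intro m hm
    set K : ℝ := ∑ i ∈ Finset.range (m + 1), (m.choose i) * B i with hK
    have hK0 : 0 ≤ K := Finset.sum_nonneg fun i _ => mul_nonneg (by positivity) (hB0 i)
    refine ⟨ENNReal.ofReal K, ENNReal.ofReal_ne_top, fun f hf a => ?_⟩
    have hs : eLpNorm (∑ i ∈ Finset.range (n + 1), fun y => ‖iteratedFDeriv ℝ i f y‖) 2 volume
        ≤ ∑ i ∈ Finset.range (n + 1), eLpNorm (iteratedFDeriv ℝ i f) 2 volume := by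
      refine (eLpNorm_sum_le (fun i _ => ?_) (by norm_num)).trans (le_of_eq ?_)
      · exact (hf.continuous_iteratedFDeriv
          (by exact_mod_cast le_top)).norm.aestronglyMeasurable
      · exact Finset.sum_congr rfl fun i _ => eLpNorm_norm _
    refine le_trans ?_ (mul_le_mul_right hs _)
    refine eLpNorm_le_mul_eLpNorm_of_ae_le_mul (.of_forall fun y => ?_) 2
    have hχa : ContDiff ℝ ∞ fun y => χ (y - a) := hχ.comp (contDiff_id.sub contDiff_const)
    refine (norm_iteratedFDeriv_smul_le hχa hf y (n := m) (by exact_mod_cast le_top)).trans ?_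
    simp only [Finset.sum_apply]
    set S := ∑ i ∈ Finset.range (n + 1), ‖iteratedFDeriv ℝ i f y‖
    have hS0 : 0 ≤ S := Finset.sum_nonneg fun i _ => norm_nonneg _
    rw [Real.norm_of_nonneg hS0, hK, Finset.sum_mul]
    refine Finset.sum_le_sum fun i _ => ?_
    rw [iteratedFDeriv_comp_sub]
    gcongr
    · exact mul_nonneg (Nat.cast_nonneg _) (hB0 i)
    · exact hB i _
    · exact Finset.single_le_sum (f := fun i => ‖iteratedFDeriv ℝ i f y‖)
        (fun _ _ => norm_nonneg _) (Finset.mem_range.2 (by omega))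
  obtain ⟨K₀, hK₀, h₀⟩ := key 0 (Nat.zero_le _)
  obtain ⟨K₁, hK₁, h₁⟩ := key n le_rfl
  refine ⟨C * (K₀ + K₁), ENNReal.mul_ne_top hC (ENNReal.add_ne_top.2 ⟨hK₀, hK₁⟩),
    fun f hf x => ?_⟩
  have hsm : ContDiff ℝ ∞ fun y => χ (y - x) • f y :=
    (hχ.comp (contDiff_id.sub contDiff_const)).smul hf
  have hcs : HasCompactSupport fun y => χ (y - x) • f y := by
    have : HasCompactSupport fun y => χ (y - x) := by
      simp only [sub_eq_add_neg]
      exact hχc.comp_homeomorph (Homeomorph.addRight (-x))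
    exact this.smul_right
  have := h _ hsm hcs x
  simp only [sub_self, hχ0, one_smul] at this
  refine this.trans ?_
  rw [mul_assoc, add_mul]
  gcongr
  · refine le_trans (le_of_eq ?_) (h₀ f hf x)
    exact eLpNorm_congr_norm_ae (.of_forall fun y => by rw [norm_iteratedFDeriv_zero])
  · exact h₁ f hf x

end SobolevEmbedding

end

/-! ### Uniqueness by a localized energy estimate. -/

section

section Uniqueness

variable {d : ℕ}

theorem norm_iteratedFDeriv_fderiv_fderiv {E F : Type*} [NormedAddCommGroup E] [NormedSpace ℝ E]
    [NormedAddCommGroup F] [NormedSpace ℝ F] (f : E → F) (i : ℕ) (x : E) :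
    ‖iteratedFDeriv ℝ i (fderiv ℝ (fderiv ℝ f)) x‖ = ‖iteratedFDeriv ℝ (i + 2) f x‖ := by
  rw [norm_iteratedFDeriv_fderiv, norm_iteratedFDeriv_fderiv]

/-- Compactness of `[0, T]`: continuity bounds the seminorm near each time, and finitely many
neighbourhoods suffice. -/
theorem MemCHInfty.exists_eLpNorm_le {T : ℝ} {u : ℝ → EuclideanSpace ℝ (Fin d) → ℂ}
    (hu : MemCHInfty T u) (n : ℕ) : ∃ R : ℝ≥0∞, R ≠ ⊤ ∧ ∀ t ∈ Set.Icc 0 T,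
      eLpNorm (iteratedFDeriv ℝ n (u t)) 2 volume ≤ R := by
  refine isCompact_Icc.induction_on (p := fun S => ∃ R : ℝ≥0∞, R ≠ ⊤ ∧ ∀ t ∈ S ∩ Set.Icc 0 T,
      eLpNorm (iteratedFDeriv ℝ n (u t)) 2 volume ≤ R) ?_ ?_ ?_ ?_ |>.imp
        fun R h => ⟨h.1, fun t ht => h.2 t ⟨ht, ht⟩⟩
  · exact ⟨0, by simp, by simp⟩
  · rintro S S' hS ⟨R, hR, h⟩
    exact ⟨R, hR, fun t ht => h t ⟨hS ht.1, ht.2⟩⟩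
  · rintro S S' ⟨R, hR, h⟩ ⟨R', hR', h'⟩
    refine ⟨max R R', by simp [hR, hR'], ?_⟩
    rintro t ⟨ht | ht, htT⟩
    exacts [(h t ⟨ht, htT⟩).trans (le_max_left _ _), (h' t ⟨ht, htT⟩).trans (le_max_right _ _)]
  · intro t ht
    have hlim := (hu.2 n t ht).eventually_lt_const (u := 1) zero_lt_one
    refine ⟨{s | eLpNorm (iteratedFDeriv ℝ n (u s - u t)) 2 volume < 1}, hlim,
      1 + eLpNorm (iteratedFDeriv ℝ n (u t)) 2 volume,
      ENNReal.add_ne_top.2 ⟨by simp, ((hu.1 t ht).2 n).2.ne⟩, fun s hs => ?_⟩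
    have hs1 : eLpNorm (iteratedFDeriv ℝ n (u s - u t)) 2 volume < 1 := hs.1
    have hcs := (hu.1 s hs.2).1
    have hct := (hu.1 t ht).1
    have e : iteratedFDeriv ℝ n (u s)
        = iteratedFDeriv ℝ n (u s - u t) + iteratedFDeriv ℝ n (u t) := by
      ext1 x
      have hd : ContDiff ℝ ∞ (u s - u t) := hcs.sub hct
      rw [Pi.add_apply, ← iteratedFDeriv_add_apply (hd.contDiffAt.of_le
        (by exact_mod_cast le_top)) (hct.contDiffAt.of_le (by norm_cast; exact le_top)),
        sub_add_cancel]
    rw [e]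
    refine (eLpNorm_add_le ?_ ?_ (by norm_num)).trans ?_
    · exact ((hcs.sub hct).continuous_iteratedFDeriv
        (by exact_mod_cast le_top)).aestronglyMeasurable
    · exact (hct.continuous_iteratedFDeriv (by exact_mod_cast le_top)).aestronglyMeasurable
    · gcongr

/-- Sobolev embedding applied to `u t` and to its second derivative. These uniform bounds provide
the dominating functions for differentiating the localized mass, the time derivative being known
only pointwise in `x`. -/
theorem MemCHInfty.exists_norm_le {T : ℝ} {u : ℝ → EuclideanSpace ℝ (Fin d) → ℂ}
    (hu : MemCHInfty T u) : ∃ B : ℝ, ∀ t ∈ Set.Icc 0 T, ∀ x,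
      ‖u t x‖ ≤ B ∧ ‖fderiv ℝ (fderiv ℝ (u t)) x‖ ≤ B := by
  set n := Module.finrank ℝ (EuclideanSpace ℝ (Fin d)) + 1
  have hn : Module.finrank ℝ (EuclideanSpace ℝ (Fin d)) < n := Nat.lt_succ_self _
  have : FiniteDimensional ℂ (EuclideanSpace ℝ (Fin d) →L[ℝ] EuclideanSpace ℝ (Fin d) →L[ℝ] ℂ) :=
    Module.Finite.of_restrictScalars_finite ℝ ℂ _
  obtain ⟨C, hC, h⟩ := enorm_le_sum_eLpNorm_iteratedFDeriv (EuclideanSpace ℝ (Fin d)) ℂ hn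
  obtain ⟨C', hC', h'⟩ := enorm_le_sum_eLpNorm_iteratedFDeriv (EuclideanSpace ℝ (Fin d))
    (EuclideanSpace ℝ (Fin d) →L[ℝ] EuclideanSpace ℝ (Fin d) →L[ℝ] ℂ) hn
  choose R hR hRle using fun m => hu.exists_eLpNorm_le m
  set S := C * ∑ i ∈ Finset.range (n + 1), R i
  set S' := C' * ∑ i ∈ Finset.range (n + 1), R (i + 2)
  have hS : S ≠ ⊤ := ENNReal.mul_ne_top hC (ENNReal.sum_ne_top.2 fun i _ => hR i)
  have hS' : S' ≠ ⊤ := ENNReal.mul_ne_top hC' (ENNReal.sum_ne_top.2 fun i _ => hR _)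
  refine ⟨max S.toReal S'.toReal, fun t ht x => ⟨?_, ?_⟩⟩
  · refine le_trans ?_ (le_max_left _ _)
    rw [← toReal_enorm]
    refine ENNReal.toReal_mono hS ((h _ (hu.1 t ht).1 x).trans ?_)
    exact mul_le_mul_right (Finset.sum_le_sum fun i _ => hRle i t ht) C
  · refine le_trans ?_ (le_max_right _ _)
    refine (toReal_enorm (fderiv ℝ (fderiv ℝ (u t)) x)).symm.le.trans ?_
    have h1 : ContDiff ℝ ∞ (fderiv ℝ (u t)) := (hu.1 t ht).1.fderiv_right (by simp)
    have h2 : ContDiff ℝ ∞ (fderiv ℝ (fderiv ℝ (u t))) := h1.fderiv_right (by simp)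
    refine ENNReal.toReal_mono hS' ((h' _ h2 x).trans ?_)
    refine mul_le_mul_right (Finset.sum_le_sum fun i _ => ?_) C'
    refine le_trans (le_of_eq ?_) (hRle (i + 2) t ht)
    exact eLpNorm_congr_norm_ae (.of_forall fun y => norm_iteratedFDeriv_fderiv_fderiv _ _ _)

theorem laplacian_eq_sum_fderiv (f : EuclideanSpace ℝ (Fin d) → ℂ) (x : EuclideanSpace ℝ (Fin d)) :
    Laplacian.laplacian f x = ∑ i, fderiv ℝ (fderiv ℝ f) x
      (EuclideanSpace.basisFun (Fin d) ℝ i) (EuclideanSpace.basisFun (Fin d) ℝ i) := by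
  rw [InnerProductSpace.laplacian_eq_iteratedFDeriv_orthonormalBasis f
    (EuclideanSpace.basisFun (Fin d) ℝ)]
  simp [iteratedFDeriv_two_apply]

theorem norm_laplacian_le {f : EuclideanSpace ℝ (Fin d) → ℂ} {x : EuclideanSpace ℝ (Fin d)} {B : ℝ}
    (h : ‖fderiv ℝ (fderiv ℝ f) x‖ ≤ B) : ‖Laplacian.laplacian f x‖ ≤ d * B := by
  rw [laplacian_eq_sum_fderiv]
  refine (norm_sum_le _ _).trans ((Finset.sum_le_card_nsmul _ _ B fun i _ => ?_).trans (by simp))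
  refine (ContinuousLinearMap.le_opNorm₂ _ _ _).trans ?_
  simpa using h

theorem continuous_laplacian {f : EuclideanSpace ℝ (Fin d) → ℂ} (hf : ContDiff ℝ ∞ f) :
    Continuous (Laplacian.laplacian f) := by
  have h1 : ContDiff ℝ ∞ (fderiv ℝ f) := hf.fderiv_right (by simp)
  have h2 : Continuous (fderiv ℝ (fderiv ℝ f)) := (h1.fderiv_right (m := ∞) (by simp)).continuous
  rw [show Laplacian.laplacian f = _ from funext (laplacian_eq_sum_fderiv f)]
  fun_prop

theorem inner_I_mul_self (a : ℂ) : inner ℝ a (Complex.I * a) = 0 := by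
  rw [Complex.inner]
  simp [Complex.mul_re, Complex.mul_im]
  ring

/-- The localized mass flux of the free Schrödinger equation. -/
theorem abs_integral_mul_inner_laplacian_le {w : EuclideanSpace ℝ (Fin d) → ℂ}
    (hw : ContDiff ℝ ∞ w) {ψ : EuclideanSpace ℝ (Fin d) → ℝ} (hψ : ContDiff ℝ ∞ ψ)
    (hψc : HasCompactSupport ψ) {K : ℝ} (hK : ∀ x, ‖fderiv ℝ ψ x‖ ≤ K)
    (hi : Integrable fun x => ‖w x‖ * ‖fderiv ℝ w x‖) :
    |∫ x, ψ x * inner ℝ (w x) (Complex.I * Laplacian.laplacian w x)|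
      ≤ d * K * ∫ x, ‖w x‖ * ‖fderiv ℝ w x‖ := by
  set e := EuclideanSpace.basisFun (Fin d) ℝ
  have hw1 : ContDiff ℝ ∞ (fderiv ℝ w) := hw.fderiv_right (by simp)
  have hw2 : ContDiff ℝ ∞ (fderiv ℝ (fderiv ℝ w)) := hw1.fderiv_right (by simp)
  have hψ1 : ContDiff ℝ ∞ (fderiv ℝ ψ) := hψ.fderiv_right (by simp)
  have hwj : ∀ j, ContDiff ℝ ∞ fun x => Complex.I * fderiv ℝ w x (e j) := fun j =>
    contDiff_const.mul (hw1.clm_apply contDiff_const)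
  set q : Fin d → EuclideanSpace ℝ (Fin d) → ℝ := fun j x =>
    inner ℝ (w x) (Complex.I * fderiv ℝ w x (e j)) with hq
  have hqs : ∀ j, ContDiff ℝ ∞ (q j) := fun j => hw.inner ℝ (hwj j)
  -- The term `⟨∂ⱼw, i∂ⱼw⟩` vanishes, so the divergence of the current `q` is exactly `⟨w, iΔw⟩`;
  -- integration by parts then puts the derivative on `ψ`.
  have hdq : ∀ j x, fderiv ℝ (q j) x (e j)
      = inner ℝ (w x) (Complex.I * fderiv ℝ (fderiv ℝ w) x (e j) (e j)) := fun j x => by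
    have d1 : DifferentiableAt ℝ w x := (hw.differentiable (by simp)) x
    have d2 : DifferentiableAt ℝ (fderiv ℝ w) x := (hw1.differentiable (by simp)) x
    rw [hq, fderiv_inner_apply ℝ d1 ((hwj j).differentiable (by simp) x), inner_I_mul_self, add_zero]
    congr 1
    have d3 : HasFDerivAt (fun y => Complex.I * fderiv ℝ w y (e j)) _ x :=
      ((d2.hasFDerivAt.clm_apply (hasFDerivAt_const (e j) x)).const_mul Complex.I)
    rw [d3.fderiv]
    simp
  have hint : ∀ φ : EuclideanSpace ℝ (Fin d) → ℝ, Continuous φ → HasCompactSupport φ →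
      ∀ g : EuclideanSpace ℝ (Fin d) → ℝ, Continuous g → Integrable fun x => φ x * g x :=
    fun φ hφ hφc g hg => (hφ.mul hg).integrable_of_hasCompactSupport hφc.mul_right
  have hψj : ∀ j, HasCompactSupport fun x => fderiv ℝ ψ x (e j) := fun j =>
    (hψc.fderiv (𝕜 := ℝ)).comp_left (g := fun A : EuclideanSpace ℝ (Fin d) →L[ℝ] ℝ => A (e j)) (by simp)
  have hψjc : ∀ j, Continuous fun x => fderiv ℝ ψ x (e j) := fun j =>
    hψ1.continuous.clm_apply continuous_const
  have hdqc : ∀ j, Continuous fun x => fderiv ℝ (q j) x (e j) := fun j =>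
    (((hqs j).fderiv_right (m := ∞) (by simp)).continuous.clm_apply continuous_const)
  have hparts : ∫ x, ψ x * inner ℝ (w x) (Complex.I * Laplacian.laplacian w x)
      = - ∑ j, ∫ x, fderiv ℝ ψ x (e j) * q j x := by
    rw [← Finset.sum_neg_distrib]
    have : ∀ x, ψ x * inner ℝ (w x) (Complex.I * Laplacian.laplacian w x)
        = ∑ j, ψ x * fderiv ℝ (q j) x (e j) := fun x => by
      rw [laplacian_eq_sum_fderiv, Finset.mul_sum, inner_sum, Finset.mul_sum]
      exact Finset.sum_congr rfl fun j _ => by rw [hdq]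
    simp only [this]
    rw [integral_finsetSum _ fun j _ => hint ψ hψ.continuous hψc _ (hdqc j)]
    refine Finset.sum_congr rfl fun j _ => ?_
    exact integral_mul_fderiv_eq_neg_fderiv_mul_of_integrable
      (hint _ (hψjc j) (hψj j) _ (hqs j).continuous) (hint ψ hψ.continuous hψc _ (hdqc j))
      (hint ψ hψ.continuous hψc _ (hqs j).continuous)
      (fun x _ => hψ.differentiable (by simp) x) (fun x _ => (hqs j).differentiable (by simp) x)
  rw [hparts, abs_neg]
  refine (Finset.abs_sum_le_sum_abs _ _).trans ?_
  refine (Finset.sum_le_card_nsmul _ _ (K * ∫ x, ‖w x‖ * ‖fderiv ℝ w x‖) fun j _ => ?_).trans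
    (le_of_eq (by simp [mul_assoc]))
  rw [← integral_const_mul, ← Real.norm_eq_abs]
  refine norm_integral_le_of_norm_le (hi.const_mul K) (.of_forall fun x => ?_)
  have he : ‖e j‖ = 1 := by simp [e]
  have h1 : ‖fderiv ℝ ψ x (e j)‖ ≤ K :=
    ((fderiv ℝ ψ x).le_opNorm _).trans (by rw [he, mul_one]; exact hK x)
  have h2 : ‖q j x‖ ≤ ‖w x‖ * ‖fderiv ℝ w x‖ := by
    refine (norm_inner_le_norm _ _).trans ?_
    rw [norm_mul, Complex.norm_I, one_mul]
    gcongr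
    exact ((fderiv ℝ w x).le_opNorm _).trans (by rw [he, mul_one])
  rw [norm_mul]
  exact mul_le_mul h1 h2 (norm_nonneg _) ((norm_nonneg _).trans h1)

theorem norm_cubic_sub_cubic_le {a b : ℂ} {B : ℝ} (ha : ‖a‖ ≤ B) (hb : ‖b‖ ≤ B) :
    ‖(‖a‖ : ℂ) ^ 2 * a - (‖b‖ : ℂ) ^ 2 * b‖ ≤ 3 * B ^ 2 * ‖a - b‖ := by
  have hB : 0 ≤ B := (norm_nonneg a).trans ha
  have e : (‖a‖ : ℂ) ^ 2 * a - (‖b‖ : ℂ) ^ 2 * b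
      = (‖a‖ : ℂ) ^ 2 * (a - b) + ((‖a‖ - ‖b‖ : ℝ) : ℂ) * ((‖a‖ + ‖b‖ : ℝ) : ℂ) * b := by
    push_cast; ring
  rw [e]
  refine (norm_add_le _ _).trans ?_
  rw [norm_mul, norm_mul, norm_mul, norm_pow, Complex.norm_real, Complex.norm_real,
    Complex.norm_real, norm_norm, Real.norm_eq_abs, Real.norm_of_nonneg (by positivity)]
  have h1 := abs_norm_sub_norm_le a b
  have h2 : ‖a‖ ^ 2 * ‖a - b‖ ≤ B ^ 2 * ‖a - b‖ := by gcongr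
  have h3 : |‖a‖ - ‖b‖| * (‖a‖ + ‖b‖) * ‖b‖ ≤ ‖a - b‖ * (B + B) * B := by gcongr
  nlinarith

theorem IsSolution.exists_hasDerivWithinAt {T ε : ℝ} (hε : ε ≠ 0)
    {u₀ : EuclideanSpace ℝ (Fin d) → ℂ} {u : ℝ → EuclideanSpace ℝ (Fin d) → ℂ}
    (hu : IsSolution T ε u₀ u) {t : ℝ} (ht : t ∈ Set.Icc 0 T) (x : EuclideanSpace ℝ (Fin d)) :
    HasDerivWithinAt (fun s => u s x) ((ε / 2 : ℝ) * (Complex.I * Laplacian.laplacian (u t) x)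
      - Complex.I * ((‖u t x‖ : ℂ) ^ 2 * u t x)) (Set.Icc 0 T) t := by
  obtain ⟨v, hv, heq⟩ := hu.eqn t ht x
  have hε' : (ε : ℂ) ≠ 0 := by exact_mod_cast hε
  convert hv using 1
  have h : (ε : ℂ) * (Complex.I * v) = ε * ((‖u t x‖ : ℂ) ^ 2 * u t x
      - (ε / 2 : ℝ) * Laplacian.laplacian (u t) x) := by
    push_cast
    linear_combination heq
  have h' := mul_left_cancel₀ hε' h
  have hI := Complex.I_sq
  linear_combination Complex.I * h' - v * hI

theorem MemCHInfty.exists_integral_le {T : ℝ} {u v : ℝ → EuclideanSpace ℝ (Fin d) → ℂ}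
    (hu : MemCHInfty T u) (hv : MemCHInfty T v) : ∃ A : ℝ, ∀ t ∈ Set.Icc 0 T,
      Integrable (fun x => ‖(u t - v t) x‖ ^ 2) ∧
      Integrable (fun x => ‖(u t - v t) x‖ * ‖fderiv ℝ (u t - v t) x‖) ∧
      ∫ x, ‖(u t - v t) x‖ * ‖fderiv ℝ (u t - v t) x‖ ≤ A := by
  obtain ⟨R₀, hR₀, h₀⟩ := hu.exists_eLpNorm_le 0
  obtain ⟨R₁, hR₁, h₁⟩ := hu.exists_eLpNorm_le 1
  obtain ⟨S₀, hS₀, k₀⟩ := hv.exists_eLpNorm_le 0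
  obtain ⟨S₁, hS₁, k₁⟩ := hv.exists_eLpNorm_le 1
  set A := (R₀ + S₀) * (R₁ + S₁)
  have hA : A ≠ ⊤ := ENNReal.mul_ne_top (ENNReal.add_ne_top.2 ⟨hR₀, hS₀⟩)
    (ENNReal.add_ne_top.2 ⟨hR₁, hS₁⟩)
  refine ⟨A.toReal, fun t ht => ?_⟩
  have e0 : ∀ f : EuclideanSpace ℝ (Fin d) → ℂ,
      eLpNorm (iteratedFDeriv ℝ 0 f) 2 volume = eLpNorm f 2 volume := fun f =>
    eLpNorm_congr_norm_ae (.of_forall fun y => by rw [norm_iteratedFDeriv_zero])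
  have e1 : ∀ f : EuclideanSpace ℝ (Fin d) → ℂ,
      eLpNorm (iteratedFDeriv ℝ 1 f) 2 volume = eLpNorm (fderiv ℝ f) 2 volume := fun f =>
    eLpNorm_congr_norm_ae (.of_forall fun y => by
      rw [← norm_iteratedFDeriv_zero (𝕜 := ℝ) (f := fderiv ℝ f), norm_iteratedFDeriv_fderiv])
  have hcu := (hu.1 t ht).1
  have hcv := (hv.1 t ht).1
  have hcw : ContDiff ℝ ∞ (u t - v t) := hcu.sub hcv
  have hw0 : eLpNorm (u t - v t) 2 volume ≤ R₀ + S₀ := by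
    refine (eLpNorm_sub_le hcu.continuous.aestronglyMeasurable hcv.continuous.aestronglyMeasurable
      (by norm_num)).trans ?_
    rw [← e0, ← e0]
    exact add_le_add (h₀ t ht) (k₀ t ht)
  have hw1 : eLpNorm (fderiv ℝ (u t - v t)) 2 volume ≤ R₁ + S₁ := by
    have : fderiv ℝ (u t - v t) = fderiv ℝ (u t) - fderiv ℝ (v t) := by
      ext1 x
      exact fderiv_sub (hcu.differentiable (by simp) x) (hcv.differentiable (by simp) x)
    rw [this]
    refine (eLpNorm_sub_le (hcu.continuous_fderiv (by simp)).aestronglyMeasurable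
      (hcv.continuous_fderiv (by simp)).aestronglyMeasurable (by norm_num)).trans ?_
    rw [← e1, ← e1]
    exact add_le_add (h₁ t ht) (k₁ t ht)
  have hm0 := hcw.continuous.aestronglyMeasurable (μ := volume)
  have hm1 := (hcw.continuous_fderiv (by simp)).aestronglyMeasurable (μ := volume)
  have hp : eLpNorm (fun x => ‖(u t - v t) x‖ * ‖fderiv ℝ (u t - v t) x‖) 1 volume ≤ A := by
    refine (eLpNorm_smul_le_mul_eLpNorm (p := 2) (q := 2) (r := 1)
      (φ := fun x => ‖(u t - v t) x‖) (f := fun x => ‖fderiv ℝ (u t - v t) x‖)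
      hm1.norm hm0.norm).trans ?_
    rw [eLpNorm_norm, eLpNorm_norm]
    exact mul_le_mul' hw0 hw1
  have hint : Integrable (fun x => ‖(u t - v t) x‖ * ‖fderiv ℝ (u t - v t) x‖) :=
    memLp_one_iff_integrable.1 ⟨hm0.norm.mul hm1.norm, hp.trans_lt hA.lt_top⟩
  refine ⟨(memLp_two_iff_integrable_sq_norm hm0).1
    ⟨hm0, hw0.trans_lt (ENNReal.add_lt_top.2 ⟨hR₀.lt_top, hS₀.lt_top⟩)⟩, hint, ?_⟩
  refine le_trans (le_of_eq ?_) (ENNReal.toReal_mono hA hp)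
  rw [eLpNorm_one_eq_lintegral_enorm, ← integral_norm_eq_lintegral_enorm hint.1]
  refine integral_congr_ae (.of_forall fun x => ?_)
  simp only
  rw [Real.norm_of_nonneg (by positivity)]

/-- The localized energy estimate for the difference of two solutions. -/
theorem IsSolution.integral_mul_norm_sub_sq_le {T ε : ℝ} (hε : 0 < ε)
    {u₀ v₀ : EuclideanSpace ℝ (Fin d) → ℂ} {u v : ℝ → EuclideanSpace ℝ (Fin d) → ℂ}
    (hu : IsSolution T ε u₀ u) (hv : IsSolution T ε v₀ v) (h0 : u₀ = v₀) {A B : ℝ}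
    (hBu : ∀ t ∈ Set.Icc 0 T, ∀ x, ‖u t x‖ ≤ B ∧ ‖fderiv ℝ (fderiv ℝ (u t)) x‖ ≤ B)
    (hBv : ∀ t ∈ Set.Icc 0 T, ∀ x, ‖v t x‖ ≤ B ∧ ‖fderiv ℝ (fderiv ℝ (v t)) x‖ ≤ B)
    (hA : ∀ t ∈ Set.Icc 0 T,
      Integrable (fun x => ‖(u t - v t) x‖ ^ 2) ∧
      Integrable (fun x => ‖(u t - v t) x‖ * ‖fderiv ℝ (u t - v t) x‖) ∧
      ∫ x, ‖(u t - v t) x‖ * ‖fderiv ℝ (u t - v t) x‖ ≤ A)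
    {ψ : EuclideanSpace ℝ (Fin d) → ℝ} (hψ : ContDiff ℝ ∞ ψ) (hψc : HasCompactSupport ψ)
    (hψ0 : ∀ x, 0 ≤ ψ x) {K : ℝ} (hK : ∀ x, ‖fderiv ℝ ψ x‖ ≤ K) {t : ℝ} (ht : t ∈ Set.Icc 0 T) :
    ∫ x, ψ x * ‖(u t - v t) x‖ ^ 2 ≤ Real.exp (6 * B ^ 2 * t) * (ε * (d * K * A) * t) := by
  have hT : 0 ≤ T := ht.1.trans ht.2
  have hK0 : 0 ≤ K := (norm_nonneg _).trans (hK 0)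
  have hB0 : 0 ≤ B := (norm_nonneg _).trans (hBu t ht 0).1
  set D : ℝ → EuclideanSpace ℝ (Fin d) → ℂ := fun s x =>
    (ε / 2 : ℝ) * (Complex.I * Laplacian.laplacian (u s - v s) x)
      - Complex.I * ((‖u s x‖ : ℂ) ^ 2 * u s x - (‖v s x‖ : ℂ) ^ 2 * v s x) with hD
  have hcu : ∀ s ∈ Set.Icc 0 T, ContDiff ℝ ∞ (u s) := fun s hs => (hu.mem.1 s hs).1
  have hcv : ∀ s ∈ Set.Icc 0 T, ContDiff ℝ ∞ (v s) := fun s hs => (hv.mem.1 s hs).1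
  have hcw : ∀ s ∈ Set.Icc 0 T, ContDiff ℝ ∞ (u s - v s) := fun s hs => (hcu s hs).sub (hcv s hs)
  have hlap : ∀ s ∈ Set.Icc 0 T, ∀ x, Laplacian.laplacian (u s - v s) x
      = Laplacian.laplacian (u s) x - Laplacian.laplacian (v s) x := fun s hs x =>
    ((hcu s hs).contDiffAt.of_le (by norm_cast)).laplacian_sub
      ((hcv s hs).contDiffAt.of_le (by norm_cast))
  have hderiv : ∀ s ∈ Set.Icc 0 T, ∀ x,
      HasDerivWithinAt (fun r => (u r - v r) x) (D s x) (Set.Icc 0 T) s := fun s hs x => by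
    have := (hu.exists_hasDerivWithinAt hε.ne' hs x).sub (hv.exists_hasDerivWithinAt hε.ne' hs x)
    refine this.congr_deriv ?_
    rw [hD]
    simp only
    rw [hlap s hs]
    ring
  have hDle : ∀ s ∈ Set.Icc 0 T, ∀ x, ‖D s x‖ ≤ ε * (d * B) + 6 * B ^ 3 := fun s hs x => by
    have h1 : ‖Laplacian.laplacian (u s - v s) x‖ ≤ d * B + d * B := by
      rw [hlap s hs]
      exact (norm_sub_le _ _).trans (add_le_add (norm_laplacian_le (hBu s hs x).2)
        (norm_laplacian_le (hBv s hs x).2))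
    have h2 := norm_cubic_sub_cubic_le (hBu s hs x).1 (hBv s hs x).1
    have h3 : ‖u s x - v s x‖ ≤ B + B :=
      (norm_sub_le _ _).trans (add_le_add (hBu s hs x).1 (hBv s hs x).1)
    refine (norm_sub_le _ _).trans ?_
    rw [norm_mul, norm_mul, norm_mul, Complex.norm_I, one_mul, one_mul, Complex.norm_real,
      Real.norm_of_nonneg (by positivity)]
    have h4 : ε / 2 * ‖Laplacian.laplacian (u s - v s) x‖ ≤ ε / 2 * (d * B + d * B) := by gcongr
    have h5 : 3 * B ^ 2 * ‖u s x - v s x‖ ≤ 3 * B ^ 2 * (B + B) := by gcongr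
    linarith
  have hDc : ∀ s ∈ Set.Icc 0 T, Continuous (D s) := fun s hs => by
    have h1 := continuous_laplacian (hcw s hs)
    have h2 := (hcu s hs).continuous
    have h3 := (hcv s hs).continuous
    rw [hD]
    fun_prop
  have hwle : ∀ s ∈ Set.Icc 0 T, ∀ x, ‖(u s - v s) x‖ ≤ 2 * B := fun s hs x => by
    have := (norm_sub_le (u s x) (v s x)).trans (add_le_add (hBu s hs x).1 (hBv s hs x).1)
    rw [Pi.sub_apply]; linarith
  have hint : ∀ g : EuclideanSpace ℝ (Fin d) → ℝ, Continuous g → Integrable fun x => ψ x * g x :=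
    fun g hg => (hψ.continuous.mul hg).integrable_of_hasCompactSupport hψc.mul_right
  set E : ℝ → ℝ := fun s => ∫ x, ψ x * ‖(u s - v s) x‖ ^ 2 with hE
  set E' : ℝ → ℝ := fun s => ∫ x, ψ x * (2 * inner ℝ ((u s - v s) x) (D s x)) with hE'
  -- Continuity up to the endpoints is proved separately, since `E` is differentiated only in the
  -- open interval.
  have hEcont : ContinuousOn E (Set.Icc 0 T) := by
    refine continuousOn_of_dominated (bound := fun x => ψ x * (2 * B) ^ 2) (fun s hs => ?_)
      (fun s hs => .of_forall fun x => ?_) (hint _ continuous_const) (.of_forall fun x s hs => ?_)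
    · exact (hψ.continuous.mul ((hcw s hs).continuous.norm.pow 2)).aestronglyMeasurable
    · rw [norm_mul, Real.norm_of_nonneg (hψ0 x), norm_pow, norm_norm]
      have := hwle s hs x
      have := hψ0 x
      gcongr
    · exact continuousWithinAt_const.mul ((hderiv s hs x).continuousWithinAt.norm.pow 2)
  have hEderiv : ∀ s ∈ Set.Ioo 0 T, HasDerivAt E (E' s) s := fun s hs => by
    have hsub := Set.Ioo_subset_Icc_self (a := (0 : ℝ)) (b := T)
    refine (hasDerivAt_integral_of_dominated_loc_of_deriv_le (s := Set.Ioo 0 T)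
      (F' := fun s x => ψ x * (2 * inner ℝ ((u s - v s) x) (D s x)))
      (bound := fun x => ψ x * (2 * ((2 * B) * (ε * (d * B) + 6 * B ^ 3))))
      (isOpen_Ioo.mem_nhds hs) ?_ (hint _ ((hcw s (hsub hs)).continuous.norm.pow 2)) ?_
      (.of_forall fun x r hr => ?_) (hint _ continuous_const) (.of_forall fun x r hr => ?_)).2
    · filter_upwards [isOpen_Ioo.mem_nhds hs] with r hr
      exact (hψ.continuous.mul ((hcw r (hsub hr)).continuous.norm.pow 2)).aestronglyMeasurable
    · have h1 := (hcw s (hsub hs)).continuous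
      have h2 := hDc s (hsub hs)
      exact (hψ.continuous.mul (continuous_const.mul (h1.inner h2))).aestronglyMeasurable
    · rw [norm_mul, Real.norm_of_nonneg (hψ0 x), norm_mul, Real.norm_ofNat]
      have h1 := hψ0 x
      have h2 : ‖inner ℝ ((u r - v r) x) (D r x)‖ ≤ (2 * B) * (ε * (d * B) + 6 * B ^ 3) :=
        (norm_inner_le_norm _ _).trans (mul_le_mul (hwle r (hsub hr) x) (hDle r (hsub hr) x)
          (norm_nonneg _) (by positivity))
      gcongr
    · exact (((hderiv r (hsub hr) x).hasDerivAt (Icc_mem_nhds hr.1 hr.2)).norm_sq).const_mul (ψ x)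
  have hE'le : ∀ s ∈ Set.Ioo 0 T, E' s ≤ ε * (d * K * A) + 6 * B ^ 2 * E s := fun s hs => by
    have hs' := Set.Ioo_subset_Icc_self hs
    set N : EuclideanSpace ℝ (Fin d) → ℂ := fun x =>
      (‖u s x‖ : ℂ) ^ 2 * u s x - (‖v s x‖ : ℂ) ^ 2 * v s x with hN
    have c1 := (hcw s hs').continuous
    have c2 := continuous_laplacian (hcw s hs')
    have c3 : Continuous N := by
      have h2 := (hcu s hs').continuous
      have h3 := (hcv s hs').continuous
      rw [hN]; fun_prop
    have e : E' s = ε * (∫ x, ψ x * inner ℝ ((u s - v s) x)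
        (Complex.I * Laplacian.laplacian (u s - v s) x))
        - ∫ x, ψ x * (2 * inner ℝ ((u s - v s) x) (Complex.I * N x)) := by
      rw [hE', ← integral_const_mul, ← integral_sub]
      · refine integral_congr_ae (.of_forall fun x => ?_)
        have : D s x = (ε / 2 : ℝ) • (Complex.I * Laplacian.laplacian (u s - v s) x)
            - Complex.I * N x := by rw [Complex.real_smul]
        simp only
        rw [this, inner_sub_right, real_inner_smul_right]
        ring
      · exact (hint _ (c1.inner (continuous_const.mul c2))).const_mul _
      · exact hint _ (continuous_const.mul (c1.inner (continuous_const.mul c3)))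
    have h1 := (abs_le.1 (abs_integral_mul_inner_laplacian_le (hcw s hs') hψ hψc hK
      (hA s hs').2.1)).2
    have h2 : d * K * ∫ x, ‖(u s - v s) x‖ * ‖fderiv ℝ (u s - v s) x‖ ≤ d * K * A := by
      have := (hA s hs').2.2
      gcongr
    have h3 : -∫ x, ψ x * (2 * inner ℝ ((u s - v s) x) (Complex.I * N x))
        ≤ 6 * B ^ 2 * E s := by
      rw [hE, ← integral_neg, ← integral_const_mul]
      refine integral_mono (hint _ (continuous_const.mul (c1.inner (continuous_const.mul c3)))).neg
        ((hint _ (c1.norm.pow 2)).const_mul _) fun x => ?_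
      have h4 : |inner ℝ ((u s - v s) x) (Complex.I * N x)|
          ≤ ‖(u s - v s) x‖ * (3 * B ^ 2 * ‖(u s - v s) x‖) := by
        refine (abs_real_inner_le_norm _ _).trans ?_
        rw [norm_mul, Complex.norm_I, one_mul]
        gcongr
        exact norm_cubic_sub_cubic_le (hBu s hs' x).1 (hBv s hs' x).1
      have h5 := mul_le_mul_of_nonneg_left ((neg_le_abs _).trans h4) (hψ0 x)
      simp only
      linarith
    rw [e]
    have := mul_le_mul_of_nonneg_left (h1.trans h2) hε.le
    linarith
  -- Grönwall by hand: the integrating factor absorbs `6B² E`, and the linear term absorbs the flux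
  -- through the cutoff.
  set G : ℝ → ℝ := fun s => Real.exp (-(6 * B ^ 2 * s)) * E s - ε * (d * K * A) * s with hG
  have hA0 : 0 ≤ A := le_trans (integral_nonneg fun x => by positivity) (hA t ht).2.2
  have hGderiv : ∀ s ∈ Set.Ioo 0 T, HasDerivAt G
      (Real.exp (-(6 * B ^ 2 * s)) * (-(6 * B ^ 2)) * E s + Real.exp (-(6 * B ^ 2 * s)) * E' s
        - ε * (d * K * A)) s := fun s hs => by
    have h1 : HasDerivAt (fun s : ℝ => Real.exp (-(6 * B ^ 2 * s)))
        (Real.exp (-(6 * B ^ 2 * s)) * (-(6 * B ^ 2))) s := by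
      have : HasDerivAt (fun s : ℝ => -(6 * B ^ 2 * s)) (-(6 * B ^ 2)) s := by
        simpa using ((hasDerivAt_id s).const_mul (6 * B ^ 2)).fun_neg
      exact this.exp
    have h2 : HasDerivAt (fun s : ℝ => ε * (d * K * A) * s) (ε * (d * K * A)) s := by
      simpa using (hasDerivAt_id s).const_mul (ε * (d * K * A))
    exact (h1.mul (hEderiv s hs)).sub h2
  have hGanti : AntitoneOn G (Set.Icc 0 T) := by
    refine antitoneOn_of_deriv_nonpos (convex_Icc 0 T) ?_ ?_ ?_
    · refine ContinuousOn.sub (ContinuousOn.mul (by fun_prop) hEcont) (by fun_prop)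
    · rw [interior_Icc]
      exact fun s hs => (hGderiv s hs).differentiableAt.differentiableWithinAt
    · rw [interior_Icc]
      intro s hs
      rw [(hGderiv s hs).deriv]
      have h1 : Real.exp (-(6 * B ^ 2 * s)) ≤ 1 := by
        rw [Real.exp_le_one_iff]
        have := hs.1
        have : 0 ≤ 6 * B ^ 2 * s := by positivity
        linarith
      have h2 := mul_le_mul_of_nonneg_left (hE'le s hs) (Real.exp_pos (-(6 * B ^ 2 * s))).le
      have h3 : Real.exp (-(6 * B ^ 2 * s)) * (ε * (d * K * A)) ≤ 1 * (ε * (d * K * A)) := by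
        gcongr
      linarith
  have hG0 : G 0 = 0 := by
    have : ∀ x, (u 0 - v 0) x = 0 := fun x => by
      rw [Pi.sub_apply, hu.init, hv.init, h0, sub_self]
    simp only [hG, hE, this]
    simp
  have hGt : G t ≤ 0 := hG0 ▸ hGanti ⟨le_rfl, hT⟩ ht ht.1
  have h1 : Real.exp (-(6 * B ^ 2 * t)) * E t ≤ ε * (d * K * A) * t := by
    have : G t = Real.exp (-(6 * B ^ 2 * t)) * E t - ε * (d * K * A) * t := rfl
    linarith
  have h2 := mul_le_mul_of_nonneg_left h1 (Real.exp_pos (6 * B ^ 2 * t)).le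
  rwa [← mul_assoc, ← Real.exp_add, add_neg_cancel, Real.exp_zero, one_mul] at h2

theorem IsSolution.eq {T ε : ℝ} (hε : 0 < ε) {u₀ : EuclideanSpace ℝ (Fin d) → ℂ}
    {u v : ℝ → EuclideanSpace ℝ (Fin d) → ℂ} (hu : IsSolution T ε u₀ u) (hv : IsSolution T ε u₀ v)
    {t : ℝ} (ht : t ∈ Set.Icc 0 T) : u t = v t := by
  obtain ⟨B₁, hB₁⟩ := hu.mem.exists_norm_le
  obtain ⟨B₂, hB₂⟩ := hv.mem.exists_norm_le
  obtain ⟨A, hA⟩ := hu.mem.exists_integral_le hv.mem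
  set B := max B₁ B₂
  have hBu : ∀ t ∈ Set.Icc 0 T, ∀ x, ‖u t x‖ ≤ B ∧ ‖fderiv ℝ (fderiv ℝ (u t)) x‖ ≤ B :=
    fun t ht x => ⟨(hB₁ t ht x).1.trans (le_max_left _ _), (hB₁ t ht x).2.trans (le_max_left _ _)⟩
  have hBv : ∀ t ∈ Set.Icc 0 T, ∀ x, ‖v t x‖ ≤ B ∧ ‖fderiv ℝ (fderiv ℝ (v t)) x‖ ≤ B :=
    fun t ht x => ⟨(hB₂ t ht x).1.trans (le_max_right _ _), (hB₂ t ht x).2.trans (le_max_right _ _)⟩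
  let b : ContDiffBump (0 : EuclideanSpace ℝ (Fin d)) := ⟨1, 2, one_pos, one_lt_two⟩
  set χ : EuclideanSpace ℝ (Fin d) → ℝ := fun x => b x
  have hχ : ContDiff ℝ ∞ χ := b.contDiff
  have hχc : HasCompactSupport χ := b.hasCompactSupport
  have hχ0 : χ 0 = 1 := b.one_of_mem_closedBall (Metric.mem_closedBall_self b.rIn_pos.le)
  obtain ⟨K, hK⟩ := (hχc.fderiv (𝕜 := ℝ)).exists_bound_of_continuous
    (hχ.continuous_fderiv (by simp))
  have hcw : Continuous (u t - v t) := ((hu.mem.1 t ht).1.sub (hv.mem.1 t ht).1).continuous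
  -- The cutoff `χ(δ ·)` has gradient at most `δK`, so the flux bound tends to zero as `δ → 0` while
  -- the localized mass tends to the full `L²` mass.
  have key : ∀ δ : ℝ, 0 < δ → ∫ x, χ (δ • x) * ‖(u t - v t) x‖ ^ 2
      ≤ Real.exp (6 * B ^ 2 * t) * (ε * (d * (δ * K) * A) * t) := fun δ hδ => by
    refine hu.integral_mul_norm_sub_sq_le hε hv rfl hBu hBv hA (ψ := fun x => χ (δ • x))
      (hχ.comp (contDiff_const_smul δ)) (hχc.comp_smul hδ.ne') (fun x => b.nonneg) (fun x => ?_) ht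
    have : HasFDerivAt (fun x => χ (δ • x)) (δ • fderiv ℝ χ (δ • x)) x := by
      have h1 := (hχ.differentiable (by simp) (δ • x)).hasFDerivAt
      have h2 : HasFDerivAt (fun x : EuclideanSpace ℝ (Fin d) => δ • x)
        (δ • ContinuousLinearMap.id ℝ _) x := (hasFDerivAt_id x).const_smul δ
      refine (h1.comp x h2).congr_fderiv ?_
      ext
      simp
    rw [this.fderiv, norm_smul, Real.norm_of_nonneg hδ.le]
    gcongr
    exact hK _
  have hlim : Tendsto (fun δ : ℝ => ∫ x, χ (δ • x) * ‖(u t - v t) x‖ ^ 2) (𝓝[>] 0)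
      (𝓝 (∫ x, ‖(u t - v t) x‖ ^ 2)) := by
    refine tendsto_integral_filter_of_dominated_convergence (fun x => ‖(u t - v t) x‖ ^ 2) ?_ ?_
      (hA t ht).1 (.of_forall fun x => ?_)
    · exact .of_forall fun δ => (((hχ.continuous.comp (continuous_const_smul δ))).mul
        (hcw.norm.pow 2)).aestronglyMeasurable
    · refine .of_forall fun δ => .of_forall fun x => ?_
      rw [norm_mul, Real.norm_of_nonneg b.nonneg, norm_pow, norm_norm]
      exact mul_le_of_le_one_left (by positivity) b.le_one
    · have : Continuous fun δ : ℝ => χ (δ • x) * ‖(u t - v t) x‖ ^ 2 :=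
        (hχ.continuous.comp (continuous_id.smul continuous_const)).mul continuous_const
      have h := (this.tendsto 0).mono_left (nhdsWithin_le_nhds (s := Set.Ioi 0))
      simpa [hχ0] using h
  have hlim' : Tendsto (fun δ : ℝ => Real.exp (6 * B ^ 2 * t) * (ε * (d * (δ * K) * A) * t))
      (𝓝[>] 0) (𝓝 0) := by
    have : Continuous fun δ : ℝ => Real.exp (6 * B ^ 2 * t) * (ε * (d * (δ * K) * A) * t) := by
      fun_prop
    simpa using (this.tendsto 0).mono_left (nhdsWithin_le_nhds (s := Set.Ioi 0))
  have hle : ∫ x, ‖(u t - v t) x‖ ^ 2 ≤ 0 := by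
    refine le_of_tendsto_of_tendsto hlim hlim' ?_
    filter_upwards [self_mem_nhdsWithin] with δ hδ using key δ hδ
  have hzero : (fun x => ‖(u t - v t) x‖ ^ 2) =ᵐ[volume] 0 :=
    (integral_eq_zero_iff_of_nonneg (fun x => by positivity) (hA t ht).1).1
      (le_antisymm hle (integral_nonneg fun x => by positivity))
  have hall := (hcw.norm.pow 2).ae_eq_iff_eq volume continuous_const |>.1 hzero
  ext x
  have := congrFun hall x
  simp only [Pi.sub_apply] at this
  exact sub_eq_zero.1 (norm_eq_zero.1 (pow_eq_zero_iff two_ne_zero |>.1 this))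

end Uniqueness

end

/-! ### Data, boosts, testing against `β`, the Born approximation and the cross terms. -/

section

variable {V : Type*} [NormedAddCommGroup V] [InnerProductSpace ℝ V] [FiniteDimensional ℝ V]
  [MeasurableSpace V] [BorelSpace V]

open scoped SchwartzMap FourierTransform RealInnerProductSpace

section Data

theorem rapidDecay_schwartz (f : 𝓢(V, ℂ)) : RapidDecay f := by
  refine ⟨f.continuous.aestronglyMeasurable, fun n p hp => ?_⟩
  -- `2 + 2‖x‖²` dominates `1 + ‖x‖` and, unlike the latter, is smooth, so multiplication by its
  -- powers preserves Schwartz functions.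
  have ht : (fun x : V => (2 + 2 * ‖x‖ ^ 2) ^ n).HasTemperateGrowth :=
    ((Function.HasTemperateGrowth.const (2 : ℝ)).add ((Function.HasTemperateGrowth.const (2 : ℝ)).mul
      (Function.hasTemperateGrowth_norm_sq (H := V)))).pow n
  have hm := (SchwartzMap.smulLeftCLM ℂ (fun x : V => (2 + 2 * ‖x‖ ^ 2) ^ n) f).memLp p
  refine (eLpNorm_mono fun x => ?_).trans_lt hm.2
  have hw := isSubmulWeight_polyWeight zero_le_one n (V := V)
  rw [SchwartzMap.smulLeftCLM_apply_apply ht, norm_smul, norm_smul, Real.norm_of_nonneg (hw.nonneg x),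
    Real.norm_of_nonneg (by positivity), polyWeight]
  refine mul_le_mul_of_nonneg_right (pow_le_pow_left₀ (by positivity) ?_ n) (norm_nonneg _)
  nlinarith [sq_nonneg (‖x‖ - 1), norm_nonneg x]

theorem exists_fourierEval_eq {a : V → ℂ} (ha : ContDiff ℝ ∞ a) (hac : HasCompactSupport a) :
    ∃ f : LOne V, RapidDecay (f : V → ℂ) ∧ ∀ x, fourierEval x f = a x := by
  set g : 𝓢(V, ℂ) := 𝓕⁻ (hac.toSchwartzMap ha)
  have hg := rapidDecay_schwartz g
  have hae := hg.integrable.coeFn_toL1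
  refine ⟨hg.integrable.toL1 _, hg.congr_ae hae.symm, fun x => ?_⟩
  rw [fourierEval_apply, Real.fourier_congr_ae hae, ← SchwartzMap.fourier_coe,
    FourierTransform.fourier_fourierInv_eq]
  rfl

end Data

section Shift

/-- Translation by `η` on the Fourier side, i.e. multiplication by a plane wave. -/
def shift (η : V) : LOne V →+ LOne V :=
  Lp.compMeasurePreserving (fun x => x - η) (measurePreserving_sub_right volume η)

theorem coeFn_shift (η : V) (f : LOne V) : (shift η f : V → ℂ) =ᵐ[volume] fun x => f (x - η) :=
  Lp.coeFn_compMeasurePreserving f (measurePreserving_sub_right volume η)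

theorem norm_shift (η : V) (f : LOne V) : ‖shift η f‖ = ‖f‖ :=
  Lp.norm_compMeasurePreserving f (measurePreserving_sub_right volume η)

theorem RapidDecay.shift {f : LOne V} (hf : RapidDecay (f : V → ℂ)) (η : V) :
    RapidDecay (shift η f : V → ℂ) := by
  refine ⟨Lp.aestronglyMeasurable _, fun n p hp => ?_⟩
  have hw := isSubmulWeight_polyWeight zero_le_one n (V := V)
  have hmp := measurePreserving_sub_right (volume : Measure V) η
  rw [wnorm_congr_ae (coeFn_shift η f)]
  have h1 : wnorm (polyWeight 1 n) p (fun x => f (x - η))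
      ≤ ENNReal.ofReal (polyWeight 1 n η)
        * eLpNorm ((fun x => polyWeight 1 n x • f x) ∘ fun x => x - η) p volume := by
    refine eLpNorm_le_mul_eLpNorm_of_ae_le_mul (.of_forall fun x => ?_) p
    have := hw.add_le η (x - η)
    rw [add_sub_cancel] at this
    rw [Function.comp_apply, norm_smul, norm_smul, Real.norm_of_nonneg (hw.nonneg _),
      Real.norm_of_nonneg (hw.nonneg _), ← mul_assoc]
    gcongr
  refine h1.trans_lt (ENNReal.mul_lt_top ENNReal.ofReal_lt_top ?_)
  rw [eLpNorm_comp_measurePreserving (hf.memLp_weight n hp).1 hmp]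
  exact hf.2 n p hp

/-- Galilean invariance. Expanding `‖ξ + η‖²` in the phase, the square of `η` gives a constant phase
and the cross term `2c⟪ξ, η⟫` a translation in `x` by `(c/π) η`. -/
theorem fourierEval_propagator_shift (c : ℝ) (η x : V) (f : LOne V) :
    fourierEval x (propagator c (shift η f))
      = (phase c η * Real.fourierChar (-⟪η, x⟫))
        * fourierEval (x + (c / Real.pi) • η) (propagator c f) := by
  have h1 : (propagator c (shift η f) : V → ℂ) =ᵐ[volume] fun ξ => phase c ξ * f (ξ - η) := by
    filter_upwards [coeFn_propagator c (shift η f), coeFn_shift η f] with ξ h1 h2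
    rw [h1, h2]
  rw [fourierEval_apply, fourierEval_apply, Real.fourier_congr_ae h1,
    Real.fourier_congr_ae (coeFn_propagator c f), Real.fourier_eq, Real.fourier_eq,
    ← integral_const_mul, ← integral_add_right_eq_self _ η]
  refine integral_congr_ae (.of_forall fun ξ => ?_)
  simp only [add_sub_cancel_right, Circle.smul_def, smul_eq_mul, Real.fourierChar_apply, phase]
  rw [← mul_assoc, ← mul_assoc, ← mul_assoc, ← Complex.exp_add, ← Complex.exp_add,
    ← Complex.exp_add, ← Complex.exp_add]
  congr 2
  rw [norm_add_sq_real, inner_add_left, inner_add_right, inner_smul_right]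
  have hpi : (Real.pi : ℂ) ≠ 0 := by exact_mod_cast Real.pi_ne_zero
  push_cast
  field_simp
  ring

theorem fourierEval_shift (η x : V) (f : LOne V) :
    fourierEval x (shift η f) = Real.fourierChar (-⟪η, x⟫) * fourierEval x f := by
  simpa using fourierEval_propagator_shift 0 η x f

end Shift

section Pairing

theorem norm_integral_mul_fourierEval_le {b : V → ℂ} (hb : Integrable b) (f : LOne V) :
    ‖∫ x, b x * fourierEval x f‖ ≤ (∫ x, ‖b x‖) * ‖f‖ := by
  rw [← integral_mul_const]
  refine norm_integral_le_of_norm_le (hb.norm.mul_const _) (.of_forall fun x => ?_)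
  rw [norm_mul]
  gcongr
  exact norm_fourierEval_le x f

theorem integrable_mul_fourierEval {b : V → ℂ} (hb : Integrable b) (f : LOne V) :
    Integrable fun x => b x * fourierEval x f :=
  hb.mul_bdd (c := ‖f‖) (continuous_fourier f.integrable).aestronglyMeasurable
    (.of_forall fun x => norm_fourierEval_le x f)

/-- The pairing of the Fourier transform with an integrable function. -/
def pairing {b : V → ℂ} (hb : Integrable b) : LOne V →L[ℂ] ℂ :=
  LinearMap.mkContinuous
    { toFun := fun f => ∫ x, b x * fourierEval x f
      map_add' := fun f g => by
        rw [← integral_add (integrable_mul_fourierEval hb f) (integrable_mul_fourierEval hb g)]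
        simp only [map_add, mul_add]
      map_smul' := fun c f => by
        rw [RingHom.id_apply, smul_eq_mul, ← integral_const_mul]
        simp only [map_smul, smul_eq_mul, mul_left_comm] } (∫ x, ‖b x‖)
    (norm_integral_mul_fourierEval_le hb)

theorem pairing_apply {b : V → ℂ} (hb : Integrable b) (f : LOne V) :
    pairing hb f = ∫ x, b x * fourierEval x f := rfl

theorem norm_pairing_le {b : V → ℂ} (hb : Integrable b) (f : LOne V) :
    ‖pairing hb f‖ ≤ (∫ x, ‖b x‖) * ‖f‖ :=
  norm_integral_mul_fourierEval_le hb f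

theorem pairing_eq_integral_fourier {b : V → ℂ} (hb : Integrable b) (f : LOne V) :
    pairing hb f = ∫ ξ, 𝓕 b ξ * f ξ := by
  have := VectorFourier.integral_fourierIntegral_smul_eq_flip (L := innerₗ V) (μ := volume)
    (ν := volume) Real.continuous_fourierChar continuous_inner hb f.integrable
  simp only [flip_innerₗ, smul_eq_mul] at this
  exact this.symm

/-- By duality the multiplier acts on `𝓕 β`, whose decay pays for the `|c|‖ξ‖²` in the phase
difference. Only `‖f‖` enters, which matters because the functions to be inserted escape to infinite
frequency as `ε → 0`. -/
theorem exists_norm_pairing_propagator_sub_le (b : 𝓢(V, ℂ)) : ∃ C : ℝ, ∀ (c : ℝ) (f : LOne V),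
    ‖pairing b.integrable (propagator c f) - pairing b.integrable f‖ ≤ C * |c| * ‖f‖ := by
  obtain ⟨C, hC, hdec⟩ := (𝓕 b).decay 2 0
  refine ⟨C, fun c f => ?_⟩
  rw [← map_sub, pairing_eq_integral_fourier, L1.norm_eq_integral_norm, ← integral_const_mul]
  refine norm_integral_le_of_norm_le (f.integrable.norm.const_mul _) ?_
  filter_upwards [Lp.coeFn_sub (propagator c f) f, coeFn_propagator c f] with ξ h1 h2
  have h3 := norm_phase_sub_le c 0 ξ
  rw [phase_zero, sub_zero] at h3
  have h4 := hdec ξ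
  rw [norm_iteratedFDeriv_zero, SchwartzMap.fourier_coe] at h4
  have e : phase c ξ * f ξ - f ξ = (phase c ξ - 1) * f ξ := by ring
  rw [h1, Pi.sub_apply, h2, e, norm_mul, norm_mul, ← mul_assoc]
  refine mul_le_mul_of_nonneg_right ?_ (norm_nonneg _)
  calc _ ≤ ‖𝓕 (b : V → ℂ) ξ‖ * (|c| * ‖ξ‖ ^ 2) := by gcongr
    _ = |c| * (‖ξ‖ ^ 2 * ‖𝓕 (b : V → ℂ) ξ‖) := by ring
    _ ≤ |c| * C := by gcongr
    _ = C * |c| := mul_comm _ _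

end Pairing

section Duhamel

/-- The Born approximation of a mild solution, with its error bound. -/
theorem norm_sub_born_le {κ T M : ℝ} (hT : 0 ≤ T) {h : ℝ → LOne V} (hc : Continuous h)
    (hM : ∀ t, ‖h t‖ ≤ 2 * M)
    {h₀ : LOne V} (hh₀ : ‖h₀‖ ≤ 2 * M)
    (heq : ∀ t ∈ Set.Icc 0 T, h t = h₀ + ∫ s in (0 : ℝ)..t, field κ s (h s)) :
    ‖h T - (h₀ + ∫ s in (0 : ℝ)..T, field κ s h₀)‖ ≤ 96 * T ^ 2 * M ^ 5 := by
  have hM0 : 0 ≤ M := by linarith [(norm_nonneg _).trans (hM 0)]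
  have hi := continuous_field (κ := κ) hc
  have hi₀ := continuous_field (κ := κ) (continuous_const (y := h₀))
  have h1 : ∀ t ∈ Set.Icc 0 T, ‖h t - h₀‖ ≤ (2 * M) ^ 3 * T := fun t ht => by
    rw [heq t ht, add_sub_cancel_left]
    refine (intervalIntegral.norm_integral_le_of_norm_le_const
      fun s _ => norm_field_le κ s (hM s)).trans ?_
    rw [sub_zero, abs_of_nonneg ht.1]
    gcongr
    exact ht.2
  rw [heq T ⟨hT, le_rfl⟩, add_sub_add_left_eq_sub, ← intervalIntegral.integral_sub
    (hi.intervalIntegrable _ _) (hi₀.intervalIntegrable _ _)]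
  -- The solution stays within `(2M)³T` of its datum, and the field has Lipschitz constant `3(2M)²`;
  -- a second integration over `[0, T]` gives `96T²M⁵`.
  refine (intervalIntegral.norm_integral_le_of_norm_le_const
    (C := 3 * (2 * M) ^ 2 * ((2 * M) ^ 3 * T)) fun s hs => ?_).trans (le_of_eq ?_)
  · rw [Set.uIoc_of_le hT] at hs
    refine (norm_field_sub_le κ s (hM s) hh₀).trans ?_
    gcongr
    exact h1 s ⟨hs.1.le, hs.2⟩
  · rw [sub_zero, abs_of_nonneg hT]
    ring

end Duhamel

section CrossTerm

/-- Cross terms sorted by powers of the relative phase `e`; the term `2|b|²a` alone is free of it.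
-/
theorem cubic_add_sub_sub {a b e : ℂ} (he : ‖e‖ = 1) :
    (‖a + e * b‖ : ℂ) ^ 2 * (a + e * b) - (‖a‖ : ℂ) ^ 2 * a - (‖e * b‖ : ℂ) ^ 2 * (e * b)
      = 2 * (‖b‖ : ℂ) ^ 2 * a + e * (2 * (‖a‖ : ℂ) ^ 2 * b)
        + starRingEnd ℂ e * (a ^ 2 * starRingEnd ℂ b) + e ^ 2 * (b ^ 2 * starRingEnd ℂ a) := by
  have h : e * starRingEnd ℂ e = 1 := by rw [Complex.mul_conj', he]; simp
  simp only [← Complex.mul_conj', map_add, map_mul]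
  linear_combination (2 * a * b * starRingEnd ℂ b) * h

theorem tendsto_integral_fourierChar_mul {ι : Type*} {l : Filter ι} {η : ι → V}
    (hη : Tendsto η l (cocompact V)) (f : V → ℂ) :
    Tendsto (fun i => ∫ x, (Real.fourierChar (-⟪η i, x⟫) : ℂ) * f x) l (𝓝 0) := by
  refine ((tendsto_integral_exp_inner_smul_cocompact f).comp hη).congr fun i => ?_
  simp only [Function.comp_apply, Circle.smul_def, smul_eq_mul, real_inner_comm]

/-- Riemann–Lebesgue at the frequencies `η`, `-η` and `2η`, all of which go to infinity. The
unimodular factors `ρ` do not depend on `x`, so their behaviour in `i` is irrelevant. -/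
theorem tendsto_integral_cross {ι : Type*} {l : Filter ι} {η : ι → V}
    (hη : Tendsto η l (cocompact V)) {ρ : ι → ℂ} (hρ : ∀ i, ‖ρ i‖ = 1) {β a b : V → ℂ}
    (hβ : Continuous β) (hβc : HasCompactSupport β) (ha : Continuous a) (hb : Continuous b) :
    Tendsto (fun i => ∫ x, β x *
      ((‖a x + (ρ i * Real.fourierChar (-⟪η i, x⟫)) * b x‖ : ℂ) ^ 2
          * (a x + (ρ i * Real.fourierChar (-⟪η i, x⟫)) * b x)
        - (‖a x‖ : ℂ) ^ 2 * a x
        - (‖(ρ i * Real.fourierChar (-⟪η i, x⟫)) * b x‖ : ℂ) ^ 2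
          * ((ρ i * Real.fourierChar (-⟪η i, x⟫)) * b x))) l
      (𝓝 (∫ x, β x * (2 * (‖b x‖ : ℂ) ^ 2 * a x))) := by
  have hi : ∀ {f : V → ℂ}, Continuous f → Integrable fun x => β x * f x := fun hf =>
    (hβ.mul hf).integrable_of_hasCompactSupport hβc.mul_right
  have hchar : ∀ ζ : V, Continuous fun x => (Real.fourierChar (-⟪ζ, x⟫) : ℂ) := fun ζ =>
    continuous_subtype_val.comp (Real.continuous_fourierChar.comp (by fun_prop))
  set f₁ : V → ℂ := fun x => 2 * (‖a x‖ : ℂ) ^ 2 * b x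
  set f₂ : V → ℂ := fun x => a x ^ 2 * starRingEnd ℂ (b x)
  set f₃ : V → ℂ := fun x => b x ^ 2 * starRingEnd ℂ (a x)
  have hf₁ : Continuous f₁ := by fun_prop
  have hf₂ : Continuous f₂ := by
    exact (ha.pow 2).mul (Complex.continuous_conj.comp hb)
  have hf₃ : Continuous f₃ := (hb.pow 2).mul (Complex.continuous_conj.comp ha)
  have hη₂ : Tendsto (fun i => -η i) l (cocompact V) :=
    (Homeomorph.neg V).isClosedEmbedding.tendsto_cocompact.comp hη
  have hη₃ : Tendsto (fun i => (2 : ℝ) • η i) l (cocompact V) :=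
    (Homeomorph.smulOfNeZero (2 : ℝ) two_ne_zero).isClosedEmbedding.tendsto_cocompact.comp hη
  have hbdd : ∀ {z ζ : ι → ℂ}, (∀ i, ‖z i‖ = 1) → Tendsto ζ l (𝓝 0) →
      Tendsto (fun i => z i * ζ i) l (𝓝 0) := fun hz hζ => by
    rw [tendsto_zero_iff_norm_tendsto_zero] at hζ ⊢
    simpa [norm_mul, hz] using hζ
  have t₁ := hbdd hρ (tendsto_integral_fourierChar_mul hη fun x => β x * f₁ x)
  have t₂ := hbdd (z := fun i => starRingEnd ℂ (ρ i)) (fun i => by simp [hρ])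
    (tendsto_integral_fourierChar_mul hη₂ fun x => β x * f₂ x)
  have t₃ := hbdd (z := fun i => ρ i ^ 2) (fun i => by simp [hρ])
    (tendsto_integral_fourierChar_mul hη₃ fun x => β x * f₃ x)
  have t := ((tendsto_const_nhds (x := ∫ x, β x * (2 * (‖b x‖ : ℂ) ^ 2 * a x))).add t₁).add t₂
    |>.add t₃
  simp only [add_zero] at t
  refine t.congr fun i => ?_
  have hint : ∀ (z : ℂ) (ζ : V) {f : V → ℂ}, Continuous f →
      Integrable fun x => z * (Real.fourierChar (-⟪ζ, x⟫) * (β x * f x)) := fun z ζ f hf => by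
    refine ((hi ((hchar ζ).mul hf)).const_mul z).congr (.of_forall fun x => ?_)
    simp only [Pi.mul_apply, mul_left_comm]
  have h₀ : Integrable fun x => β x * (2 * (‖b x‖ : ℂ) ^ 2 * a x) := hi (by fun_prop)
  have h₁ := hint (ρ i) (η i) hf₁
  have h₂ := hint (starRingEnd ℂ (ρ i)) (-η i) hf₂
  have h₃ := hint (ρ i ^ 2) ((2 : ℝ) • η i) hf₃
  rw [← integral_const_mul, ← integral_const_mul, ← integral_const_mul, ← integral_add h₀ h₁,
    ← integral_add (h₀.fun_add h₁) h₂, ← integral_add ((h₀.fun_add h₁).fun_add h₂) h₃]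
  refine integral_congr_ae (.of_forall fun x => ?_)
  simp only
  rw [cubic_add_sub_sub (by rw [norm_mul, hρ, one_mul]; exact Circle.norm_coe _)]
  have e₂ : (Real.fourierChar (-⟪-η i, x⟫) : ℂ) = starRingEnd ℂ (Real.fourierChar (-⟪η i, x⟫)) := by
    rw [inner_neg_left, AddChar.map_neg_eq_inv, Circle.coe_inv_eq_conj]
  have e₃ : (Real.fourierChar (-⟪(2 : ℝ) • η i, x⟫) : ℂ) = (Real.fourierChar (-⟪η i, x⟫)) ^ 2 := by
    rw [inner_smul_left, sq, ← Circle.coe_mul, ← AddChar.map_add_eq_mul]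
    congr 2
    simp
    ring
  rw [e₂, e₃]
  simp only [f₁, f₂, f₃, map_mul]
  ring

end CrossTerm

end

/-! ### The limit `ε → 0` of the first order interaction. -/

section

variable {V : Type*} [NormedAddCommGroup V] [InnerProductSpace ℝ V] [FiniteDimensional ℝ V]
  [MeasurableSpace V] [BorelSpace V]

open scoped SchwartzMap FourierTransform RealInnerProductSpace

section Limit

/-- The frequency of the plane wave `exp (i k·x / ε)`. -/
def frequency (k : V) (ε : ℝ) : V := (-(2 * Real.pi * ε)⁻¹) • k

theorem tendsto_frequency {k : V} (hk : k ≠ 0) :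
    Tendsto (frequency k) (𝓝[>] 0) (cocompact V) := by
  rw [← Metric.cobounded_eq_cocompact, ← tendsto_norm_atTop_iff_cobounded]
  have h1 : Tendsto (fun ε : ℝ => ε⁻¹ * ((2 * Real.pi)⁻¹ * ‖k‖)) (𝓝[>] 0) atTop :=
    tendsto_inv_nhdsGT_zero.atTop_mul_const (by positivity)
  refine h1.congr' ?_
  filter_upwards [self_mem_nhdsWithin] with ε hε
  have hε' : 0 < ε := hε
  rw [frequency, norm_smul, norm_neg, Real.norm_of_nonneg (by positivity), mul_inv]
  ring

theorem fourierEval_shift_frequency (k x : V) {ε : ℝ} (f : LOne V) :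
    fourierEval x (shift (frequency k ε) f)
      = fourierEval x f * Complex.exp (Complex.I * ((⟪k, x⟫ / ε : ℝ) : ℂ)) := by
  rw [fourierEval_shift, Real.fourierChar_apply, mul_comm, frequency, inner_smul_left]
  congr 2
  have hpi : (Real.pi : ℂ) ≠ 0 := by exact_mod_cast Real.pi_ne_zero
  simp only [conj_trivial]
  push_cast
  rw [mul_inv]
  field_simp

/-- The factor `ε` in `kappa` and the `1/ε` in the frequency cancel, leaving transport at the group
velocity `k`. -/
theorem fourierEval_propagator_shift_frequency (k x : V) (s : ℝ) {ε : ℝ} (hε : ε ≠ 0)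
    (f : LOne V) :
    fourierEval x (propagator (kappa ε * s) (shift (frequency k ε) f))
      = (phase (kappa ε * s) (frequency k ε) * Real.fourierChar (-⟪frequency k ε, x⟫))
        * fourierEval (x - s • k) (propagator (kappa ε * s) f) := by
  rw [fourierEval_propagator_shift, frequency, smul_smul]
  have : kappa ε * s / Real.pi * -(2 * Real.pi * ε)⁻¹ = -s := by
    have := Real.pi_ne_zero
    rw [kappa]
    field_simp
  rw [this, neg_smul s, ← sub_eq_add_neg]

/-- The interaction of two waves in the cubic nonlinearity. -/
def cross (f g : LOne V) : LOne V := cubic (f + g) - cubic f - cubic g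

theorem norm_cubic_le {R : ℝ} {f : LOne V} (hf : ‖f‖ ≤ R) : ‖cubic f‖ ≤ R ^ 3 := by
  have := norm_field_le 0 0 hf
  rwa [field, norm_smul, norm_neg, Complex.norm_I, one_mul, LinearIsometry.norm_map, zero_mul,
    propagator_zero] at this

theorem norm_cross_le (f g : LOne V) : ‖cross f g‖ ≤ 3 * (‖f‖ + ‖g‖) ^ 3 := by
  have h1 := norm_cubic_le (norm_add_le f g)
  have h2 := norm_cubic_le (f := f) (R := ‖f‖ + ‖g‖) (by linarith [norm_nonneg g])
  have h3 := norm_cubic_le (f := g) (R := ‖f‖ + ‖g‖) (by linarith [norm_nonneg f])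
  have h4 := norm_sub_le (cubic (f + g) - cubic f) (cubic g)
  have h5 := norm_sub_le (cubic (f + g)) (cubic f)
  rw [cross]
  linarith

theorem fourierEval_cross (x : V) (f g : LOne V) : fourierEval x (cross f g)
    = (‖fourierEval x f + fourierEval x g‖ : ℂ) ^ 2 * (fourierEval x f + fourierEval x g)
      - (‖fourierEval x f‖ : ℂ) ^ 2 * fourierEval x f
      - (‖fourierEval x g‖ : ℂ) ^ 2 * fourierEval x g := by
  rw [cross, map_sub, map_sub, fourierEval_cubic, fourierEval_cubic, fourierEval_cubic, map_add]

theorem propagator_field_cross (κ T s : ℝ) (f g : LOne V) :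
    propagator (κ * T) (field κ s (f + g) - field κ s f - field κ s g)
      = (-Complex.I) • propagator (κ * (T - s))
        (cross (propagator (κ * s) f) (propagator (κ * s) g)) := by
  simp only [field, ← smul_sub, ← map_sub, cross, ← map_add]
  rw [map_smul, ← propagator_add, mul_sub, ← sub_eq_add_neg]

theorem norm_cross_sub_cross_le {a a' b b' : ℂ} {R : ℝ} (ha : ‖a‖ ≤ R) (ha' : ‖a'‖ ≤ R)
    (hb : ‖b‖ ≤ R) (hb' : ‖b'‖ ≤ R) (hab : ‖a + b‖ ≤ R) (hab' : ‖a' + b'‖ ≤ R) :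
    ‖((‖a + b‖ : ℂ) ^ 2 * (a + b) - (‖a‖ : ℂ) ^ 2 * a - (‖b‖ : ℂ) ^ 2 * b)
      - ((‖a' + b'‖ : ℂ) ^ 2 * (a' + b') - (‖a'‖ : ℂ) ^ 2 * a' - (‖b'‖ : ℂ) ^ 2 * b')‖
      ≤ 6 * R ^ 2 * (‖a - a'‖ + ‖b - b'‖) := by
  have h1 := norm_cubic_sub_cubic_le ha ha'
  have h2 := norm_cubic_sub_cubic_le hb hb'
  have h3 := norm_cubic_sub_cubic_le hab hab'
  have h4 : ‖a + b - (a' + b')‖ ≤ ‖a - a'‖ + ‖b - b'‖ := by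
    rw [add_sub_add_comm]; exact norm_add_le _ _
  have h5 : 3 * R ^ 2 * ‖a + b - (a' + b')‖ ≤ 3 * R ^ 2 * (‖a - a'‖ + ‖b - b'‖) := by gcongr
  set A := (‖a‖ : ℂ) ^ 2 * a
  set A' := (‖a'‖ : ℂ) ^ 2 * a'
  set B := (‖b‖ : ℂ) ^ 2 * b
  set B' := (‖b'‖ : ℂ) ^ 2 * b'
  set S := (‖a + b‖ : ℂ) ^ 2 * (a + b)
  set S' := (‖a' + b'‖ : ℂ) ^ 2 * (a' + b')
  have e : S - A - B - (S' - A' - B') = (S - S') - (A - A') - (B - B') := by ring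
  rw [e]
  have h6 := norm_sub_le ((S - S') - (A - A')) (B - B')
  have h7 := norm_sub_le (S - S') (A - A')
  linarith

variable (β : 𝓢(V, ℂ)) (f g : LOne V) (k : V)

/-- The first order term in the interaction of two waves of which the second one has been boosted,
tested against `β`. -/
def interaction (T ε s : ℝ) : ℂ :=
  pairing β.integrable (propagator (kappa ε * T)
    (field (kappa ε) s (f + shift (frequency k ε) g) - field (kappa ε) s f
      - field (kappa ε) s (shift (frequency k ε) g)))

theorem norm_interaction_le (T ε s : ℝ) :
    ‖interaction β f g k T ε s‖ ≤ (∫ x, ‖β x‖) * (3 * (‖f‖ + ‖g‖) ^ 3) := by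
  rw [interaction]
  refine (norm_pairing_le _ _).trans ?_
  gcongr
  rw [propagator_field_cross, norm_smul, norm_neg, Complex.norm_I, one_mul,
    LinearIsometry.norm_map]
  refine (norm_cross_le _ _).trans (le_of_eq ?_)
  rw [LinearIsometry.norm_map, LinearIsometry.norm_map, norm_shift]

theorem continuous_interaction (T ε : ℝ) : Continuous (interaction β f g k T ε) := by
  have h : ∀ h : LOne V, Continuous fun s => field (kappa ε) s h := fun h =>
    continuous_field continuous_const
  exact (pairing β.integrable).continuous.comp
    ((propagator (kappa ε * T)).continuous.comp (((h _).sub (h _)).sub (h _)))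

theorem tendsto_kappa_mul (c : ℝ) : Tendsto (fun ε => kappa ε * c) (𝓝[>] 0) (𝓝 0) := by
  have : Continuous fun ε => kappa ε * c := by unfold kappa; fun_prop
  simpa [kappa] using (this.tendsto 0).mono_left nhdsWithin_le_nhds

theorem tendsto_norm_propagator_sub (c : ℝ) (h : LOne V) :
    Tendsto (fun ε => ‖propagator (kappa ε * c) h - h‖) (𝓝[>] 0) (𝓝 0) := by
  have := ((continuous_propagator_left h).tendsto 0).comp (tendsto_kappa_mul c)
  rw [propagator_zero] at this
  exact tendsto_iff_norm_sub_tendsto_zero.1 this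

variable {k} in
theorem tendsto_interaction (hk : k ≠ 0) (hβ : HasCompactSupport β) (T s : ℝ) :
    Tendsto (fun ε => interaction β f g k T ε s) (𝓝[>] 0)
      (𝓝 (-Complex.I * ∫ x, β x * (2 * (‖fourierEval (x - s • k) g‖ : ℂ) ^ 2 * fourierEval x f))) := by
  set a : V → ℂ := fun x => fourierEval x f
  set b : V → ℂ := fun x => fourierEval (x - s • k) g
  set e : ℝ → V → ℂ := fun ε x =>
    phase (kappa ε * s) (frequency k ε) * Real.fourierChar (-⟪frequency k ε, x⟫) with he
  have hcont : ∀ h : LOne V, Continuous fun x => fourierEval x h := fun h =>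
    continuous_fourier h.integrable
  have ha : Continuous a := hcont f
  have hb : Continuous b := (hcont g).comp (by fun_prop)
  have hce : ∀ ε, Continuous (e ε) := fun ε => continuous_const.mul
    (continuous_subtype_val.comp (Real.continuous_fourierChar.comp (by fun_prop)))
  have hne : ∀ ε x, ‖e ε x‖ = 1 := fun ε x => by
    rw [he, norm_mul, norm_phase, one_mul]; exact Circle.norm_coe _
  have hlim := tendsto_integral_cross (tendsto_frequency hk)
    (ρ := fun ε => phase (kappa ε * s) (frequency k ε)) (fun ε => norm_phase _ _)
    β.continuous hβ ha hb
  set Ψ : ℝ → V → ℂ := fun ε x => (‖a x + e ε x * b x‖ : ℂ) ^ 2 * (a x + e ε x * b x)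
    - (‖a x‖ : ℂ) ^ 2 * a x - (‖e ε x * b x‖ : ℂ) ^ 2 * (e ε x * b x) with hΨ
  have hΨc : ∀ ε, Continuous (Ψ ε) := fun ε => by
    have := hce ε
    fun_prop
  set X : ℝ → LOne V := fun ε => cross (propagator (kappa ε * s) f)
    (propagator (kappa ε * s) (shift (frequency k ε) g)) with hX
  set R := ‖f‖ + ‖g‖
  have hX3 : ∀ ε, ‖X ε‖ ≤ 3 * R ^ 3 := fun ε => (norm_cross_le _ _).trans (le_of_eq (by
    rw [LinearIsometry.norm_map, LinearIsometry.norm_map, norm_shift]))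
  obtain ⟨C, hC⟩ := exists_norm_pairing_propagator_sub_le β
  -- The remaining free evolution from `s` to `T` is negligible against the fixed test function,
  -- although `X ε` itself does not converge in `L¹`.
  have t1 : Tendsto (fun ε => pairing β.integrable (propagator (kappa ε * (T - s)) (X ε))
      - pairing β.integrable (X ε)) (𝓝[>] 0) (𝓝 0) := by
    refine squeeze_zero_norm (a := fun ε => |C| * |kappa ε * (T - s)| * (3 * R ^ 3))
      (fun ε => (hC _ _).trans ?_) ?_
    · gcongr
      · exact le_abs_self C
      · exact hX3 ε
    · simpa using ((tendsto_kappa_mul (T - s)).abs.const_mul |C|).mul_const (3 * R ^ 3)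
  -- Dispersion of the envelopes is negligible: once the boost is extracted by Galilean invariance,
  -- the propagator acts on fixed elements of `L¹` over a time tending to zero.
  have t2 : Tendsto (fun ε => pairing β.integrable (X ε) - ∫ x, β x * Ψ ε x) (𝓝[>] 0) (𝓝 0) := by
    have hD := (((tendsto_norm_propagator_sub s f).add (tendsto_norm_propagator_sub s g)).const_mul
      (6 * R ^ 2)).const_mul (∫ x, ‖β x‖)
    simp only [add_zero, mul_zero] at hD
    refine squeeze_zero_norm' ?_ hD
    filter_upwards [self_mem_nhdsWithin] with ε hε
    have hε0 : ε ≠ 0 := (Set.mem_Ioi.1 hε).ne'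
    have hi : Integrable fun x => β x * Ψ ε x :=
      (β.continuous.mul (hΨc ε)).integrable_of_hasCompactSupport hβ.mul_right
    rw [pairing_apply, ← integral_sub (integrable_mul_fourierEval β.integrable _) hi,
      ← integral_mul_const]
    refine norm_integral_le_of_norm_le (β.integrable.norm.mul_const _) (.of_forall fun x => ?_)
    rw [← mul_sub, norm_mul]
    gcongr
    have hg := norm_shift (frequency k ε) g
    have h1 : ‖fourierEval x (propagator (kappa ε * s) f)‖ ≤ ‖f‖ :=
      (norm_fourierEval_le _ _).trans (by rw [LinearIsometry.norm_map])
    have h2 : ‖fourierEval x (propagator (kappa ε * s) (shift (frequency k ε) g))‖ ≤ ‖g‖ :=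
      (norm_fourierEval_le _ _).trans (by rw [LinearIsometry.norm_map, hg])
    have h3 : ‖a x‖ ≤ ‖f‖ := norm_fourierEval_le _ _
    have h4 : ‖e ε x * b x‖ ≤ ‖g‖ := by
      rw [norm_mul, hne, one_mul]; exact norm_fourierEval_le _ _
    have hf0 := norm_nonneg f
    have hg0 := norm_nonneg g
    rw [hX, fourierEval_cross]
    refine (norm_cross_sub_cross_le (R := R) (by linarith) (by linarith) (by linarith)
      (by linarith) ((norm_add_le _ _).trans (add_le_add h1 h2))
      ((norm_add_le _ _).trans (add_le_add h3 h4))).trans ?_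
    gcongr
    · rw [← map_sub]; exact norm_fourierEval_le _ _
    · rw [fourierEval_propagator_shift_frequency k x s hε0, ← mul_sub, norm_mul]
      change ‖e ε x‖ * _ ≤ _
      rw [hne, one_mul, ← map_sub]
      exact norm_fourierEval_le _ _
  have t3 := ((t1.add t2).add hlim).const_mul (-Complex.I)
  rw [add_zero, zero_add] at t3
  refine t3.congr fun ε => ?_
  rw [interaction, propagator_field_cross, map_smul, smul_eq_mul]
  congr 1
  change _ - _ + (_ - ∫ x, β x * Ψ ε x) + ∫ x, β x * Ψ ε x = _
  ring

variable {k} in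
theorem tendsto_integral_interaction (hk : k ≠ 0) (hβ : HasCompactSupport β) (T : ℝ) :
    Tendsto (fun ε => ∫ s in (0 : ℝ)..T, interaction β f g k T ε s) (𝓝[>] 0)
      (𝓝 (∫ s in (0 : ℝ)..T, -Complex.I *
        ∫ x, β x * (2 * (‖fourierEval (x - s • k) g‖ : ℂ) ^ 2 * fourierEval x f))) :=
  intervalIntegral.tendsto_integral_filter_of_dominated_convergence
    (fun _ => (∫ x, ‖β x‖) * (3 * (‖f‖ + ‖g‖) ^ 3))
    (.of_forall fun ε => (continuous_interaction β f g k T ε).aestronglyMeasurable)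
    (.of_forall fun ε => .of_forall fun s _ => norm_interaction_le β f g k T ε s)
    intervalIntegrable_const
    (.of_forall fun s _ => tendsto_interaction β f g hk hβ T s)

end Limit

end

/-! ### Lower bounds: remainder after testing, duality and positivity of the overlap. -/

section

variable {V : Type*} [NormedAddCommGroup V] [InnerProductSpace ℝ V] [FiniteDimensional ℝ V]
  [MeasurableSpace V] [BorelSpace V]

open scoped SchwartzMap FourierTransform RealInnerProductSpace

theorem norm_pairing_sub_interaction_le (β : 𝓢(V, ℂ)) (f g : LOne V) (k : V) {T ε M : ℝ}
    (hT : 0 ≤ T) (hf : ‖f‖ ≤ 2 * M) (hg : ‖g‖ ≤ 2 * M) (hfg : ‖f + shift (frequency k ε) g‖ ≤ 2 * M)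
    {h h₁ h₂ : ℝ → LOne V} (hc : Continuous h) (hc₁ : Continuous h₁) (hc₂ : Continuous h₂)
    (hM : ∀ t, ‖h t‖ ≤ 2 * M) (hM₁ : ∀ t, ‖h₁ t‖ ≤ 2 * M) (hM₂ : ∀ t, ‖h₂ t‖ ≤ 2 * M)
    (heq : ∀ t ∈ Set.Icc 0 T, h t = (f + shift (frequency k ε) g)
      + ∫ s in (0 : ℝ)..t, field (kappa ε) s (h s))
    (heq₁ : ∀ t ∈ Set.Icc 0 T, h₁ t = f + ∫ s in (0 : ℝ)..t, field (kappa ε) s (h₁ s))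
    (heq₂ : ∀ t ∈ Set.Icc 0 T, h₂ t = shift (frequency k ε) g
      + ∫ s in (0 : ℝ)..t, field (kappa ε) s (h₂ s)) :
    ‖pairing β.integrable (propagator (kappa ε * T) (h T - h₁ T - h₂ T))
      - ∫ s in (0 : ℝ)..T, interaction β f g k T ε s‖
      ≤ (∫ x, ‖β x‖) * (288 * T ^ 2 * M ^ 5) := by
  have b := norm_sub_born_le hT hc hM hfg heq
  have b₁ := norm_sub_born_le hT hc₁ hM₁ hf heq₁
  have b₂ := norm_sub_born_le hT hc₂ hM₂ ((norm_shift _ _).trans_le hg) heq₂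
  set g' := shift (frequency k ε) g with hg'
  have hF : ∀ q : LOne V, IntervalIntegrable (fun s => field (kappa ε) s q) volume 0 T := fun q =>
    (continuous_field continuous_const).intervalIntegrable _ _
  set P : LOne V →L[ℂ] ℂ :=
    (pairing β.integrable).comp (propagator (kappa ε * T)).toContinuousLinearMap
  have hP : ∀ q, pairing β.integrable (propagator (kappa ε * T) q) = P q := fun q => rfl
  have hPle : ∀ q, ‖P q‖ ≤ (∫ x, ‖β x‖) * ‖q‖ := fun q => by
    rw [← hP]
    exact (norm_pairing_le _ _).trans (by rw [LinearIsometry.norm_map])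
  have e : ∫ s in (0 : ℝ)..T, interaction β f g k T ε s
      = P ((∫ s in (0 : ℝ)..T, field (kappa ε) s (f + g'))
        - (∫ s in (0 : ℝ)..T, field (kappa ε) s f) - ∫ s in (0 : ℝ)..T, field (kappa ε) s g') := by
    rw [← intervalIntegral.integral_sub (hF _) (hF _), ← intervalIntegral.integral_sub
      ((hF _).sub (hF _)) (hF _), ← P.intervalIntegral_comp_comm (((hF _).sub (hF _)).sub (hF _))]
    rfl
  rw [e, hP, ← map_sub]
  refine (hPle _).trans ?_
  gcongr
  set I := ∫ s in (0 : ℝ)..T, field (kappa ε) s (f + g')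
  set I₁ := ∫ s in (0 : ℝ)..T, field (kappa ε) s f
  set I₂ := ∫ s in (0 : ℝ)..T, field (kappa ε) s g'
  -- The data cancel, and three Born errors of `96T²M⁵` remain; hence 288.
  have e' : h T - h₁ T - h₂ T - (I - I₁ - I₂)
      = (h T - (f + g' + I)) - (h₁ T - (f + I₁)) - (h₂ T - (g' + I₂)) := by abel
  rw [e']
  have n₁ := norm_sub_le ((h T - (f + g' + I)) - (h₁ T - (f + I₁))) (h₂ T - (g' + I₂))
  have n₂ := norm_sub_le (h T - (f + g' + I)) (h₁ T - (f + I₁))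
  linarith

/-- A function of which the pairing with a test function is large has a large `Lᵖ` norm. -/
theorem ofReal_norm_integral_mul_le (β : 𝓢(V, ℂ)) {w : V → ℂ} (hw : AEStronglyMeasurable w)
    {p q : ℝ≥0∞} [hpq : ENNReal.HolderConjugate q p] :
    ENNReal.ofReal ‖∫ x, β x * w x‖ ≤ eLpNorm β q volume * eLpNorm w p volume := by
  rw [ofReal_norm]
  refine (enorm_integral_le_lintegral_enorm _).trans ?_
  rw [← eLpNorm_one_eq_lintegral_enorm]
  have := eLpNorm_smul_le_mul_eLpNorm (p := q) (q := p) (r := 1) hw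
    β.continuous.aestronglyMeasurable
  exact this

/-- Hölder with a fixed `β`. The constant depends on `β`, `p` and `m` only, so it is uniform in `ε`,
and `p = ∞` is covered with conjugate exponent 1. -/
theorem eLpNorm_pos_of_le {β : 𝓢(V, ℂ)} {p : ℝ≥0∞} (hp : 1 ≤ p) {m : ℝ} (hm : 0 < m) :
    ∃ c : ℝ≥0∞, 0 < c ∧ ∀ w : V → ℂ, AEStronglyMeasurable w → m ≤ ‖∫ x, β x * w x‖ →
      c ≤ eLpNorm w p volume := by
  obtain ⟨q, hq⟩ : ∃ q : ℝ≥0∞, ENNReal.HolderConjugate q p :=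
    ⟨_, (ENNReal.HolderConjugate.conjExponent hp).symm⟩
  have hβ := (β.memLp q volume).2
  refine ⟨ENNReal.ofReal m / eLpNorm β q volume,
    ENNReal.div_pos (ENNReal.ofReal_pos.2 hm).ne' hβ.ne, fun w hw hle => ?_⟩
  refine ENNReal.div_le_of_le_mul' ((ENNReal.ofReal_le_ofReal hle).trans ?_)
  exact ofReal_norm_integral_mul_le β hw

theorem integral_overlap_pos {β : V → ℝ} (hβ : Continuous β) (hβc : HasCompactSupport β)
    (hβ0 : β 0 ≠ 0) {T : ℝ} (hT : 0 < T) {k y : V} (hky : T • k = y) :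
    0 < ∫ s in (0 : ℝ)..T, ∫ x, β x ^ 2 * β (x - s • k + y) ^ 2 := by
  have hc : Continuous fun s : ℝ => ∫ x, β x ^ 2 * β (x - s • k + y) ^ 2 := by
    have h := continuous_parametric_integral_of_continuous (μ := (volume : Measure V))
      (f := fun (s : ℝ) x => β x ^ 2 * β (x - s • k + y) ^ 2) (by fun_prop) hβc.isCompact
    refine h.congr fun s => setIntegral_eq_integral_of_forall_compl_eq_zero fun x hx => ?_
    simp [image_eq_zero_of_notMem_tsupport hx]
  -- The integrand is continuous and nonnegative in `s`, so positivity at the endpoint `s = T`,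
  -- where the moving bump sits exactly on the fixed one, is enough.
  refine intervalIntegral.integral_pos hT hc.continuousOn
    (fun s _ => integral_nonneg fun x => by positivity) ⟨T, ⟨hT.le, le_rfl⟩, ?_⟩
  refine Continuous.integral_pos_of_hasCompactSupport_nonneg_nonzero (x := 0) (by fun_prop) ?_
    (fun x => by positivity) ?_
  · exact (hβc.comp_left (g := fun r : ℝ => r ^ 2) (by simp)).mul_right
  · simp [hky, hβ0]

end

/-! ### Choice of the amplitude and of the profiles. -/

section

open scoped SchwartzMap FourierTransform RealInnerProductSpace

variable {d : ℕ}

theorem IsSolution.hasUniqueSolution {T ε : ℝ} (hε : 0 < ε)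
    {u₀ : EuclideanSpace ℝ (Fin d) → ℂ} {u : ℝ → EuclideanSpace ℝ (Fin d) → ℂ}
    (hu : IsSolution T ε u₀ u) : HasUniqueSolution T ε u₀ :=
  ⟨⟨u, hu⟩, fun _ _ hv hw _ ht => hv.eq hε hw ht⟩

/-- The error is quintic and the signal cubic in `δ`, so one small `δ` meets both the existence
condition and the comparison. -/
theorem exists_small_amplitude {T m K J : ℝ} (hT : 0 < T) (hm : 0 < m) (hK : 0 ≤ K) (hJ : 0 < J) :
    ∃ δ : ℝ, 0 < δ ∧ 24 * (δ * m) ^ 2 * T ≤ 1 ∧ K * (288 * T ^ 2 * (δ * m) ^ 5) ≤ δ ^ 3 * J := by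
  set A := 24 * m ^ 2 * T
  set B := K * (288 * T ^ 2 * m ^ 5) / J with hB
  have hA0 : 0 ≤ A := by positivity
  have hB0 : 0 ≤ B := by positivity
  have hBJ : K * (288 * T ^ 2 * m ^ 5) = B * J := by rw [hB]; field_simp
  set δ := (1 + A + B)⁻¹
  have hδ : 0 < δ := by positivity
  have hδ1 : δ * (1 + A + B) = 1 := inv_mul_cancel₀ (by positivity)
  have hδA : 0 ≤ δ * A := by positivity
  have hδB : 0 ≤ δ * B := by positivity
  have hle : δ ≤ 1 := by nlinarith
  have key : ∀ X : ℝ, 0 ≤ X → δ * X ≤ 1 → δ ^ 2 * X ≤ 1 := fun X hX h => by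
    have : δ * (δ * X) ≤ 1 * 1 := by gcongr
    linarith
  refine ⟨δ, hδ, ?_, ?_⟩
  · have := key A hA0 (by nlinarith)
    calc _ = δ ^ 2 * A := by simp only [A]; ring
      _ ≤ 1 := this
  · have := key B hB0 (by nlinarith)
    calc _ = δ ^ 3 * J * (δ ^ 2 * B) := by
          rw [mul_pow]; linear_combination δ ^ 5 * hBJ
      _ ≤ δ ^ 3 * J * 1 := by gcongr
      _ = _ := mul_one _

theorem tsupport_bump_subset (b : ContDiffBump (0 : EuclideanSpace ℝ (Fin d))) (δ : ℝ)
    (y : EuclideanSpace ℝ (Fin d)) :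
    tsupport (fun x => (δ : ℂ) * (b (x + y) : ℂ)) ⊆ Metric.closedBall (-y) b.rOut := by
  refine closure_minimal (fun x hx => ?_) Metric.isClosed_closedBall
  by_contra h
  refine hx ?_
  have : b (x + y) = 0 := b.zero_of_le_dist (by
    rw [Metric.mem_closedBall, not_le, dist_eq_norm, sub_neg_eq_add] at h
    rw [dist_zero_right]
    exact h.le)
  simp [this]

theorem contDiff_bump (b : ContDiffBump (0 : EuclideanSpace ℝ (Fin d))) (δ : ℝ)
    (y : EuclideanSpace ℝ (Fin d)) : ContDiff ℝ ∞ fun x => (δ : ℂ) * (b (x + y) : ℂ) :=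
  contDiff_const.mul (Complex.ofRealCLM.contDiff.comp
    (b.contDiff.comp (contDiff_id.add contDiff_const)))

theorem hasCompactSupport_bump (b : ContDiffBump (0 : EuclideanSpace ℝ (Fin d))) (δ : ℝ)
    (y : EuclideanSpace ℝ (Fin d)) : HasCompactSupport fun x => (δ : ℂ) * (b (x + y) : ℂ) :=
  (isCompact_closedBall (-y) b.rOut).of_isClosed_subset (isClosed_tsupport _)
    (tsupport_bump_subset b δ y)

end

end WeakNLS

end

/-! ### The two colliding packets. -/

theorem proposition1p2 (d : ℕ) (hd : 1 ≤ d) (T : ℝ) (hT : 0 < T) :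
    ∃ (k₁ k₂ : EuclideanSpace ℝ (Fin d)) (α₁ α₂ : EuclideanSpace ℝ (Fin d) → ℂ),
      ContDiff ℝ ∞ α₁ ∧ HasCompactSupport α₁ ∧
      ContDiff ℝ ∞ α₂ ∧ HasCompactSupport α₂ ∧
      Disjoint (tsupport α₁) (tsupport α₂) ∧
      (∀ ε ∈ Set.Ioc (0 : ℝ) 1,
        WeakNLS.HasUniqueSolution T ε (WeakNLS.wkb ε α₁ k₁ + WeakNLS.wkb ε α₂ k₂) ∧
        WeakNLS.HasUniqueSolution T ε (WeakNLS.wkb ε α₁ k₁) ∧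
        WeakNLS.HasUniqueSolution T ε (WeakNLS.wkb ε α₂ k₂)) ∧
      ∀ u u₁ u₂ : ℝ → ℝ → EuclideanSpace ℝ (Fin d) → ℂ,
        (∀ ε ∈ Set.Ioc (0 : ℝ) 1,
          WeakNLS.IsSolution T ε (WeakNLS.wkb ε α₁ k₁ + WeakNLS.wkb ε α₂ k₂) (u ε) ∧
          WeakNLS.IsSolution T ε (WeakNLS.wkb ε α₁ k₁) (u₁ ε) ∧
          WeakNLS.IsSolution T ε (WeakNLS.wkb ε α₂ k₂) (u₂ ε)) →
        ∀ p : ℝ≥0∞, 2 ≤ p →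
          0 < liminf
            (fun ε : ℝ => ⨆ t ∈ Set.Icc (0 : ℝ) T,
              eLpNorm (u ε t - (u₁ ε t + u₂ ε t)) p volume)
            (𝓝[>] (0 : ℝ)) := by
  -- The outer radius is 1 and the centres are 3 apart, so the supports are disjoint; the velocity
  -- `y / T` brings the second packet from `-y` to the origin at time `T`.
  let b : ContDiffBump (0 : EuclideanSpace ℝ (Fin d)) := ⟨1 / 2, 1, by norm_num, by norm_num⟩
  set y : EuclideanSpace ℝ (Fin d) := EuclideanSpace.single (⟨0, hd⟩ : Fin d) (3 : ℝ)
  have hy : ‖y‖ = 3 := by simp [y]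
  set k : EuclideanSpace ℝ (Fin d) := T⁻¹ • y
  have hky : T • k = y := smul_inv_smul₀ hT.ne' y
  have hk : k ≠ 0 := fun h => by simp [← hky, h] at hy
  set β : SchwartzMap (EuclideanSpace ℝ (Fin d)) ℂ :=
    (WeakNLS.hasCompactSupport_bump b 1 0).toSchwartzMap (WeakNLS.contDiff_bump b 1 0)
  have hβ : ∀ x, β x = b x := fun x => by
    change ((1 : ℝ) : ℂ) * (b (x + 0) : ℂ) = b x
    simp
  have hβc : HasCompactSupport β := WeakNLS.hasCompactSupport_bump b 1 0
  obtain ⟨f₀, hf₀, hf₀e⟩ := WeakNLS.exists_fourierEval_eq (WeakNLS.contDiff_bump b 1 0)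
    (WeakNLS.hasCompactSupport_bump b 1 0)
  obtain ⟨g₀, hg₀, hg₀e⟩ := WeakNLS.exists_fourierEval_eq (WeakNLS.contDiff_bump b 1 y)
    (WeakNLS.hasCompactSupport_bump b 1 y)
  -- The extra 1 makes the data norms strictly less than `M = δ m`, as `exists_isSolution` requires,
  -- and ensures `m > 0`.
  set m := ‖f₀‖ + ‖g₀‖ + 1
  have hm : 0 < m := by positivity
  set J := ∫ s in (0 : ℝ)..T, ∫ x, b x ^ 2 * b (x - s • k + y) ^ 2
  have hJ : 0 < J := WeakNLS.integral_overlap_pos b.continuous b.hasCompactSupport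
    (b.pos_of_mem_ball (Metric.mem_ball_self b.rOut_pos)).ne' hT hky
  obtain ⟨δ, hδ, hδ1, hδ2⟩ := WeakNLS.exists_small_amplitude (K := ∫ x, ‖β x‖) hT hm
    (by positivity) hJ
  set M := δ * m with hM
  set f := (δ : ℂ) • f₀ with hf
  set g := (δ : ℂ) • g₀ with hg
  have hrf : WeakNLS.RapidDecay (f : EuclideanSpace ℝ (Fin d) → ℂ) :=
    (hf₀.const_smul (δ : ℂ)).congr_ae (Lp.coeFn_smul _ _).symm
  have hrg : WeakNLS.RapidDecay (g : EuclideanSpace ℝ (Fin d) → ℂ) :=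
    (hg₀.const_smul (δ : ℂ)).congr_ae (Lp.coeFn_smul _ _).symm
  have hfe : ∀ x, WeakNLS.fourierEval x f = δ * b (x + 0) := fun x => by
    rw [hf, map_smul, hf₀e]; simp
  have hge : ∀ x, WeakNLS.fourierEval x g = δ * b (x + y) := fun x => by
    rw [hg, map_smul, hg₀e]; simp
  have hnf : ‖f‖ = δ * ‖f₀‖ := by rw [hf, norm_smul, Complex.norm_of_nonneg hδ.le]
  have hng : ‖g‖ = δ * ‖g₀‖ := by rw [hg, norm_smul, Complex.norm_of_nonneg hδ.le]
  have hsum : ‖f‖ + ‖g‖ < M := by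
    rw [hnf, hng, hM]
    simp only [m]
    linarith
  have hM0 : 0 < M := by positivity
  have hfM : ‖f‖ < M := by linarith [norm_nonneg g]
  have hgM : ‖g‖ < M := by linarith [norm_nonneg f]
  set g' : ℝ → WeakNLS.LOne (EuclideanSpace ℝ (Fin d)) := fun ε =>
    WeakNLS.shift (WeakNLS.frequency k ε) g with hg'
  have hg'M : ∀ ε, ‖g' ε‖ < M := fun ε => by rwa [hg', WeakNLS.norm_shift]
  have hfg'M : ∀ ε, ‖f + g' ε‖ < M := fun ε =>
    (norm_add_le _ _).trans_lt (by rwa [hg', WeakNLS.norm_shift])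
  have hw₁ : ∀ ε, WeakNLS.wkb ε (fun x => (δ : ℂ) * (b (x + 0) : ℂ)) 0
      = fun x => WeakNLS.fourierEval x f := fun ε => by
    ext x
    rw [WeakNLS.wkb, hfe]
    simp
  have hw₂ : ∀ ε, WeakNLS.wkb ε (fun x => (δ : ℂ) * (b (x + y) : ℂ)) k
      = fun x => WeakNLS.fourierEval x (g' ε) := fun ε => by
    ext x
    rw [WeakNLS.wkb, WeakNLS.fourierEval_shift_frequency, hge]
  have hw : ∀ ε, WeakNLS.wkb ε (fun x => (δ : ℂ) * (b (x + 0) : ℂ)) 0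
      + WeakNLS.wkb ε (fun x => (δ : ℂ) * (b (x + y) : ℂ)) k
      = fun x => WeakNLS.fourierEval x (f + g' ε) := fun ε => by
    rw [hw₁, hw₂]
    ext x
    rw [Pi.add_apply, map_add]
  have hrg' : ∀ ε, WeakNLS.RapidDecay (g' ε : EuclideanSpace ℝ (Fin d) → ℂ) := fun ε => hrg.shift _
  have hrfg' : ∀ ε, WeakNLS.RapidDecay ((f + g' ε : WeakNLS.LOne _) :
      EuclideanSpace ℝ (Fin d) → ℂ) := fun ε =>
    (hrf.add (hrg' ε)).congr_ae (Lp.coeFn_add _ _).symm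
  refine ⟨0, k, _, _, WeakNLS.contDiff_bump b δ 0, WeakNLS.hasCompactSupport_bump b δ 0,
    WeakNLS.contDiff_bump b δ y, WeakNLS.hasCompactSupport_bump b δ y, ?_, fun ε hε => ?_,
    fun u u₁ u₂ hu p hp => ?_⟩
  · refine (Metric.closedBall_disjoint_closedBall ?_).mono (WeakNLS.tsupport_bump_subset b δ 0)
      (WeakNLS.tsupport_bump_subset b δ y)
    rw [neg_zero, dist_zero_left, norm_neg, hy]
    change (1 : ℝ) + 1 < 3
    norm_num
  · obtain ⟨_, _, _, _, s⟩ := WeakNLS.exists_isSolution hT.le hδ1 ε (hfg'M ε) (hrfg' ε)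
    obtain ⟨_, _, _, _, s₁⟩ := WeakNLS.exists_isSolution hT.le hδ1 ε hfM hrf
    obtain ⟨_, _, _, _, s₂⟩ := WeakNLS.exists_isSolution hT.le hδ1 ε (hg'M ε) (hrg' ε)
    rw [hw, hw₁, hw₂]
    exact ⟨s.hasUniqueSolution hε.1, s₁.hasUniqueSolution hε.1, s₂.hasUniqueSolution hε.1⟩
  · have hL := (WeakNLS.tendsto_integral_interaction β f g hk hβc T).norm
    have hLim : ‖∫ s in (0 : ℝ)..T, -Complex.I * ∫ x, β x *
        (2 * (‖WeakNLS.fourierEval (x - s • k) g‖ : ℂ) ^ 2 * WeakNLS.fourierEval x f)‖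
        = 2 * δ ^ 3 * J := by
      have e : ∀ s : ℝ, -Complex.I * ∫ x, β x *
          (2 * (‖WeakNLS.fourierEval (x - s • k) g‖ : ℂ) ^ 2 * WeakNLS.fourierEval x f)
          = (-Complex.I * (2 * δ ^ 3 : ℝ)) * ((∫ x, b x ^ 2 * b (x - s • k + y) ^ 2 : ℝ) : ℂ) :=
        fun s => by
          rw [← integral_complex_ofReal, ← integral_const_mul, ← integral_const_mul]
          refine integral_congr_ae (.of_forall fun x => ?_)
          simp only
          rw [hβ, hfe, hge, norm_mul, Complex.norm_of_nonneg hδ.le,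
            Complex.norm_of_nonneg b.nonneg, add_zero]
          push_cast
          ring
      simp only [e]
      rw [intervalIntegral.integral_const_mul, intervalIntegral.integral_ofReal, norm_mul, norm_mul,
        norm_neg, Complex.norm_I, one_mul, Complex.norm_of_nonneg hJ.le,
        Complex.norm_of_nonneg (by positivity)]
    rw [hLim] at hL
    have hδJ : 0 < δ ^ 3 * J := by positivity
    -- The limit is `2δ³J` and the Born error at most `δ³J`. Once the interaction exceeds `3/2 δ³J`,
    -- the tested difference is at least half of `δ³J`.
    obtain ⟨c, hc, hcle⟩ := WeakNLS.eLpNorm_pos_of_le (β := β) (one_le_two.trans hp)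
      (half_pos hδJ)
    refine hc.trans_le (le_liminf_of_le (by isBoundedDefault) ?_)
    filter_upwards [hL.eventually (lt_mem_nhds
      (show 3 / 2 * (δ ^ 3 * J) < 2 * δ ^ 3 * J by linarith)),
      Ioc_mem_nhdsGT (zero_lt_one' ℝ)] with ε hε1 hε
    -- The supremum over `t` is bounded below by its value at the arrival time `T`.
    refine le_trans ?_ (le_iSup₂ (f := fun t (_ : t ∈ Set.Icc (0 : ℝ) T) =>
      eLpNorm (u ε t - (u₁ ε t + u₂ ε t)) p volume) T ⟨hT.le, le_rfl⟩)
    have hTm : T ∈ Set.Icc (0 : ℝ) T := ⟨hT.le, le_rfl⟩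
    obtain ⟨hu, hu₁, hu₂⟩ := hu ε hε
    rw [hw] at hu
    rw [hw₁] at hu₁
    rw [hw₂] at hu₂
    obtain ⟨h, hhc, hhM, hheq, hs⟩ := WeakNLS.exists_isSolution hT.le hδ1 ε (hfg'M ε) (hrfg' ε)
    obtain ⟨h₁, hhc₁, hhM₁, hheq₁, hs₁⟩ := WeakNLS.exists_isSolution hT.le hδ1 ε hfM hrf
    obtain ⟨h₂, hhc₂, hhM₂, hheq₂, hs₂⟩ :=
      WeakNLS.exists_isSolution hT.le hδ1 ε (hg'M ε) (hrg' ε)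
    have hbound := WeakNLS.norm_pairing_sub_interaction_le β f g k hT.le (by linarith)
      (by linarith) (by linarith [hfg'M ε]) hhc hhc₁ hhc₂ hhM hhM₁ hhM₂ hheq hheq₁ hheq₂
    -- Uniqueness replaces the given solutions by the constructed ones, for which the Fourier side
    -- bounds hold.
    have hwT : u ε T - (u₁ ε T + u₂ ε T) = fun x => WeakNLS.fourierEval x
        (WeakNLS.propagator (WeakNLS.kappa ε * T) (h T - h₁ T - h₂ T)) := by
      rw [hu.eq hε.1 hs hTm, hu₁.eq hε.1 hs₁ hTm, hu₂.eq hε.1 hs₂ hTm]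
      ext x
      simp only [Pi.sub_apply, Pi.add_apply, map_sub]
      ring
    rw [hwT]
    refine hcle _ (WeakNLS.continuous_fourier (WeakNLS.LOne.integrable _)).aestronglyMeasurable ?_
    rw [← WeakNLS.pairing_apply β.integrable]
    have htri := norm_sub_norm_le (∫ s in (0 : ℝ)..T, WeakNLS.interaction β f g k T ε s)
      (WeakNLS.pairing β.integrable
        (WeakNLS.propagator (WeakNLS.kappa ε * T) (h T - h₁ T - h₂ T)))
    rw [norm_sub_rev] at htri
    linarith
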